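/- **Conventions.** Let $\Bbbk=\bigoplus_{i\in\mathbb Z}\Bbbk^i$ be a graded strongly commutative ring: $ba=(-1)^{|a||b|}ab$ for homogeneous $a,b$, and $c^2=0$ for every $c$ of odd degree. Modules are $\mathbb Z$-graded $\Bbbk$-modules (the two actions being related by $xa=(-1)^{|a||x|}ax$), $\otimes=\otimes_\Bbbk$, and maps are $\Bbbk$-linear and homogeneous. Maps are written on the right of their arguments, $fg$ means "first $f$, then $g$", they commute with the left action of $\Bbbk$, and $(x\otimes y).(f\otimes g)=(-1)^{|y||f|}\,xf\otimes yg$. The shift is $M[a]^i=M^{a+i}$, and $\sigma^a:M\to M[a]$ is the identity map, of degree $-a$; $\sigma$ is $\sigma^1: M\to M[1]$, or $M[-1]\to M$. A map $\Bbbk\to M$ is identified with the image of $1$. $1_M$ is abbreviated to $1$. Put $XT^{\geq}=\bigoplus_{n\ge 0}X^{\otimes n}$ with inclusions $\mathrm{inj}_n$ and projections $\mathrm{pr}_n$. **Algebras.** A *unit-complemented curved algebra* $(A,m_2,m_1,m_0,\eta,\mathsf v)$ is a graded module $A$ with maps $m_2:A\otimes A\to A$, $m_1:A\to A$, $m_0:\Bbbk\to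 A$ of degrees $0,1,2$ and $\eta:\Bbbk\to A$, $\mathsf v:A\to\Bbbk$ of degree $0$ such that $$(1\otimes m_2)m_2=(m_2\otimes1)m_2,\quad m_2m_1=(1\otimes m_1+m_1\otimes 1)m_2,\quad m_1^2=(m_0\otimes1-1\otimes m_0)m_2,\quad m_0m_1=0,$$ $$(1\otimes\eta)m_2=1=(\eta\otimes1)m_2,\quad \eta m_1=0,\quad \eta\mathsf v=1_\Bbbk .$$ A morphism $A\to B$ is a pair $(\mathsf f_1,\underline f)$ with $\mathsf f_1:A\to B$ of degree $0$ and $\underline f\in\Bbbk^1$ such that $m_2\mathsf f_1=(\mathsf f_1\otimes\mathsf f_1)m_2$, $m_1\mathsf f_1=\mathsf f_1m_1$, $m_0\mathsf f_1=m_0$, $\eta\mathsf f_1=\eta$. The composite of $f:A\to B$ and $g:B\to C$ is $(\mathsf f_1\mathsf g_1,\underline g+\underline f)$; the identity is $(\mathrm{id},0)$. This is the category $\mathrm{UCCAlg}$. **Coalgebras.** A *curved augmented coalgebra* $(C,\delta_2,\delta_1,\delta_0,\varepsilon,\mathsf w)$ is a graded module $C$ with maps $\delta_2:C\to C\otimes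 C$, $\delta_1:C\to C$, $\delta_0:C\to\Bbbk$ of degrees $0,1,2$ and $\varepsilon:C\to\Bbbk$, $\mathsf w:\Bbbk\to C$ of degree $0$ such that $$\delta_2(1\otimes\delta_2)=\delta_2(\delta_2\otimes1),\quad \delta_1\delta_2=\delta_2(1\otimes\delta_1+\delta_1\otimes1),\quad \delta_1^2=\delta_2(1\otimes\delta_0-\delta_0\otimes1),\quad \delta_1\delta_0=0,$$ $$\delta_2(1\otimes\varepsilon)=1=\delta_2(\varepsilon\otimes1),\quad \delta_1\varepsilon=0,\quad \mathsf w\varepsilon=1_\Bbbk,\quad \mathsf w\delta_2=\mathsf w\otimes\mathsf w,$$ and such that $\bar C=\operatorname{Ker}\varepsilon$ with $\bar\delta_2=\delta_2-1\otimes\mathsf w-\mathsf w\otimes1:\bar C\to\bar C\otimes\bar C$ is conilpotent: every $x\in\bar C$ is annihilated by some iterated comultiplication $\bar C\to\bar C^{\otimes n}$, $n>1$. A morphism $C\to D$ is a pair $(\mathsf g_1,\mathsf g_0)$, $\mathsf g_1:C\to D$ of degree $0$, $\mathsf g_0:C\to\Bbbk$ of degree $1$, such that $$\delta_2(\mathsf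 g_1\otimes\mathsf g_1)=\mathsf g_1\delta_2,\quad \delta_1\mathsf g_1+\delta_2(\mathsf g_0\otimes\mathsf g_1-\mathsf g_1\otimes\mathsf g_0)=\mathsf g_1\delta_1,\quad \delta_0-\delta_1\mathsf g_0-\delta_2(\mathsf g_0\otimes\mathsf g_0)=\mathsf g_1\delta_0,\quad \mathsf g_1\varepsilon=\varepsilon,\quad \mathsf w\mathsf g_1=\mathsf w.$$ The composite of $f:C\to D$ and $g:D\to E$ is $(\mathsf f_1\mathsf g_1,\ \mathsf f_0+\mathsf f_1\mathsf g_0)$; the identity is $(\mathrm{id},0)$. This is the category $\mathrm{CACoalg}$. **Bar construction.** For $A\in\mathrm{UCCAlg}$ let $\bar A=\operatorname{Ker}\mathsf v$, let $\mathrm{pr}:A[1]\to\bar A[1]$ be the shifted projection $x\mapsto x-(x\mathsf v)\eta$, and put $$b_0=m_0\sigma,\quad b_1=-\sigma^{-1}m_1\sigma,\quad b_2=-(\sigma^{-1}\otimes\sigma^{-1})m_2\sigma,\quad b_n=0\ (n>2),\quad \check b=(b_n)_{n\ge0}:A[1]T^\ge\to A[1].$$ $\mathrm{Bar}\,A=\bar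 A[1]T^{\ge}$ has the cut comultiplication $x_1\cdots x_n\mapsto\sum_{k=0}^n x_1\cdots x_k\otimes x_{k+1}\cdots x_n$, $\varepsilon=\mathrm{pr}_0$, $\mathsf w=\mathrm{inj}_0$; $\delta_1$ is the coderivation with components $\bar b_n=(\bar A[1]^{\otimes n}\hookrightarrow A[1]^{\otimes n}\xrightarrow{b_n}A[1]\xrightarrow{\mathrm{pr}}\bar A[1])$, that is, $\delta_1=\sum_{r+k+t=n}1^{\otimes r}\otimes\bar b_k\otimes1^{\otimes t}$ on $\bar A[1]^{\otimes n}$; and $$\delta_0=-\bigl(\bar A[1]T^{\ge}\hookrightarrow A[1]T^\ge\xrightarrow{\check b}A[1]\xrightarrow{\sigma^{-1}\mathsf v}\Bbbk\bigr).$$ For $f=(\mathsf f_1,\underline f):A\to B$ let $\check f:A[1]T^{\ge}\to B[1]$ have components $f_0=\underline f\,\eta\sigma$, $f_1=\sigma^{-1}\mathsf f_1\sigma$, $f_n=0$ for $n>1$. Then $\mathrm{Bar} f=(\mathsf g_1,\mathsf g_0)$, where $\mathsf g_1=\bigoplus_n\bar f_1^{\otimes n}$ with $\bar f_1=(\bar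 A[1]\hookrightarrow A[1]\xrightarrow{f_1}B[1]\xrightarrow{\mathrm{pr}}\bar B[1])$, and $\mathsf g_0=(\bar A[1]T^\ge\hookrightarrow A[1]T^{\ge}\xrightarrow{\check f}B[1]\xrightarrow{\sigma^{-1}\mathsf v}\Bbbk)$. **Cobar construction.** For $C\in\mathrm{CACoalg}$ let $\mathrm{pr}:C[-1]\to\bar C[-1]$ be the shifted projection $x\mapsto x-(x\varepsilon)\mathsf w$, let $\mathbf w=\mathsf w\sigma^{-1}\in C[-1]^1$, and put $$\xi_0=\sigma\delta_0,\quad \xi_1=-\sigma\delta_1\sigma^{-1},\quad \xi_2=-\sigma\delta_2(\sigma^{-1}\otimes\sigma^{-1}),\quad \xi_n=0\ (n>2).$$ $\mathrm{Cobar}\,C=\bar C[-1]T^\ge$ is the tensor algebra with unit $\eta=\mathrm{inj}_0$ and splitting $\mathsf v=\mathrm{pr}_0$; $m_1$ is the derivation with components $\bar\xi_n=(\bar C[-1]\hookrightarrow C[-1]\xrightarrow{\xi_n}C[-1]^{\otimes n}\xrightarrow{\mathrm{pr}^{\otimes n}}\bar C[-1]^{\otimes n})$, that is, on $\bar C[-1]^{\otimes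 n}$ it is $\sum_{r+1+t=n}\sum_k1^{\otimes r}\otimes\bar\xi_k\otimes1^{\otimes t}$; and $$m_0=-\mathbf w\otimes\mathbf w-\sum_{n\ge0}\mathbf w\xi_n ,$$ an element of $\bar C[-1]T^\ge$. For $g=(\mathsf g_1,\mathsf g_0):C\to D$, $\mathrm{Cobar}\,g=(\mathsf f_1,\underline f)$, where $\mathsf f_1$ is the algebra homomorphism with components $\bar C[-1]\hookrightarrow C[-1]\xrightarrow{\sigma\mathsf g_1\sigma^{-1}}D[-1]\xrightarrow{\mathrm{pr}}\bar D[-1]$ and $\bar C[-1]\hookrightarrow C[-1]\xrightarrow{\sigma\mathsf g_0}\Bbbk$, and $\underline f=\mathsf w\mathsf g_0\in\Bbbk^1$. **Theorem.** These formulas define functors $\mathrm{Bar}:\mathrm{UCCAlg}\to\mathrm{CACoalg}$ and $\mathrm{Cobar}:\mathrm{CACoalg}\to\mathrm{UCCAlg}$, and $\mathrm{Cobar}$ is left adjoint to $\mathrm{Bar}$: there is a bijection $$\mathrm{UCCAlg}(\mathrm{Cobar}\,C,A)\cong\mathrm{CACoalg}(C,\mathrm{Bar}\,A)$$ natural in $C$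 and $A$. -/

import Mathlib

open CategoryTheory
open scoped DirectSum TensorProduct

namespace CurvedBarCobar

universe u

set_option linter.unusedSectionVars false

/-! ### Signs, graded modules -/

/-- The Koszul sign `(-1) ^ i`. -/
def ksign (i : ℤ) : ℤ := (i.negOnePow : ℤ)

theorem ksign_add (i j : ℤ) : ksign (i + j) = ksign i * ksign j := by
  simp [ksign, Int.negOnePow_add]

theorem ksign_of_even {i : ℤ} (h : Even i) : ksign i = 1 := by
  simp [ksign, Int.negOnePow_even i h]

theorem ksign_of_odd {i : ℤ} (h : Odd i) : ksign i = -1 := by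
  simp [ksign, Int.negOnePow_odd i h]

theorem ksign_mul_self (i : ℤ) : ksign i * ksign i = 1 := by
  rcases Int.even_or_odd i with h | h <;> simp [ksign_of_even, ksign_of_odd, h]

@[simp] theorem ksign_zero : ksign 0 = 1 := by simp [ksign]

/-- A graded strongly commutative ring. -/
class StronglyCommutative {k : Type u} [Ring k] (𝒜 : ℤ → AddSubgroup k) : Prop where
  comm : ∀ {i j : ℤ} {a b : k}, a ∈ 𝒜 i → b ∈ 𝒜 j → b * a = ksign (i * j) • (a * b)
  sq_zero : ∀ {i : ℤ} {c : k}, Odd i → c ∈ 𝒜 i → c * c = 0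

/-- A criterion for a family of subgroups to be a grading. -/
theorem isInternal_of_proj {M : Type u} [AddCommGroup M] (deg : ℤ → AddSubgroup M)
    (p : ℤ → M →ₗ[ℤ] M)
    (h1 : ∀ i x, x ∈ deg i → p i x = x)
    (h2 : ∀ i j x, x ∈ deg j → i ≠ j → p i x = 0)
    (h3 : ∀ x, x ∈ AddSubgroup.closure (⋃ i, (deg i : Set M))) :
    DirectSum.IsInternal deg := by
  classical
  have key : ∀ (i : ℤ) (z : ⨁ i, deg i), p i (DirectSum.coeAddMonoidHom deg z) = z i := by
    intro i z
    induction z using DirectSum.induction_on with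
    | zero => simp
    | of j x =>
      rw [DirectSum.coeAddMonoidHom_of]
      by_cases h : i = j
      · subst h; rw [h1 _ _ x.2, DirectSum.of_eq_same]
      · rw [h2 i j _ x.2 h, DirectSum.of_eq_of_ne _ _ _ h]; rfl
    | add x y hx hy => rw [map_add, map_add, hx, hy, DirectSum.add_apply]; rfl
  constructor
  · intro z w h
    refine DirectSum.ext (fun i => Subtype.ext ?_)
    rw [← key, ← key, h]
  · intro x
    refine AddSubgroup.closure_induction (p := fun x _ => ∃ z, DirectSum.coeAddMonoidHom deg z = x)
      ?_ ⟨0, map_zero _⟩ ?_ ?_ (h3 x)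
    · intro x hx
      obtain ⟨i, hi⟩ := Set.mem_iUnion.1 hx
      exact ⟨DirectSum.of (fun i => deg i) i ⟨x, hi⟩, DirectSum.coeAddMonoidHom_of _ _ _⟩
    · rintro _ _ _ _ ⟨z, rfl⟩ ⟨w, rfl⟩; exact ⟨z + w, map_add _ _ _⟩
    · rintro _ _ ⟨z, rfl⟩; exact ⟨-z, map_neg _ _⟩

/-- A graded module over the graded ring `k = ⨁ 𝒜 i`. It is written as a left module; for
homogeneous `x`, `a` the right action is `x a = (-1)^(|x||a|) a x`. -/
structure GrMod {k : Type u} [Ring k] (𝒜 : ℤ → AddSubgroup k) where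
  carrier : Type u
  [grp : AddCommGroup carrier]
  [mod : Module k carrier]
  deg : ℤ → AddSubgroup carrier
  internal : DirectSum.IsInternal deg
  smul_mem : ∀ {i j : ℤ} {a : k} {x : carrier}, a ∈ 𝒜 i → x ∈ deg j → a • x ∈ deg (i + j)

attribute [instance] GrMod.grp GrMod.mod

section
variable {k : Type u} [Ring k] {𝒜 : ℤ → AddSubgroup k}

instance : CoeSort (GrMod 𝒜) (Type u) := ⟨GrMod.carrier⟩

namespace GrMod

noncomputable instance (M : GrMod 𝒜) : DirectSum.Decomposition M.deg :=
  M.internal.chooseDecomposition _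

/-- The homogeneous component of degree `i`. -/
noncomputable def proj (M : GrMod 𝒜) (i : ℤ) : M →ₗ[ℤ] M :=
  AddMonoidHom.toIntLinearMap
    { toFun := fun x => (DirectSum.decompose M.deg x i : M)
      map_zero' := by simp
      map_add' := by simp }

theorem proj_mem (M : GrMod 𝒜) (i : ℤ) (x : M) : M.proj i x ∈ M.deg i :=
  (DirectSum.decompose M.deg x i).2

theorem proj_same (M : GrMod 𝒜) {i : ℤ} {x : M} (h : x ∈ M.deg i) : M.proj i x = x :=
  DirectSum.decompose_of_mem_same _ h

theorem proj_ne (M : GrMod 𝒜) {i j : ℤ} {x : M} (h : x ∈ M.deg j) (hij : i ≠ j) :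
    M.proj i x = 0 :=
  DirectSum.decompose_of_mem_ne _ h (Ne.symm hij)

theorem hom_induction (M : GrMod 𝒜) {p : M → Prop} (h0 : p 0)
    (hh : ∀ i x, x ∈ M.deg i → p x) (ha : ∀ x y, p x → p y → p (x + y)) (x : M) : p x :=
  DirectSum.Decomposition.inductionOn M.deg h0 (fun m => hh _ m.1 m.2) ha x

/-- The additive endomorphism `x ↦ (-1)^(p|x|) x`. -/
noncomputable def sgn (M : GrMod 𝒜) (p : ℤ) : M →ₗ[ℤ] M :=
  AddMonoidHom.toIntLinearMap
    ((DirectSum.toAddMonoid (fun j => (ksign (p * j)) • (M.deg j).subtype)).comp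
      (DirectSum.decomposeAddEquiv M.deg).toAddMonoidHom)

theorem sgn_of_mem (M : GrMod 𝒜) (p : ℤ) {j : ℤ} {x : M} (h : x ∈ M.deg j) :
    M.sgn p x = ksign (p * j) • x := by
  show DirectSum.toAddMonoid (fun j => (ksign (p * j)) • (M.deg j).subtype)
    (DirectSum.decompose M.deg x) = _
  rw [DirectSum.decompose_of_mem _ h, DirectSum.toAddMonoid_of]
  rfl

/-- The base ring as a graded module. -/
abbrev unit (𝒜 : ℤ → AddSubgroup k) [GradedRing 𝒜] : GrMod 𝒜 where
  carrier := k
  deg := 𝒜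
  internal := DirectSum.Decomposition.isInternal 𝒜
  smul_mem := fun ha hx => SetLike.GradedMul.mul_mem ha hx

/-- The shift `M[a]`, with `M[a]^i = M^(a+i)`. -/
def shift (a : ℤ) (M : GrMod 𝒜) : GrMod 𝒜 where
  carrier := M.carrier
  deg := fun i => M.deg (a + i)
  internal := by
    refine isInternal_of_proj _ (fun i => M.proj (a + i)) (fun i x h => M.proj_same h)
      (fun i j x h hij => M.proj_ne h (by simpa using hij)) (fun x => ?_)
    refine M.hom_induction (zero_mem _) (fun i x h => AddSubgroup.subset_closure ?_)
      (fun _ _ => add_mem) x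
    exact Set.mem_iUnion.2 ⟨i - a, by simpa using h⟩
  smul_mem := fun {i j a' x} ha hx => by
    have := M.smul_mem ha hx
    rwa [show i + (a + j) = a + (i + j) by ring] at this

end GrMod

/-- Homogeneous `k`-linear maps of degree `d`. (They commute with the left action without
sign.) -/
structure GHom (d : ℤ) (M N : GrMod 𝒜) where
  lin : M →ₗ[k] N
  deg_mem : ∀ {i : ℤ} {x : M}, x ∈ M.deg i → lin x ∈ N.deg (i + d)

namespace GHom
variable {M N P : GrMod 𝒜} {d e r : ℤ}

instance : FunLike (GHom d M N) M N where
  coe f := f.lin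
  coe_injective := by
    rintro ⟨f, _⟩ ⟨g, _⟩ h
    congr 1
    exact DFunLike.coe_injective h

instance : LinearMapClass (GHom d M N) k M N where
  map_add f := f.lin.map_add
  map_smulₛₗ f := f.lin.map_smul

instance : AddMonoidHomClass (GHom d M N) M N where
  map_add f := f.lin.map_add
  map_zero f := f.lin.map_zero

@[ext] theorem ext {f g : GHom d M N} (h : ∀ x, f x = g x) : f = g := DFunLike.ext _ _ h

theorem map_mem (f : GHom d M N) {i : ℤ} {x : M} (h : x ∈ M.deg i) : f x ∈ N.deg (i + d) :=
  f.deg_mem h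

/-- The identity. -/
def id (M : GrMod 𝒜) : GHom 0 M M where
  lin := LinearMap.id
  deg_mem := fun h => by simpa using h

/-- Composition `g ∘ f` (first `f`, then `g`). -/
def comp (g : GHom e N P) (f : GHom d M N) : GHom (d + e) M P where
  lin := g.lin ∘ₗ f.lin
  deg_mem := fun hx => by
    rw [← add_assoc]
    exact g.map_mem (f.map_mem hx)

/-- The same map, regarded as a map of an equal degree. -/
def cast (f : GHom d M N) (h : d = r := by norm_num) : GHom r M N where
  lin := f.lin
  deg_mem := fun hx => h ▸ f.map_mem hx

instance : Zero (GHom d M N) := ⟨⟨0, fun _ => by simp⟩⟩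
instance : Add (GHom d M N) :=
  ⟨fun f g => ⟨f.lin + g.lin, fun h => add_mem (f.map_mem h) (g.map_mem h)⟩⟩
instance : Neg (GHom d M N) := ⟨fun f => ⟨-f.lin, fun h => neg_mem (f.map_mem h)⟩⟩

@[simp] theorem id_apply (x : M) : GHom.id M x = x := rfl
@[simp] theorem comp_apply (g : GHom e N P) (f : GHom d M N) (x : M) :
    g.comp f x = g (f x) := rfl
@[simp] theorem cast_apply (f : GHom d M N) (h : d = r) (x : M) : f.cast h x = f x := rfl
@[simp] theorem zero_apply (x : M) : (0 : GHom d M N) x = 0 := rfl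
@[simp] theorem add_apply (f g : GHom d M N) (x : M) : (f + g) x = f x + g x := rfl
@[simp] theorem neg_apply (f : GHom d M N) (x : M) : (-f) x = -f x := rfl

/-- The map `k → M`, `a ↦ a x`, of degree `d` given by an element `x` of degree `d`. -/
def ofElem [GradedRing 𝒜] (x : M) (h : x ∈ M.deg d) : GHom d (GrMod.unit 𝒜) M where
  lin := LinearMap.toSpanSingleton k M x
  deg_mem := fun ha => M.smul_mem ha h

/-- The map `σ^a : M → M[a]` of degree `-a` which is the identity on elements. -/
def sigma (a : ℤ) (M : GrMod 𝒜) : GHom (-a) M (M.shift a) where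
  lin := (LinearMap.id : M →ₗ[k] M)
  deg_mem := fun {i x} h => by
    show x ∈ M.deg (a + (i + -a))
    simpa using h

/-- The inverse map `M[a] → M` of degree `a`. -/
def sigmaInv (a : ℤ) (M : GrMod 𝒜) : GHom a (M.shift a) M where
  lin := (LinearMap.id : M →ₗ[k] M)
  deg_mem := fun {i x} h => by
    show x ∈ M.deg (i + a)
    rw [add_comm]
    exact h

theorem proj_map (f : GHom d M N) (i : ℤ) (x : M) : N.proj (i + d) (f x) = f (M.proj i x) := by
  refine M.hom_induction (p := fun x => N.proj (i + d) (f x) = f (M.proj i x)) (by simp)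
    (fun j x h => ?_) (fun x y hx hy => by simp only [map_add, hx, hy]) x
  by_cases hij : i = j
  · subst hij
    rw [M.proj_same h, N.proj_same (f.map_mem h)]
  · rw [M.proj_ne h hij, N.proj_ne (f.map_mem h) (by simpa using hij), map_zero]

/-- The kernel of a homogeneous map. -/
def ker (f : GHom d M N) : GrMod 𝒜 where
  carrier := LinearMap.ker f.lin
  deg := fun i => (M.deg i).comap (LinearMap.ker f.lin).subtype.toAddMonoidHom
  internal := by
    have hp : ∀ i (x : LinearMap.ker f.lin), M.proj i x ∈ LinearMap.ker f.lin := by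
      intro i x
      have h := f.proj_map i x
      rw [show f (x : M) = 0 from x.2, map_zero] at h
      exact h.symm
    refine isInternal_of_proj _ (fun i => AddMonoidHom.toIntLinearMap
      { toFun := fun x => ⟨M.proj i x, hp i x⟩
        map_zero' := by ext; simp
        map_add' := by intros; ext; simp }) ?_ ?_ ?_
    · intro i x h; exact Subtype.ext (M.proj_same h)
    · intro i j x h hij; exact Subtype.ext (M.proj_ne h hij)
    · classical
      intro x
      have hs := DirectSum.sum_support_decompose M.deg (x : M)
      have : x = ∑ i ∈ (DirectSum.decompose M.deg (x : M)).support,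
          (⟨M.proj i x, hp i x⟩ : LinearMap.ker f.lin) := by
        apply Subtype.ext
        rw [AddSubmonoidClass.coe_finsetSum]
        exact hs.symm
      rw [this]
      exact sum_mem fun i _ => AddSubgroup.subset_closure
        (Set.mem_iUnion.2 ⟨i, M.proj_mem i x⟩)
  smul_mem := fun ha hx => M.smul_mem ha hx

/-- The inclusion of the kernel. -/
def kerIncl (f : GHom d M N) : GHom 0 f.ker M where
  lin := (LinearMap.ker f.lin).subtype
  deg_mem := fun h => by rw [add_zero]; exact h

/-- Corestriction to a kernel. -/
def kerLift (f : GHom d M N) (g : GHom e P M) (h : ∀ x, f (g x) = 0) : GHom e P f.ker where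
  lin := g.lin.codRestrict _ h
  deg_mem := fun hx => g.map_mem hx

end GHom

/-! ### Tensor products -/

section tensor
variable [GradedRing 𝒜] [StronglyCommutative 𝒜]

theorem ring_induction {p : k → Prop} (h0 : p 0) (hh : ∀ i a, a ∈ 𝒜 i → p a)
    (ha : ∀ x y, p x → p y → p (x + y)) (x : k) : p x :=
  (GrMod.unit 𝒜).hom_induction h0 hh ha x

/-- The subgroup of `M ⊗[ℤ] N` generated by the elements `m a ⊗ n - m ⊗ a n` with `m`, `a`
homogeneous, where `m a = (-1)^(|m||a|) a m`. -/
def tensorRel₀ (M N : GrMod 𝒜) : AddSubgroup (M ⊗[ℤ] N) :=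
  AddSubgroup.closure {t | ∃ (i j : ℤ) (a : k) (m : M) (n : N), a ∈ 𝒜 i ∧ m ∈ M.deg j ∧
    t = ksign (i * j) • ((a • m) ⊗ₜ[ℤ] n) - m ⊗ₜ[ℤ] (a • n)}

/-- The same subgroup, as a `k`-submodule. -/
def tensorRel (M N : GrMod 𝒜) : Submodule k (M ⊗[ℤ] N) where
  carrier := tensorRel₀ M N
  add_mem' := fun h h' => add_mem h h'
  zero_mem' := zero_mem _
  smul_mem' := by
    intro c t ht
    refine AddSubgroup.closure_induction (p := fun t _ => c • t ∈ tensorRel₀ M N)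
      ?_ (by simp) (fun x y _ _ hx hy => by rw [smul_add]; exact add_mem hx hy)
      (fun x _ hx => by rw [smul_neg]; exact neg_mem hx) ht
    rintro _ ⟨i, j, a, m, n, ha, hm, rfl⟩
    refine ring_induction (𝒜 := 𝒜) (p := fun c => c • (ksign (i * j) • ((a • m) ⊗ₜ[ℤ] n) -
      m ⊗ₜ[ℤ] (a • n)) ∈ tensorRel₀ M N) (by rw [zero_smul]; exact zero_mem _) (fun l c hc => ?_)
      (fun x y hx hy => by rw [add_smul]; exact add_mem hx hy) c
    refine AddSubgroup.subset_closure ⟨i, l + j, a, c • m, n, ha, M.smul_mem hc hm, ?_⟩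
    rw [smul_sub, smul_comm c (ksign _), TensorProduct.smul_tmul', TensorProduct.smul_tmul',
      smul_smul, smul_smul, StronglyCommutative.comm hc ha, smul_assoc, TensorProduct.smul_tmul', TensorProduct.smul_tmul',
      smul_smul (ksign (i * (l + j))), ← ksign_add]
    congr 3
    rw [show i * (l + j) + l * i = i * j + 2 * (i * l) by ring, ksign_add,
      ksign_of_even (even_two_mul _), mul_one]

/-- The underlying module of the tensor product over `k`. -/
abbrev TensorCarrier (M N : GrMod 𝒜) : Type u := (M ⊗[ℤ] N) ⧸ tensorRel M N

/-- The pure tensor `x ⊗ y`. -/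
def tmk {M N : GrMod 𝒜} (x : M) (y : N) : TensorCarrier M N :=
  (tensorRel M N).mkQ (x ⊗ₜ[ℤ] y)

section
variable {M N : GrMod 𝒜}

theorem tmk_add_left (x x' : M) (y : N) : tmk (x + x') y = tmk x y + tmk x' y := by
  simp [tmk, TensorProduct.add_tmul]
theorem tmk_add_right (x : M) (y y' : N) : tmk x (y + y') = tmk x y + tmk x y' := by
  simp [tmk, TensorProduct.tmul_add]
theorem smul_tmk (a : k) (x : M) (y : N) : tmk (a • x) y = a • tmk x y := by
  rw [tmk, ← TensorProduct.smul_tmul', map_smul]; rfl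
theorem tmk_zero_left (y : N) : tmk (0 : M) y = 0 := by simp [tmk]
theorem tmk_zero_right (x : M) : tmk x (0 : N) = 0 := by simp [tmk]
theorem tmk_zsmul_left (c : ℤ) (x : M) (y : N) : tmk (c • x) y = c • tmk x y := by
  rw [tmk, ← TensorProduct.smul_tmul', map_zsmul]; rfl
theorem tmk_zsmul_right (c : ℤ) (x : M) (y : N) : tmk x (c • y) = c • tmk x y := by
  rw [tmk, TensorProduct.tmul_smul, map_zsmul]; rfl

theorem tmk_smul {i j : ℤ} {a : k} {x : M} (ha : a ∈ 𝒜 i) (hx : x ∈ M.deg j) (y : N) :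
    tmk x (a • y) = ksign (i * j) • (a • tmk x y) := by
  rw [← smul_tmk, ← tmk_zsmul_left, tmk, tmk, eq_comm, ← sub_eq_zero, ← map_sub]
  refine (Submodule.Quotient.mk_eq_zero _).2 ?_
  exact AddSubgroup.subset_closure ⟨i, j, a, x, y, ha, hx, by
    rw [TensorProduct.smul_tmul']⟩

theorem tensor_induction {p : TensorCarrier M N → Prop} (h0 : p 0)
    (hh : ∀ x y, p (tmk x y)) (ha : ∀ x y, p x → p y → p (x + y)) (t : TensorCarrier M N) :
    p t := by
  obtain ⟨t, rfl⟩ := (tensorRel M N).mkQ_surjective t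
  induction t with
  | zero => rw [map_zero]; exact h0
  | tmul x y => exact hh x y
  | add x y hx hy => rw [map_add]; exact ha _ _ hx hy

theorem tensor_hom_induction {p : TensorCarrier M N → Prop} (h0 : p 0)
    (hh : ∀ i j x y, x ∈ M.deg i → y ∈ N.deg j → p (tmk x y))
    (ha : ∀ x y, p x → p y → p (x + y)) (t : TensorCarrier M N) : p t := by
  refine tensor_induction h0 (fun x y => ?_) ha t
  refine M.hom_induction (p := fun x => p (tmk x y)) (by rw [tmk_zero_left]; exact h0)
    (fun i x hx => ?_) (fun _ _ h h' => by rw [tmk_add_left]; exact ha _ _ h h') x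
  exact N.hom_induction (p := fun y => p (tmk x y)) (by rw [tmk_zero_right]; exact h0)
    (fun j y hy => hh i j x y hx hy) (fun _ _ h h' => by rw [tmk_add_right]; exact ha _ _ h h') y

/-- Biadditive balanced maps factor through the tensor product. -/
def liftZ {Q : Type u} [AddCommGroup Q] (f : M →ₗ[ℤ] N →ₗ[ℤ] Q)
    (hf : ∀ {i j : ℤ} {a : k} {m : M} (n : N), a ∈ 𝒜 i → m ∈ M.deg j →
      ksign (i * j) • f (a • m) n = f m (a • n)) : TensorCarrier M N →ₗ[ℤ] Q :=
  AddMonoidHom.toIntLinearMap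
    (QuotientAddGroup.lift (tensorRel M N).toAddSubgroup
      (TensorProduct.lift f).toAddMonoidHom (by
        intro t ht
        refine AddSubgroup.closure_induction
          (p := fun t _ => (TensorProduct.lift f).toAddMonoidHom t = 0) ?_ (map_zero _)
          (fun x y _ _ hx hy => by rw [map_add, hx, hy, add_zero])
          (fun x _ hx => by rw [map_neg, hx, neg_zero]) ht
        rintro _ ⟨i, j, a, m, n, ha, hm, rfl⟩
        rw [map_sub, map_zsmul, sub_eq_zero]
        exact hf n ha hm))

theorem liftZ_tmk {Q : Type u} [AddCommGroup Q] (f : M →ₗ[ℤ] N →ₗ[ℤ] Q)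
    (hf : ∀ {i j : ℤ} {a : k} {m : M} (n : N), a ∈ 𝒜 i → m ∈ M.deg j →
      ksign (i * j) • f (a • m) n = f m (a • n)) (x : M) (y : N) :
    liftZ f hf (tmk x y) = f x y := rfl

/-- The `k`-linear version: `f` is `k`-linear in the first argument. -/
def lift {Q : Type u} [AddCommGroup Q] [Module k Q] (f : M →ₗ[k] N →ₗ[ℤ] Q)
    (hf : ∀ {i j : ℤ} {a : k} {m : M} (n : N), a ∈ 𝒜 i → m ∈ M.deg j →
      ksign (i * j) • f (a • m) n = f m (a • n)) : TensorCarrier M N →ₗ[k] Q :=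
  { liftZ (f.toAddMonoidHom.toIntLinearMap) hf with
    map_smul' := fun a t => by
      refine tensor_induction (p := fun t => liftZ (f.toAddMonoidHom.toIntLinearMap) hf (a • t) =
        a • liftZ (f.toAddMonoidHom.toIntLinearMap) hf t) (by simp) (fun x y => ?_)
        (fun x y hx hy => by rw [smul_add, map_add, map_add, hx, hy, smul_add]) t
      rw [← smul_tmk]
      show f (a • x) y = a • f x y
      rw [map_smul]; rfl }

theorem lift_tmk {Q : Type u} [AddCommGroup Q] [Module k Q] (f : M →ₗ[k] N →ₗ[ℤ] Q)
    (hf : ∀ {i j : ℤ} {a : k} {m : M} (n : N), a ∈ 𝒜 i → m ∈ M.deg j →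
      ksign (i * j) • f (a • m) n = f m (a • n)) (x : M) (y : N) :
    lift f hf (tmk x y) = f x y := rfl

theorem GrMod.proj_smul (M : GrMod 𝒜) {l : ℤ} {a : k} (ha : a ∈ 𝒜 l) (n : ℤ) (x : M) :
    M.proj n (a • x) = a • M.proj (n - l) x := by
  refine M.hom_induction (p := fun x => M.proj n (a • x) = a • M.proj (n - l) x) (by simp)
    (fun j x h => ?_) (fun x y hx hy => by simp only [map_add, hx, hy, smul_add]) x
  by_cases hj : n - l = j
  · subst hj
    have h' := M.smul_mem ha h
    rw [add_sub_cancel] at h'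
    rw [M.proj_same h, M.proj_same h']
  · rw [M.proj_ne h hj, M.proj_ne (M.smul_mem ha h) (by omega), smul_zero]

theorem GrMod.sgn_smul (M : GrMod 𝒜) (p : ℤ) {l : ℤ} {a : k} (ha : a ∈ 𝒜 l) (x : M) :
    M.sgn p (a • x) = ksign (p * l) • a • M.sgn p x := by
  refine M.hom_induction (p := fun x => M.sgn p (a • x) = ksign (p * l) • a • M.sgn p x)
    (by simp) (fun j x h => ?_) (fun x y hx hy => by simp only [map_add, hx, hy, smul_add]) x
  rw [M.sgn_of_mem p h, M.sgn_of_mem p (M.smul_mem ha h), mul_add, ksign_add, mul_smul,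
    smul_comm a]

/-- Auxiliary to `tensorProj`: `x ↦ (y ↦ ∑ⱼ xⱼ ⊗ y₍ₙ₋ⱼ₎)`. -/
noncomputable def tensorProjAux (M N : GrMod 𝒜) (n : ℤ) : M →ₗ[ℤ] N →ₗ[ℤ] TensorCarrier M N :=
  AddMonoidHom.toIntLinearMap
    ((DirectSum.toAddMonoid (fun j => AddMonoidHom.mk'
      (fun x : M.deg j => AddMonoidHom.toIntLinearMap
        (AddMonoidHom.mk' (fun y : N => tmk (x : M) (N.proj (n - j) y))
          (fun y y' => by rw [map_add, tmk_add_right])))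
      (fun x x' => by ext y; exact tmk_add_left _ _ _))).comp
    (DirectSum.decomposeAddEquiv M.deg).toAddMonoidHom)

theorem tensorProjAux_apply (n : ℤ) {j : ℤ} {x : M} (hx : x ∈ M.deg j) (y : N) :
    tensorProjAux M N n x y = tmk x (N.proj (n - j) y) := by
  have h : tensorProjAux M N n x = DirectSum.toAddMonoid (fun j => AddMonoidHom.mk'
      (fun x : M.deg j => AddMonoidHom.toIntLinearMap
        (AddMonoidHom.mk' (fun y : N => tmk (x : M) (N.proj (n - j) y))
          (fun y y' => by rw [map_add, tmk_add_right])))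
      (fun x x' => by ext y; exact tmk_add_left _ _ _)) (DirectSum.decompose M.deg x) := rfl
  rw [h, DirectSum.decompose_of_mem _ hx, DirectSum.toAddMonoid_of]
  rfl

/-- The homogeneous components of an element of the tensor product. -/
noncomputable def tensorProj (M N : GrMod 𝒜) (n : ℤ) : TensorCarrier M N →ₗ[ℤ] TensorCarrier M N :=
  liftZ (tensorProjAux M N n) (by
    intro i j a m y ha hm
    rw [tensorProjAux_apply n hm, tensorProjAux_apply n (M.smul_mem ha hm), N.proj_smul ha,
      tmk_smul ha hm, smul_tmk, show n - (i + j) = n - j - i by ring])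

theorem tensorProj_tmk (n : ℤ) {j : ℤ} {x : M} (hx : x ∈ M.deg j) (y : N) :
    tensorProj M N n (tmk x y) = tmk x (N.proj (n - j) y) :=
  tensorProjAux_apply n hx y
end

/-- The tensor product of graded modules over `k`; `x ⊗ y` has degree `|x| + |y|`. -/
abbrev GrMod.tensor (M N : GrMod 𝒜) : GrMod 𝒜 where
  carrier := TensorCarrier M N
  deg := fun n => AddSubgroup.closure
    {t | ∃ (i j : ℤ) (x : M) (y : N), x ∈ M.deg i ∧ y ∈ N.deg j ∧ i + j = n ∧ t = tmk x y}
  internal := by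
    refine isInternal_of_proj _ (tensorProj M N) ?_ ?_ ?_
    · intro n t ht
      refine AddSubgroup.closure_induction (p := fun t _ => tensorProj M N n t = t) ?_
        (map_zero _) (fun x y _ _ hx hy => by rw [map_add, hx, hy])
        (fun x _ hx => by rw [map_neg, hx]) ht
      rintro _ ⟨i, j, x, y, hx, hy, rfl, rfl⟩
      rw [tensorProj_tmk _ hx, N.proj_same (by rwa [add_sub_cancel_left])]
    · intro n l t ht hn
      refine AddSubgroup.closure_induction (p := fun t _ => tensorProj M N n t = 0) ?_
        (map_zero _) (fun x y _ _ hx hy => by rw [map_add, hx, hy, add_zero])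
        (fun x _ hx => by rw [map_neg, hx, neg_zero]) ht
      rintro _ ⟨i, j, x, y, hx, hy, rfl, rfl⟩
      rw [tensorProj_tmk _ hx, N.proj_ne hy (by omega), tmk_zero_right]
    · intro t
      refine tensor_hom_induction (zero_mem _) (fun i j x y hx hy => ?_)
        (fun _ _ => add_mem) t
      refine AddSubgroup.subset_closure (Set.mem_iUnion.2 ⟨i + j, ?_⟩)
      exact AddSubgroup.subset_closure ⟨i, j, x, y, hx, hy, rfl, rfl⟩
  smul_mem := by
    intro l n a t ha ht
    refine AddSubgroup.closure_induction
      (p := fun t _ => a • t ∈ AddSubgroup.closure _) ?_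
      (by rw [smul_zero]; exact zero_mem _)
      (fun x y _ _ hx hy => by rw [smul_add]; exact add_mem hx hy)
      (fun x _ hx => by rw [smul_neg]; exact neg_mem hx) ht
    rintro _ ⟨i, j, x, y, hx, hy, rfl, rfl⟩
    exact AddSubgroup.subset_closure
      ⟨l + i, j, a • x, y, M.smul_mem ha hx, hy, by ring, (smul_tmk _ _ _).symm⟩

/-- `x ⊗ y` as an element of the graded module `M ⊗ N`. -/
def tm {M N : GrMod 𝒜} (x : M) (y : N) : M.tensor N := tmk x y

theorem tm_mem {M N : GrMod 𝒜} {i j : ℤ} {x : M} {y : N} (hx : x ∈ M.deg i)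
    (hy : y ∈ N.deg j) : tm x y ∈ (M.tensor N).deg (i + j) :=
  AddSubgroup.subset_closure ⟨i, j, x, y, hx, hy, rfl, rfl⟩

/-- Homogeneous maps out of a tensor product. -/
def GHom.tensorLift {M N P : GrMod 𝒜} (d : ℤ) (f : M →ₗ[k] N →ₗ[ℤ] P)
    (hf : ∀ {i j : ℤ} {a : k} {m : M} (n : N), a ∈ 𝒜 i → m ∈ M.deg j →
      ksign (i * j) • f (a • m) n = f m (a • n))
    (hd : ∀ {i j : ℤ} {m : M} {n : N}, m ∈ M.deg i → n ∈ N.deg j →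
      f m n ∈ P.deg (i + j + d)) : GHom d (M.tensor N) P where
  lin := lift f hf
  deg_mem := by
    intro n t ht
    refine AddSubgroup.closure_induction (p := fun t _ => lift f hf t ∈ P.deg (n + d)) ?_
      (by rw [map_zero]; exact zero_mem _) (fun x y _ _ hx hy => by rw [map_add]; exact add_mem hx hy)
      (fun x _ hx => by rw [map_neg]; exact neg_mem hx) ht
    rintro _ ⟨i, j, x, y, hx, hy, rfl, rfl⟩
    rw [lift_tmk]
    exact hd hx hy

namespace GHom
variable {M M' N N' P : GrMod 𝒜} {d e p q r : ℤ}

theorem tensorLift_tm (f : M →ₗ[k] N →ₗ[ℤ] P) (hf) (hd) (x : M) (y : N) :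
    tensorLift d f hf hd (tm x y) = f x y := rfl

/-- The tensor product of homogeneous maps, with the Koszul sign of operators written on the
right: `x ⊗ y ↦ (-1)^(p|y|) f(x) ⊗ g(y)`, where `p` is the degree of `f`. -/
noncomputable def tmap (f : GHom p M M') (g : GHom q N N') :
    GHom (p + q) (M.tensor N) (M'.tensor N') :=
  tensorLift (p + q)
    (LinearMap.mk₂' k ℤ (fun (x : M) (y : N) => tm (f x) (g (N.sgn p y)))
      (fun x x' y => by rw [map_add]; exact tmk_add_left _ _ _)
      (fun a x y => by rw [map_smul]; exact smul_tmk _ _ _)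
      (fun x y y' => by rw [map_add, map_add]; exact tmk_add_right _ _ _)
      (fun c x y => by rw [map_zsmul, map_zsmul]; exact tmk_zsmul_right _ _ _))
    (by
      intro i j a m n ha hm
      show ksign (i * j) • tmk (f (a • m)) (g (N.sgn p n)) = tmk (f m) (g (N.sgn p (a • n)))
      rw [N.sgn_smul p ha, map_zsmul, map_smul, map_smul, tmk_zsmul_right, smul_tmk,
        tmk_smul ha (f.map_mem hm), smul_smul, ← ksign_add,
        show p * i + i * (j + p) = i * j + 2 * (p * i) by ring, ksign_add,
        ksign_of_even (even_two_mul _), mul_one])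
    (by
      intro i j m n hm hn
      show tm (f m) (g (N.sgn p n)) ∈ _
      rw [N.sgn_of_mem p hn, map_zsmul, show i + j + (p + q) = (i + p) + (j + q) by ring]
      exact tm_mem (f.map_mem hm) (zsmul_mem (g.map_mem hn) _))

theorem tmap_tm (f : GHom p M M') (g : GHom q N N') {j : ℤ} (x : M) {y : N}
    (hy : y ∈ N.deg j) : tmap f g (tm x y) = ksign (p * j) • tm (f x) (g y) := by
  show tmk (f x) (g (N.sgn p y)) = _
  rw [N.sgn_of_mem p hy, map_zsmul, tmk_zsmul_right]; rfl

/-- `k ⊗ M → M`, `a ⊗ x ↦ a x`. -/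
def lunit (M : GrMod 𝒜) : GHom 0 ((GrMod.unit 𝒜).tensor M) M :=
  tensorLift 0
    (LinearMap.mk₂' k ℤ (fun (a : k) (y : M) => a • y)
      (fun a b y => add_smul a b y) (fun a b y => mul_smul a b y) (fun a y y' => smul_add a y y')
      (fun c a y => smul_comm a c y))
    (by
      intro i j a b n ha hb
      show ksign (i * j) • (a * b) • n = b • a • n
      rw [smul_smul, StronglyCommutative.comm ha hb, smul_assoc])
    (by
      intro i j a y ha hy
      rw [add_zero]
      exact M.smul_mem ha hy)

theorem lunit_tm (a : GrMod.unit 𝒜) (x : M) : lunit M (tm a x) = a • x := rfl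

/-- The right action `x a`, as a function of `a`. -/
noncomputable def rightMul (M : GrMod 𝒜) (x : M) : GrMod.unit 𝒜 →ₗ[ℤ] M :=
  AddMonoidHom.toIntLinearMap
    ((DirectSum.toAddMonoid (fun i => AddMonoidHom.mk'
      (fun a : 𝒜 i => (a : k) • M.sgn i x) (fun a b => add_smul (a : k) b _))).comp
      (DirectSum.decomposeAddEquiv 𝒜).toAddMonoidHom)

theorem rightMul_of_mem_right {i : ℤ} (x : M) {a : GrMod.unit 𝒜} (ha : a ∈ 𝒜 i) :
    rightMul M x a = a • M.sgn i x := by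
  show DirectSum.toAddMonoid (fun i => AddMonoidHom.mk'
      (fun a : 𝒜 i => (a : k) • M.sgn i x) (fun a b => add_smul (a : k) b _))
      (DirectSum.decompose 𝒜 _) = _
  rw [DirectSum.decompose_of_mem _ ha, DirectSum.toAddMonoid_of]
  rfl

theorem rightMul_of_mem {i j : ℤ} {x : M} (hx : x ∈ M.deg j) {a : GrMod.unit 𝒜}
    (ha : a ∈ 𝒜 i) : rightMul M x a = ksign (i * j) • a • x := by
  rw [rightMul_of_mem_right x ha, M.sgn_of_mem i hx, smul_comm]

/-- `M ⊗ k → M`, `x ⊗ a ↦ x a`. -/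
noncomputable def runit (M : GrMod 𝒜) : GHom 0 (M.tensor (GrMod.unit 𝒜)) M :=
  tensorLift 0
    (LinearMap.mk₂' k ℤ (fun (x : M) (a : GrMod.unit 𝒜) => rightMul M x a)
      (fun x x' a => by
        refine (GrMod.unit 𝒜).hom_induction
          (p := fun a => rightMul M (x + x') a = rightMul M x a + rightMul M x' a) (by simp)
          (fun i a ha => ?_) (fun a b h h' => by simp only [map_add, h, h']; abel) a
        rw [rightMul_of_mem_right _ ha, rightMul_of_mem_right _ ha, rightMul_of_mem_right _ ha,
          map_add, smul_add])
      (fun c x a => by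
        refine (GrMod.unit 𝒜).hom_induction
          (p := fun a => rightMul M (c • x) a = c • rightMul M x a) (by simp)
          (fun i a ha => ?_) (fun a b h h' => by simp only [map_add, h, h', smul_add]) a
        rw [rightMul_of_mem_right _ ha, rightMul_of_mem_right _ ha]
        refine ring_induction (𝒜 := 𝒜)
          (p := fun c => a • M.sgn i (c • x) = c • a • M.sgn i x)
          (by simp) (fun l c hc => ?_)
          (fun b c hb hc => by rw [add_smul, map_add, smul_add, hb, hc, add_smul]) c
        rw [M.sgn_smul i hc, smul_comm _ (ksign _), smul_smul _ c,
          StronglyCommutative.comm hc ha, smul_assoc, smul_smul (ksign _), ← ksign_add,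
          ksign_of_even (by rw [mul_comm l i]; exact ⟨_, rfl⟩), one_smul, mul_smul])
      (fun x a b => map_add _ a b)
      (fun c x a => map_zsmul _ c a))
    (by
      intro i j a m b ha hm
      refine (GrMod.unit 𝒜).hom_induction
        (p := fun b => ksign (i * j) • rightMul M (a • m) b = rightMul M m (a • b)) (by simp)
        (fun l b hb => ?_) (fun b c h h' => by simp only [map_add, smul_add, h, h']) b
      rw [rightMul_of_mem (M.smul_mem ha hm) hb,
        rightMul_of_mem hm (show a • b ∈ 𝒜 (i + l) from (GrMod.unit 𝒜).smul_mem ha hb)]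
      show _ = ksign ((i + l) * j) • (a * b) • m
      rw [smul_smul (ksign _), ← ksign_add, smul_smul b,
        StronglyCommutative.comm ha hb, smul_assoc, smul_smul (ksign _), ← ksign_add,
        show i * j + l * (i + j) + i * l = (i + l) * j + 2 * (l * i) by ring, ksign_add,
        ksign_of_even (even_two_mul _), mul_one])
    (by
      intro i j x a hx ha
      show rightMul M x a ∈ _
      rw [rightMul_of_mem hx ha, add_zero, add_comm]
      exact zsmul_mem (M.smul_mem ha hx) _)

theorem runit_tm {i j : ℤ} {x : M} (hx : x ∈ M.deg j) {a : GrMod.unit 𝒜} (ha : a ∈ 𝒜 i) :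
    runit M (tm x a) = ksign (i * j) • a • x :=
  rightMul_of_mem hx ha

/-- The map `t ↦ x ⊗ t`, `N ⊗ P → (M ⊗ N) ⊗ P` (additive, and `k`-linear up to sign). -/
def assocAux (M N P : GrMod 𝒜) (x : M) :
    TensorCarrier N P →ₗ[ℤ] TensorCarrier (M.tensor N) P :=
  liftZ (LinearMap.mk₂ ℤ (fun (y : N) (z : P) => tmk (tm x y) z)
      (fun y y' z => by
        rw [show tm x (y + y') = tm x y + tm x y' from tmk_add_right x y y', tmk_add_left])
      (fun c y z => by
        rw [show tm x (c • y) = c • tm x y from tmk_zsmul_right c x y, tmk_zsmul_left])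
      (fun y z z' => tmk_add_right _ _ _)
      (fun c y z => tmk_zsmul_right _ _ _))
    (by
      intro i j a y z ha hy
      show ksign (i * j) • tmk (tm x (a • y)) z = tmk (tm x y) (a • z)
      refine M.hom_induction (p := fun x =>
        ksign (i * j) • tmk (tm x (a • y)) z = tmk (tm x y) (a • z)) ?_ (fun l x hx => ?_)
        (fun x x' h h' => ?_) x
      · rw [show tm (0 : M) (a • y) = 0 from tmk_zero_left _,
          show tm (0 : M) y = 0 from tmk_zero_left _, tmk_zero_left, tmk_zero_left, smul_zero]
      · rw [tmk_smul ha (tm_mem hx hy),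
          show tm x (a • y) = ksign (i * l) • (a • tm x y) from tmk_smul ha hx y,
          tmk_zsmul_left, smul_tmk, smul_smul, ← ksign_add, add_comm l j, mul_add]
      · rw [show tm (x + x') (a • y) = tm x (a • y) + tm x' (a • y) from tmk_add_left _ _ _,
          show tm (x + x') y = tm x y + tm x' y from tmk_add_left _ _ _, tmk_add_left,
          tmk_add_left, smul_add, h, h'])

theorem assocAux_tmk (x : M) (y : N) (z : P) :
    assocAux M N P x (tmk y z) = tmk (tm x y) z := rfl

/-- The associativity constraint `M ⊗ (N ⊗ P) → (M ⊗ N) ⊗ P`, `x ⊗ (y ⊗ z) ↦ (x ⊗ y) ⊗ z`. -/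
def assocInv (M N P : GrMod 𝒜) :
    GHom 0 (M.tensor (N.tensor P)) ((M.tensor N).tensor P) :=
  tensorLift 0
    (show M →ₗ[k] TensorCarrier N P →ₗ[ℤ] TensorCarrier (M.tensor N) P from
    LinearMap.mk₂' k ℤ
      (fun (x : M) (t : TensorCarrier N P) => assocAux M N P x t)
      (fun x x' t => by
        refine tensor_induction (p := fun t => assocAux M N P (x + x') t =
          assocAux M N P x t + assocAux M N P x' t) (by simp) (fun y z => ?_)
          (fun s t hs ht => by simp only [map_add, hs, ht]; abel) t
        rw [assocAux_tmk, assocAux_tmk, assocAux_tmk,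
          show tm (x + x') y = tm x y + tm x' y from tmk_add_left _ _ _, tmk_add_left])
      (fun a x t => by
        refine tensor_induction (p := fun t => assocAux M N P (a • x) t =
          a • assocAux M N P x t) (by simp) (fun y z => ?_)
          (fun s t hs ht => by simp only [map_add, hs, ht, smul_add]) t
        rw [assocAux_tmk, assocAux_tmk,
          show tm (a • x) y = a • tm x y from smul_tmk _ _ _, smul_tmk])
      (fun x t t' => map_add _ t t')
      (fun c x t => map_zsmul _ c t))
    (by
      intro i j a x t ha hx
      show ksign (i * j) • assocAux M N P (a • x) t = assocAux M N P x (a • t)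
      refine tensor_induction (p := fun t : TensorCarrier N P =>
          ksign (i * j) • assocAux M N P (a • x) t = assocAux M N P x (a • t)) (by simp)
          (fun y z => ?_) (fun s t hs ht => by simp only [map_add, smul_add, hs, ht]) t
      rw [← smul_tmk, assocAux_tmk, assocAux_tmk,
        show tm (a • x) y = a • tm x y from smul_tmk _ _ _,
        show tm x (a • y) = ksign (i * j) • (a • tm x y) from tmk_smul ha hx y, tmk_zsmul_left])
    (by
      intro i n x t hx ht
      show assocAux M N P x t ∈ ((M.tensor N).tensor P).deg (i + n + 0)
      rw [add_zero]
      refine AddSubgroup.closure_induction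
        (p := fun t _ => assocAux M N P x t ∈ ((M.tensor N).tensor P).deg (i + n)) ?_
        (by rw [map_zero]; exact zero_mem _)
        (fun x y _ _ hx hy => by rw [map_add]; exact add_mem hx hy)
        (fun x _ hx => by rw [map_neg]; exact neg_mem hx) ht
      rintro _ ⟨j, l, y, z, hy, hz, rfl, rfl⟩
      rw [assocAux_tmk, ← add_assoc]
      exact tm_mem (tm_mem hx hy) hz)

theorem assocInv_tm (x : M) (y : N) (z : P) :
    assocInv M N P (tm x (tm y z)) = tm (tm x y) z := rfl

end GHom
end tensor

/-! ### Direct sums, the tensor module `T X` -/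

section tensorAlgebra

/-- The direct sum of a sequence of graded modules. -/
abbrev GrMod.dsum (F : ℕ → GrMod 𝒜) : GrMod 𝒜 where
  carrier := ⨁ n, F n
  deg := fun i =>
    { carrier := {t | ∀ n, t n ∈ (F n).deg i}
      add_mem' := fun h h' n => by rw [DirectSum.add_apply]; exact add_mem (h n) (h' n)
      zero_mem' := fun n => by rw [DirectSum.zero_apply]; exact zero_mem _
      neg_mem' := fun {t} h n => neg_mem (h n) }
  internal := by
    refine isInternal_of_proj _
      (fun i => (DirectSum.map fun n => ((F n).proj i).toAddMonoidHom).toIntLinearMap) ?_ ?_ ?_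
    · intro i t ht
      refine DirectSum.ext (fun n => ?_)
      exact (DirectSum.map_apply _ _ _).trans ((F n).proj_same (ht n))
    · intro i j t ht hij
      refine DirectSum.ext (fun n => ?_)
      exact (DirectSum.map_apply _ _ _).trans ((F n).proj_ne (ht n) hij)
    · intro t
      induction t using DirectSum.induction_on with
      | zero => exact zero_mem _
      | add x y hx hy => exact add_mem hx hy
      | of n x =>
        refine (F n).hom_induction (p := fun x => DirectSum.of (fun n => (F n : Type u)) n x ∈
          AddSubgroup.closure _) (by rw [map_zero]; exact zero_mem _) (fun i x hx => ?_)
          (fun x y hx hy => by rw [map_add]; exact add_mem hx hy) x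
        refine AddSubgroup.subset_closure (Set.mem_iUnion.2 ⟨i, fun m => ?_⟩)
        by_cases h : m = n
        · subst h; rw [DirectSum.of_eq_same]; exact hx
        · rw [DirectSum.of_eq_of_ne _ _ _ h]; exact zero_mem _
  smul_mem := fun ha ht n => by
    rw [DirectSum.smul_apply]
    exact (F n).smul_mem ha (ht n)

namespace GHom
variable {F : ℕ → GrMod 𝒜} {P : GrMod 𝒜} {d : ℤ}

/-- The inclusion of a summand. -/
def inj (F : ℕ → GrMod 𝒜) (n : ℕ) : GHom 0 (F n) (GrMod.dsum F) where
  lin := DirectSum.lof k ℕ (fun n => (F n : Type u)) n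
  deg_mem := fun {i x} hx m => by
    show DirectSum.of (fun n => (F n : Type u)) n x m ∈ _
    rw [add_zero]
    by_cases h : m = n
    · subst h; rw [DirectSum.of_eq_same]; exact hx
    · rw [DirectSum.of_eq_of_ne _ _ _ h]; exact zero_mem _

/-- The projection to a summand. -/
def pr (F : ℕ → GrMod 𝒜) (n : ℕ) : GHom 0 (GrMod.dsum F) (F n) where
  lin := DirectSum.component k ℕ (fun n => (F n : Type u)) n
  deg_mem := fun {i x} hx => by rw [add_zero]; exact hx n

theorem dsum_induction {j : ℤ} {p : GrMod.dsum F → Prop} (h0 : p 0)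
    (hi : ∀ n (x : F n), x ∈ (F n).deg j → p (inj F n x))
    (ha : ∀ x y, p x → p y → p (x + y)) {t : GrMod.dsum F} (ht : t ∈ (GrMod.dsum F).deg j) :
    p t := by
  classical
  have h : t = ∑ n ∈ DFinsupp.support t, inj F n (t n) := (DirectSum.sum_support_of t).symm
  rw [h]
  exact Finset.sum_induction _ p ha h0 (fun n _ => hi n _ (ht n))

/-- The map out of a direct sum with given components. -/
def desc (f : ∀ n, GHom d (F n) P) : GHom d (GrMod.dsum F) P where
  lin := DirectSum.toModule k ℕ P (fun n => (f n).lin)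
  deg_mem := fun {i t} ht => by
    refine dsum_induction (p := fun t => DirectSum.toModule k ℕ P (fun n => (f n).lin) t ∈
      P.deg (i + d)) (by rw [map_zero]; exact zero_mem _) (fun n x hx => ?_)
      (fun x y hx hy => by rw [map_add]; exact add_mem hx hy) ht
    show DirectSum.toModule k ℕ P (fun n => (f n).lin)
      (DirectSum.lof k ℕ (fun n => (F n : Type u)) n x) ∈ _
    rw [DirectSum.toModule_lof]
    exact (f n).map_mem hx

theorem desc_inj (f : ∀ n, GHom d (F n) P) (n : ℕ) (x : F n) : desc f (inj F n x) = f n x := by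
  show DirectSum.toModule k ℕ P (fun n => (f n).lin)
    (DirectSum.lof k ℕ (fun n => (F n : Type u)) n x) = _
  rw [DirectSum.toModule_lof]
  rfl

end GHom

variable [GradedRing 𝒜] [StronglyCommutative 𝒜]

theorem one_mem_unit : (1 : k) ∈ (GrMod.unit 𝒜).deg 0 := SetLike.GradedOne.one_mem

/-- The tensor power `X^{⊗n}`: `X^{⊗0} = k` and `X^{⊗(n+1)} = X ⊗ X^{⊗n}`. -/
def GrMod.tpow (X : GrMod 𝒜) : ℕ → GrMod 𝒜
  | 0 => GrMod.unit 𝒜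
  | n + 1 => X.tensor (X.tpow n)

/-- The tensor module `T X = ⨁ X^{⊗n}`. -/
abbrev GrMod.T (X : GrMod 𝒜) : GrMod 𝒜 := GrMod.dsum X.tpow

namespace GHom
variable {X Y M N P : GrMod 𝒜} {d e : ℤ}

/-- `M → k ⊗ M`, `x ↦ 1 ⊗ x`. -/
def lunitInv (M : GrMod 𝒜) : GHom 0 M ((GrMod.unit 𝒜).tensor M) where
  lin :=
    { toFun := fun x => tm (1 : k) x
      map_add' := fun _ _ => tmk_add_right _ _ _
      map_smul' := fun a x => by
        refine ring_induction (𝒜 := 𝒜) (p := fun a =>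
          tmk (M := GrMod.unit 𝒜) (1 : k) (a • x) = a • tmk (M := GrMod.unit 𝒜) (1 : k) x)
          ?_ (fun i a ha => ?_) (fun a b h h' => ?_) a
        · rw [zero_smul, zero_smul, tmk_zero_right]
        · rw [tmk_smul ha one_mem_unit, mul_zero, ksign_zero, one_smul]
        · rw [add_smul, add_smul, tmk_add_right, h, h'] }
  deg_mem := fun {i x} hx => by
    rw [add_zero, ← zero_add i]
    exact tm_mem one_mem_unit hx

/-- `M → M ⊗ k`, `x ↦ x ⊗ 1`. -/
def runitInv (M : GrMod 𝒜) : GHom 0 M (M.tensor (GrMod.unit 𝒜)) where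
  lin :=
    { toFun := fun x => tm x (1 : k)
      map_add' := fun _ _ => tmk_add_left _ _ _
      map_smul' := fun _ _ => smul_tmk _ _ _ }
  deg_mem := fun hx => tm_mem hx one_mem_unit

/-- The inclusion `k = X^{⊗0} → T X`. -/
def injZero (X : GrMod 𝒜) : GHom 0 (GrMod.unit 𝒜) X.T := inj X.tpow 0

/-- The projection `T X → X^{⊗0} = k`. -/
def prZero (X : GrMod 𝒜) : GHom 0 X.T (GrMod.unit 𝒜) := pr X.tpow 0

/-- The inclusion `X ⊗ X^{⊗n} → T X`. -/
def injSucc (X : GrMod 𝒜) (n : ℕ) : GHom 0 (X.tensor (X.tpow n)) X.T := inj X.tpow (n + 1)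

/-- Left multiplication by `x ∈ X` on `T X`. -/
def consAux (X : GrMod 𝒜) (x : X) : X.T →ₗ[ℤ] X.T :=
  AddMonoidHom.toIntLinearMap (DirectSum.toAddMonoid fun n =>
    AddMonoidHom.mk' (fun t : X.tpow n => injSucc X n (tm x t))
      (fun t t' => (congrArg (injSucc X n) (tmk_add_right x t t')).trans (map_add _ _ _)))

theorem consAux_inj (x : X) (n : ℕ) (t : X.tpow n) :
    consAux X x (inj X.tpow n t) = injSucc X n (tm x t) := by
  show DirectSum.toAddMonoid (fun n => AddMonoidHom.mk' (fun t : X.tpow n => injSucc X n (tm x t))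
      (fun t t' => (congrArg (injSucc X n) (tmk_add_right x t t')).trans (map_add _ _ _)))
    (DirectSum.of (fun n => (X.tpow n : Type u)) n t) = _
  rw [DirectSum.toAddMonoid_of]
  rfl

theorem T_induction {p : X.T → Prop} (h0 : p 0) (hi : ∀ n t, p (inj X.tpow n t))
    (ha : ∀ x y, p x → p y → p (x + y)) (t : X.T) : p t :=
  DirectSum.induction_on t h0 hi ha

theorem consAux_add (x x' : X) (t : X.T) :
    consAux X (x + x') t = consAux X x t + consAux X x' t := by
  refine T_induction (p := fun t => consAux X (x + x') t = consAux X x t + consAux X x' t)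
    (by simp) (fun n t => ?_) (fun s t hs ht => by simp only [map_add, hs, ht]; abel) t
  rw [consAux_inj, consAux_inj, consAux_inj, ← map_add]
  exact congrArg _ (tmk_add_left _ _ _)

theorem consAux_smul (a : k) (x : X) (t : X.T) : consAux X (a • x) t = a • consAux X x t := by
  refine T_induction (p := fun t => consAux X (a • x) t = a • consAux X x t)
    (by simp) (fun n t => ?_) (fun s t hs ht => by simp only [map_add, hs, ht, smul_add]) t
  rw [consAux_inj, consAux_inj, ← map_smul]
  exact congrArg _ (smul_tmk _ _ _)

theorem consAux_smul_right {i j : ℤ} {a : k} {x : X} (ha : a ∈ 𝒜 i) (hx : x ∈ X.deg j)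
    (t : X.T) : consAux X x (a • t) = ksign (i * j) • a • consAux X x t := by
  refine T_induction (p := fun t => consAux X x (a • t) = ksign (i * j) • a • consAux X x t)
    (by simp) (fun n t => ?_) (fun s t hs ht => by simp only [map_add, hs, ht, smul_add]) t
  rw [← map_smul, consAux_inj, consAux_inj, ← map_smul, ← map_zsmul]
  exact congrArg _ (tmk_smul ha hx t)

/-- `X ⊗ T X → T X`, `x ⊗ (x₁ ⋯ xₙ) ↦ x x₁ ⋯ xₙ`. -/
def cons (X : GrMod 𝒜) : GHom 0 (X.tensor X.T) X.T :=
  tensorLift 0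
    (LinearMap.mk₂' k ℤ (fun (x : X) (t : X.T) => consAux X x t)
      consAux_add consAux_smul (fun x t t' => map_add _ t t') (fun c x t => map_zsmul _ c t))
    (by
      intro i j a x t ha hx
      show ksign (i * j) • consAux X (a • x) t = consAux X x (a • t)
      rw [consAux_smul_right ha hx, consAux_smul])
    (by
      intro i j x t hx ht
      rw [add_zero]
      refine dsum_induction (p := fun t => consAux X x t ∈ X.T.deg (i + j))
        (by rw [map_zero]; exact zero_mem _) (fun n t ht => ?_)
        (fun x y hx hy => by rw [map_add]; exact add_mem hx hy) ht
      have h := (inj X.tpow (n + 1)).map_mem (tm_mem hx ht)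
      rw [add_zero] at h
      rw [consAux_inj]
      exact h)

theorem cons_tm_inj (x : X) (n : ℕ) (t : X.tpow n) :
    cons X (tm x (inj X.tpow n t)) = injSucc X n (tm x t) := consAux_inj x n t

/-- Auxiliary to `mulT`: concatenation with a tensor of length `n` on the left. -/
def mulAux (X : GrMod 𝒜) : ∀ n : ℕ, X.tpow n →ₗ[k] X.T →ₗ[ℤ] X.T
  | 0 => (LinearMap.toSpanSingleton k (X.T →ₗ[ℤ] X.T) LinearMap.id : k →ₗ[k] _)
  | n + 1 => (lift (LinearMap.mk₂' k ℤ
      (fun (x : X) (t : X.tpow n) => consAux X x ∘ₗ mulAux X n t)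
      (fun x x' t => LinearMap.ext fun u => consAux_add _ _ _)
      (fun a x t => LinearMap.ext fun u => consAux_smul _ _ _)
      (fun x t t' => by rw [map_add, LinearMap.comp_add])
      (fun c x t => by rw [map_zsmul, LinearMap.comp_smul]))
      (by
        intro i j a x t ha hx
        refine LinearMap.ext fun u => ?_
        show ksign (i * j) • consAux X (a • x) (mulAux X n t u) =
          consAux X x (mulAux X n (a • t) u)
        rw [map_smul, LinearMap.smul_apply, consAux_smul_right ha hx, consAux_smul]) :
      TensorCarrier X (X.tpow n) →ₗ[k] X.T →ₗ[ℤ] X.T)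

theorem mulAux_zero (a : k) (u : X.T) : mulAux X 0 (show k from a) u = a • u := rfl

theorem mulAux_succ (n : ℕ) (x : X) (t : X.tpow n) (u : X.T) :
    mulAux X (n + 1) (tm x t) u = consAux X x (mulAux X n t u) := rfl

theorem mulAux_smul_right (n : ℕ) {i j : ℤ} {a : k} {t : X.tpow n} (ha : a ∈ 𝒜 i)
    (ht : t ∈ (X.tpow n).deg j) (u : X.T) :
    mulAux X n t (a • u) = ksign (i * j) • a • mulAux X n t u := by
  induction n generalizing j with
  | zero =>
    change t ∈ 𝒜 j at ht
    show (show k from t) • a • u = ksign (i * j) • a • (show k from t) • u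
    rw [smul_smul, smul_smul, StronglyCommutative.comm ha ht, smul_assoc]
  | succ n ih =>
    refine AddSubgroup.closure_induction (p := fun t _ => mulAux X (n + 1) t (a • u) =
      ksign (i * j) • a • mulAux X (n + 1) t u) ?_ ?_ ?_ ?_ ht
    · rintro _ ⟨l, m, x, s, hx, hs, rfl, rfl⟩
      show consAux X x (mulAux X n s (a • u)) = ksign _ • a • consAux X x (mulAux X n s u)
      rw [ih hs, map_zsmul, consAux_smul_right ha hx, smul_smul, ← ksign_add]
      congr 2; ring
    · simp [map_zero (mulAux X (n + 1))]
    · intro x y _ _ hx hy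
      simp only [map_add (mulAux X (n + 1)), LinearMap.add_apply, hx, hy, smul_add]
    · intro x _ hx
      simp only [map_neg (mulAux X (n + 1)), LinearMap.neg_apply, hx, smul_neg]

theorem consAux_mem {i j : ℤ} {x : X} {t : X.T} (hx : x ∈ X.deg i) (ht : t ∈ X.T.deg j) :
    consAux X x t ∈ X.T.deg (i + j) := by
  have h := (cons X).map_mem (tm_mem hx ht)
  rwa [add_zero] at h

theorem mulAux_mem (n : ℕ) {i j : ℤ} {t : X.tpow n} {u : X.T}
    (ht : t ∈ (X.tpow n).deg i) (hu : u ∈ X.T.deg j) : mulAux X n t u ∈ X.T.deg (i + j) := by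
  induction n generalizing i with
  | zero => exact X.T.smul_mem ht hu
  | succ n ih =>
    refine AddSubgroup.closure_induction
      (p := fun t _ => mulAux X (n + 1) t u ∈ X.T.deg (i + j)) ?_ ?_ ?_ ?_ ht
    · rintro _ ⟨l, m, x, s, hx, hs, rfl, rfl⟩
      rw [add_assoc]
      exact consAux_mem hx (ih hs)
    · rw [map_zero (mulAux X (n + 1))]; exact zero_mem _
    · intro x y _ _ hx hy
      rw [map_add (mulAux X (n + 1))]; exact add_mem hx hy
    · intro x _ hx
      rw [map_neg (mulAux X (n + 1))]; exact neg_mem hx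

/-- Auxiliary to `mulT`: concatenation as a curried map. -/
def mulLin (X : GrMod 𝒜) : X.T →ₗ[k] X.T →ₗ[ℤ] X.T :=
  DirectSum.toModule k ℕ (X.T →ₗ[ℤ] X.T) (mulAux X)

theorem mulLin_inj (n : ℕ) (t : X.tpow n) : mulLin X (inj X.tpow n t) = mulAux X n t := by
  show DirectSum.toModule k ℕ (X.T →ₗ[ℤ] X.T) (mulAux X)
    (DirectSum.lof k ℕ (fun n => (X.tpow n : Type u)) n t) = _
  rw [DirectSum.toModule_lof]

/-- The multiplication (concatenation) `T X ⊗ T X → T X` of the tensor algebra. -/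
def mulT (X : GrMod 𝒜) : GHom 0 (X.T.tensor X.T) X.T :=
  tensorLift 0 (mulLin X)
    (by
      intro i j a t u ha ht
      rw [map_smul (mulLin X), LinearMap.smul_apply]
      refine dsum_induction (p := fun t : X.T =>
        ksign (i * j) • a • mulLin X t u = mulLin X t (a • u)) ?_ (fun n t ht => ?_)
        (fun x y hx hy => ?_) ht
      · rw [map_zero (mulLin X), LinearMap.zero_apply, LinearMap.zero_apply, smul_zero, smul_zero]
      · rw [mulLin_inj, mulAux_smul_right n ha ht]
      · rw [map_add (mulLin X), LinearMap.add_apply, LinearMap.add_apply, smul_add, smul_add,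
          hx, hy])
    (by
      intro i j t u ht hu
      rw [add_zero]
      refine dsum_induction (p := fun t : X.T => mulLin X t u ∈ X.T.deg (i + j)) ?_
        (fun n t ht => ?_) (fun x y hx hy => ?_) ht
      · rw [map_zero (mulLin X)]; exact zero_mem _
      · rw [mulLin_inj]
        exact mulAux_mem n ht hu
      · rw [map_add (mulLin X)]; exact add_mem hx hy)

theorem mulT_tm (t u : X.T) : mulT X (tm t u) = mulLin X t u := rfl

theorem mulT_injZero (a : k) (u : X.T) :
    mulT X (tm (injZero X a) u) = a • u := by
  rw [mulT_tm]
  exact congrArg (fun f : X.T →ₗ[ℤ] X.T => f u) (mulLin_inj 0 a)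

theorem mulT_injSucc (n : ℕ) (x : X) (t : X.tpow n) (u : X.T) :
    mulT X (tm (injSucc X n (tm x t)) u) = cons X (tm x (mulT X (tm (inj X.tpow n t) u))) := by
  rw [mulT_tm, mulT_tm, mulLin_inj]
  exact congrArg (fun f : X.T →ₗ[ℤ] X.T => f u) (mulLin_inj (n + 1) (tm x t))

/-- The unit `1 ∈ k = X^{⊗0} ⊆ T X`. -/
def oneT (X : GrMod 𝒜) : X.T := injZero X 1

theorem oneT_mem (X : GrMod 𝒜) : oneT X ∈ X.T.deg 0 := (injZero X).map_mem one_mem_unit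

theorem oneT_tm_oneT_mem (X : GrMod 𝒜) :
    tm (oneT X) (oneT X) ∈ (X.T.tensor X.T).deg 0 := by
  have h := tm_mem (oneT_mem X) (oneT_mem X)
  rwa [add_zero] at h

/-- `X → T X`. -/
def inj₁ (X : GrMod 𝒜) : GHom 0 X X.T := ((inj X.tpow 1).comp (runitInv X)).cast

/-- `X ⊗ X → T X`. -/
noncomputable def inj₂ (X : GrMod 𝒜) : GHom 0 (X.tensor X) X.T :=
  ((inj X.tpow 2).comp (tmap (GHom.id X) (runitInv X))).cast

/-- `f^{⊗n}`, for `f` of degree `0`. -/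
noncomputable def tpowMap (f : GHom 0 X Y) : ∀ n : ℕ, GHom 0 (X.tpow n) (Y.tpow n)
  | 0 => GHom.id (GrMod.unit 𝒜)
  | n + 1 => (tmap f (tpowMap f n)).cast

/-- `T f : T X → T Y`, for `f` of degree `0`. -/
noncomputable def Tmap (f : GHom 0 X Y) : GHom 0 X.T Y.T :=
  desc fun n => ((inj Y.tpow n).comp (tpowMap f n)).cast

/-- The algebra homomorphism from `T X` to an algebra `(P, μ, η)` extending `f : X → P`. -/
noncomputable def algExt (μ : GHom 0 (P.tensor P) P) (η : P) (hη : η ∈ P.deg 0)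
    (f : GHom 0 X P) : GHom 0 X.T P :=
  desc fun n => go n
where
  /-- `x₁ ⊗ ⋯ ⊗ xₙ ↦ f(x₁) (f(x₂) ⋯ (f(xₙ) 1))`. -/
  go : ∀ n : ℕ, GHom 0 (X.tpow n) P
    | 0 => ofElem η hη
    | n + 1 => (μ.comp (tmap f (go n))).cast

/-- The derivation of `T X` extending `ξ : X → T X`; on `X^{⊗n}` it is
`∑ 1^{⊗r} ⊗ ξ ⊗ 1^{⊗t}`, the sum over `r + 1 + t = n`. -/
noncomputable def deriv (ξ : GHom d X X.T) : GHom d X.T X.T :=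
  desc fun n => go n
where
  /-- The restriction to `X^{⊗n}`: `D(x t) = x D(t) + ξ(x) t` up to the Koszul sign. -/
  go : ∀ n : ℕ, GHom d (X.tpow n) X.T
    | 0 => 0
    | n + 1 => ((cons X).comp (tmap (GHom.id X) (go n))).cast + ((mulT X).comp (tmap ξ (inj X.tpow n))).cast

/-- The cut comultiplication `x₁ ⋯ xₙ ↦ ∑ x₁ ⋯ xₖ ⊗ xₖ₊₁ ⋯ xₙ`, the sum over `0 ≤ k ≤ n`. -/
noncomputable def cut (X : GrMod 𝒜) : GHom 0 X.T (X.T.tensor X.T) :=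
  desc fun n => go n
where
  /-- The restriction to `X^{⊗n}`: `Δ(x t) = 1 ⊗ x t + x Δ(t)`. -/
  go : ∀ n : ℕ, GHom 0 (X.tpow n) (X.T.tensor X.T)
    | 0 => ofElem (tm (oneT X) (oneT X)) (oneT_tm_oneT_mem X)
    | n + 1 => head n + tail n (go n)
  /-- `x t ↦ 1 ⊗ x t`. -/
  head (n : ℕ) : GHom 0 (X.tensor (X.tpow n)) (X.T.tensor X.T) :=
    ((tmap (injZero X) (GHom.id X.T)).comp ((lunitInv X.T).comp (injSucc X n))).cast
  /-- `x t ↦ x Δ(t)`. -/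
  tail (n : ℕ) (Δ : GHom 0 (X.tpow n) (X.T.tensor X.T)) :
      GHom 0 (X.tensor (X.tpow n)) (X.T.tensor X.T) :=
    ((tmap (cons X) (GHom.id X.T)).comp
      ((assocInv X X.T X.T).comp (tmap (GHom.id X) Δ))).cast

/-- The coderivation of `T X` with components `b : T X → X`. It is the composite
`T X → T X ⊗ T X ⊗ T X → T X ⊗ X ⊗ T X → T X` of the iterated cut comultiplication, `1 ⊗ b ⊗ 1`
and concatenation, that is, `∑ 1^{⊗r} ⊗ bₘ ⊗ 1^{⊗t}`, the sum over `r + m + t = n`,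
on `X^{⊗n}`. -/
noncomputable def coderiv (b : GHom d X.T X) : GHom d X.T X.T :=
  ((mulT X).comp ((tmap (GHom.id X.T)
    ((cons X).comp ((tmap b (GHom.id X.T)).comp (cut X)))).comp (cut X))).cast

end GHom
end tensorAlgebra

/-! ### Curved algebras -/

section curved
variable (𝒜 : ℤ → AddSubgroup k) [GradedRing 𝒜] [StronglyCommutative 𝒜]

/-- The data of a unit-complemented curved algebra `(A, m₂, m₁, m₀, η, v)`. The maps
`m₀ : k → A` and `η : k → A` are given by the images of `1`. -/
structure AlgData where
  A : GrMod 𝒜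
  mul : GHom 0 (A.tensor A) A
  diff : GHom 1 A A
  curv : A
  curv_mem : curv ∈ A.deg 2
  one : A
  one_mem : one ∈ A.deg 0
  split : GHom 0 A (GrMod.unit 𝒜)

variable {𝒜}

/-- The axioms of a unit-complemented curved algebra. -/
structure AlgData.IsUCCAlg (A : AlgData 𝒜) : Prop where
  mul_assoc : ∀ x y z : A.A, A.mul (tm x (A.mul (tm y z))) = A.mul (tm (A.mul (tm x y)) z)
  leibniz : ∀ t : A.A.tensor A.A, A.diff (A.mul t) =
    A.mul (GHom.tmap (GHom.id A.A) A.diff t) + A.mul (GHom.tmap A.diff (GHom.id A.A) t)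
  diff_diff : ∀ x : A.A, A.diff (A.diff x) = A.mul (tm A.curv x) - A.mul (tm x A.curv)
  diff_curv : A.diff A.curv = 0
  mul_one : ∀ x : A.A, A.mul (tm x A.one) = x
  one_mul : ∀ x : A.A, A.mul (tm A.one x) = x
  diff_one : A.diff A.one = 0
  split_one : A.split A.one = (1 : k)

/-- The data of a morphism of unit-complemented curved algebras: a map `f₁` of degree `0` and a
`k`-linear map `k → k` of degree `1`, given by the image `und ∈ k¹` of `1`. -/
@[ext] structure AlgHomData (A B : AlgData 𝒜) where
  f₁ : GHom 0 A.A B.A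
  und : 𝒜 1

namespace AlgHomData
variable {A B C : AlgData 𝒜}

/-- The conditions on a morphism of unit-complemented curved algebras. -/
structure IsHom (f : AlgHomData A B) : Prop where
  map_mul : ∀ x y : A.A, f.f₁ (A.mul (tm x y)) = B.mul (tm (f.f₁ x) (f.f₁ y))
  map_diff : ∀ x : A.A, f.f₁ (A.diff x) = B.diff (f.f₁ x)
  map_curv : f.f₁ A.curv = B.curv
  map_one : f.f₁ A.one = B.one

/-- The identity `(id, 0)`. -/
def id (A : AlgData 𝒜) : AlgHomData A A := ⟨GHom.id A.A, 0⟩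

/-- The composite `h = (f₁ g₁, g + f)` of `f : A → B` and `g : B → C`. -/
def comp (f : AlgHomData A B) (g : AlgHomData B C) : AlgHomData A C :=
  ⟨(g.f₁.comp f.f₁).cast, g.und + f.und⟩

theorem isHom_id (A : AlgData 𝒜) : (id A).IsHom where
  map_mul _ _ := rfl
  map_diff _ := rfl
  map_curv := rfl
  map_one := rfl

theorem IsHom.comp {f : AlgHomData A B} {g : AlgHomData B C} (hf : f.IsHom) (hg : g.IsHom) :
    (f.comp g).IsHom where
  map_mul x y := by
    show g.f₁ (f.f₁ _) = C.mul (tm (g.f₁ (f.f₁ x)) (g.f₁ (f.f₁ y)))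
    rw [hf.map_mul, hg.map_mul]
  map_diff x := by
    show g.f₁ (f.f₁ _) = C.diff (g.f₁ (f.f₁ x))
    rw [hf.map_diff, hg.map_diff]
  map_curv := by
    show g.f₁ (f.f₁ _) = _
    rw [hf.map_curv, hg.map_curv]
  map_one := by
    show g.f₁ (f.f₁ _) = _
    rw [hf.map_one, hg.map_one]

end AlgHomData

variable (𝒜) in
/-- Unit-complemented curved algebras. -/
structure UCCAlg where
  data : AlgData 𝒜
  isUCCAlg : data.IsUCCAlg

namespace UCCAlg

/-- Morphisms of unit-complemented curved algebras. -/
@[ext] structure Hom (A B : UCCAlg 𝒜) where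
  data : AlgHomData A.data B.data
  isHom : data.IsHom

/-- The category of unit-complemented curved algebras. -/
instance : Category (UCCAlg 𝒜) where
  Hom := Hom
  id A := ⟨AlgHomData.id A.data, AlgHomData.isHom_id A.data⟩
  comp f g := ⟨f.data.comp g.data, f.isHom.comp g.isHom⟩
  id_comp _ := Hom.ext (AlgHomData.ext rfl (add_zero _))
  comp_id _ := Hom.ext (AlgHomData.ext rfl (zero_add _))
  assoc _ _ _ := Hom.ext (AlgHomData.ext rfl (add_assoc _ _ _).symm)

end UCCAlg

/-! ### Curved coalgebras -/

variable (𝒜) in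
/-- The data of a curved augmented coalgebra `(C, δ₂, δ₁, δ₀, ε, w)`. The augmentation
`w : k → C` is given by the image of `1`. -/
structure CoalgData where
  C : GrMod 𝒜
  comul : GHom 0 C (C.tensor C)
  codiff : GHom 1 C C
  cocurv : GHom 2 C (GrMod.unit 𝒜)
  counit : GHom 0 C (GrMod.unit 𝒜)
  aug : C
  aug_mem : aug ∈ C.deg 0

namespace CoalgData

/-- The axioms of a curved augmented coalgebra, without conilpotency. -/
structure IsCoaugmented (C : CoalgData 𝒜) : Prop where
  coassoc : ∀ x : C.C, GHom.assocInv C.C C.C C.C (GHom.tmap (GHom.id C.C) C.comul (C.comul x)) =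
    GHom.tmap C.comul (GHom.id C.C) (C.comul x)
  coleibniz : ∀ x : C.C, C.comul (C.codiff x) =
    GHom.tmap (GHom.id C.C) C.codiff (C.comul x) + GHom.tmap C.codiff (GHom.id C.C) (C.comul x)
  codiff_codiff : ∀ x : C.C, C.codiff (C.codiff x) =
    GHom.runit C.C (GHom.tmap (GHom.id C.C) C.cocurv (C.comul x)) -
    GHom.lunit C.C (GHom.tmap C.cocurv (GHom.id C.C) (C.comul x))
  cocurv_codiff : ∀ x : C.C, C.cocurv (C.codiff x) = 0
  comul_counit : ∀ x : C.C,
    GHom.runit C.C (GHom.tmap (GHom.id C.C) C.counit (C.comul x)) = x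
  counit_comul : ∀ x : C.C,
    GHom.lunit C.C (GHom.tmap C.counit (GHom.id C.C) (C.comul x)) = x
  counit_codiff : ∀ x : C.C, C.counit (C.codiff x) = 0
  counit_aug : C.counit C.aug = (1 : k)
  comul_aug : C.comul C.aug = tm C.aug C.aug

/-- `C̄ = Ker ε`. -/
abbrev bar (C : CoalgData 𝒜) : GrMod 𝒜 := C.counit.ker

/-- The projection `C → C̄`, `x ↦ x - ε(x) w`. -/
def barPr (C : CoalgData 𝒜) (h : C.counit C.aug = (1 : k)) : GHom 0 C.C C.bar :=
  GHom.kerLift C.counit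
    (GHom.id C.C + (-((GHom.ofElem C.aug C.aug_mem).comp C.counit)).cast) (by
      intro x
      show C.counit (x + -((C.counit x : k) • C.aug)) = 0
      rw [map_add, map_neg, map_smul, h]
      show (C.counit x : k) + -((C.counit x : k) * 1) = 0
      rw [mul_one, add_neg_cancel])

/-- `δ̄₂ = δ₂ - 1 ⊗ w - w ⊗ 1 : C̄ → C̄ ⊗ C̄`, written as the composite
`C̄ → C → C ⊗ C → C̄ ⊗ C̄`. -/
noncomputable def barComul (C : CoalgData 𝒜) (h : C.counit C.aug = (1 : k)) :
    GHom 0 C.bar (C.bar.tensor C.bar) :=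
  ((GHom.tmap (C.barPr h) (C.barPr h)).comp (C.comul.comp (GHom.kerIncl C.counit))).cast

/-- The iterated comultiplication `Δ̄⁽ⁿ⁺¹⁾ : C̄ → C̄^{⊗(n+1)}`. -/
noncomputable def iterComul (C : CoalgData 𝒜) (h : C.counit C.aug = (1 : k)) :
    ∀ n : ℕ, GHom 0 C.bar (C.bar.tpow (n + 1))
  | 0 => GHom.runitInv C.bar
  | n + 1 => ((GHom.tmap (GHom.id C.bar) (iterComul C h n)).comp (C.barComul h)).cast

/-- The axioms of a curved augmented coalgebra. -/
structure IsCACoalg (C : CoalgData 𝒜) : Prop extends IsCoaugmented C where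
  conilpotent : ∀ x : C.bar, ∃ n ≥ 1, C.iterComul counit_aug n x = 0

end CoalgData

/-- The data of a morphism of curved augmented coalgebras. -/
@[ext] structure CoalgHomData (C D : CoalgData 𝒜) where
  g₁ : GHom 0 C.C D.C
  g₀ : GHom 1 C.C (GrMod.unit 𝒜)

namespace CoalgHomData
variable {C D E : CoalgData 𝒜}

/-- The conditions on a morphism of curved augmented coalgebras. -/
structure IsHom (g : CoalgHomData C D) : Prop where
  map_comul : ∀ x : C.C, GHom.tmap g.g₁ g.g₁ (C.comul x) = D.comul (g.g₁ x)
  map_codiff : ∀ x : C.C, g.g₁ (C.codiff x) +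
    (GHom.lunit D.C (GHom.tmap g.g₀ g.g₁ (C.comul x)) -
      GHom.runit D.C (GHom.tmap g.g₁ g.g₀ (C.comul x))) = D.codiff (g.g₁ x)
  map_cocurv : ∀ x : C.C, C.cocurv x - g.g₀ (C.codiff x) -
    GHom.lunit (GrMod.unit 𝒜) (GHom.tmap g.g₀ g.g₀ (C.comul x)) = D.cocurv (g.g₁ x)
  map_counit : ∀ x : C.C, D.counit (g.g₁ x) = C.counit x
  map_aug : g.g₁ C.aug = D.aug

/-- The identity `(id, 0)`. -/
def id (C : CoalgData 𝒜) : CoalgHomData C C := ⟨GHom.id C.C, 0⟩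

/-- The composite `h = (f₁ g₁, f₀ + f₁ g₀)` of `f : C → D` and `g : D → E`. -/
def comp (f : CoalgHomData C D) (g : CoalgHomData D E) : CoalgHomData C E :=
  ⟨(g.g₁.comp f.g₁).cast, f.g₀ + (g.g₀.comp f.g₁).cast⟩

end CoalgHomData

end curved

namespace GHom
variable [GradedRing 𝒜] [StronglyCommutative 𝒜]
variable {M M' M'' N N' N'' P : GrMod 𝒜} {d e p q r : ℤ}

/-- Two homogeneous maps out of a tensor product agree if they agree on homogeneous pure
tensors. -/
theorem tensor_ext {f : GHom d (M.tensor N) P} {g : GHom e (M.tensor N) P}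
    (h : ∀ i j (x : M) (y : N), x ∈ M.deg i → y ∈ N.deg j → f (tm x y) = g (tm x y))
    (t : M.tensor N) : f t = g t := by
  refine tensor_hom_induction (p := fun t : M.tensor N => f t = g t) ?_ h ?_ t
  · rw [map_zero f, map_zero g]
  · intro x y hx hy
    rw [map_add f, map_add g, hx, hy]

theorem tmap_id_id (t : M.tensor N) : tmap (GHom.id M) (GHom.id N) t = t := by
  refine tensor_ext (f := tmap (GHom.id M) (GHom.id N)) (g := GHom.id (M.tensor N))
    (fun i j x y hx hy => ?_) t
  rw [tmap_tm _ _ _ hy, zero_mul, ksign_zero, one_smul]; rfl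

theorem tmap_comp (f : GHom 0 M M') (g : GHom 0 N N') (f' : GHom p M' M'')
    (g' : GHom q N' N'') (t : M.tensor N) :
    tmap f' g' (tmap f g t) = tmap ((f'.comp f).cast (r := p)) ((g'.comp g).cast (r := q)) t := by
  refine tensor_ext (f := (tmap f' g').comp (tmap f g)) 
    (g := tmap ((f'.comp f).cast (r := p)) ((g'.comp g).cast (r := q)))
    (fun i j x y hx hy => ?_) t
  have hy' := g.map_mem hy
  rw [comp_apply, tmap_tm _ _ _ hy, tmap_tm _ _ _ hy, zero_mul, ksign_zero, one_smul,
    tmap_tm _ _ _ hy', add_zero]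
  rfl

theorem tmap_add_left (f f' : GHom p M M') (g : GHom q N N') (t : M.tensor N) :
    tmap (f + f') g t = tmap f g t + tmap f' g t := by
  refine tensor_ext (f := tmap (f + f') g) (g := tmap f g + tmap f' g)
    (fun i j x y hx hy => ?_) t
  rw [add_apply, tmap_tm _ _ _ hy, tmap_tm _ _ _ hy, tmap_tm _ _ _ hy, ← smul_add]
  exact congrArg _ (tmk_add_left _ _ _)

theorem tmap_add_right (f : GHom p M M') (g g' : GHom q N N') (t : M.tensor N) :
    tmap f (g + g') t = tmap f g t + tmap f g' t := by
  refine tensor_ext (f := tmap f (g + g')) (g := tmap f g + tmap f g')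
    (fun i j x y hx hy => ?_) t
  rw [add_apply, tmap_tm _ _ _ hy, tmap_tm _ _ _ hy, tmap_tm _ _ _ hy, ← smul_add]
  exact congrArg _ (tmk_add_right _ _ _)

theorem tmap_zero_left (g : GHom q N N') (t : M.tensor N) :
    tmap (0 : GHom p M M') g t = 0 := by
  have h := tmap_add_left (0 : GHom p M M') 0 g t
  rw [show (0 + 0 : GHom p M M') = 0 from ext fun _ => add_zero _] at h
  exact left_eq_add.1 h

theorem tmap_zero_right (f : GHom p M M') (t : M.tensor N) :
    tmap f (0 : GHom q N N') t = 0 := by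
  have h := tmap_add_right f (0 : GHom q N N') 0 t
  rw [show (0 + 0 : GHom q N N') = 0 from ext fun _ => add_zero _] at h
  exact left_eq_add.1 h

theorem map_lunit_tmap (g : GHom q N' P) (f₀ : GHom p M (GrMod.unit 𝒜)) (f₁ : GHom 0 N N')
    (t : M.tensor N) :
    g (lunit N' (tmap f₀ f₁ t)) = lunit P (tmap f₀ ((g.comp f₁).cast (r := q)) t) := by
  refine tensor_ext (f := g.comp ((lunit N').comp (tmap f₀ f₁)))
    (g := (lunit P).comp (tmap f₀ ((g.comp f₁).cast (r := q)))) (fun i j x y hx hy => ?_) t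
  rw [comp_apply, comp_apply, comp_apply, tmap_tm _ _ _ hy, tmap_tm _ _ _ hy, map_zsmul, map_zsmul,
    map_zsmul, lunit_tm, lunit_tm, map_smul]
  rfl

theorem map_runit_tmap (g : GHom 0 M' P) (f₁ : GHom 0 M M') (f₀ : GHom p N (GrMod.unit 𝒜))
    (t : M.tensor N) :
    g (runit M' (tmap f₁ f₀ t)) = runit P (tmap ((g.comp f₁).cast (r := 0)) f₀ t) := by
  refine tensor_ext (f := g.comp ((runit M').comp (tmap f₁ f₀)))
    (g := (runit P).comp (tmap ((g.comp f₁).cast (r := 0)) f₀)) (fun i j x y hx hy => ?_) t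
  have hx' := f₁.map_mem hx
  have hx'' := g.map_mem hx'
  rw [add_zero] at hx' hx''
  rw [add_zero] at hx''
  rw [comp_apply, comp_apply, comp_apply, tmap_tm _ _ _ hy, tmap_tm _ _ _ hy, map_zsmul, map_zsmul,
    map_zsmul, cast_apply, comp_apply, runit_tm hx' (f₀.map_mem hy),
    runit_tm hx'' (f₀.map_mem hy), map_zsmul, map_smul]

theorem map_runit_tmap_unit (g : GHom 1 M' (GrMod.unit 𝒜)) (f₁ : GHom 0 M M')
    (f₀ : GHom 1 N (GrMod.unit 𝒜)) (t : M.tensor N) :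
    g (runit M' (tmap f₁ f₀ t)) =
      -lunit (GrMod.unit 𝒜) (tmap ((g.comp f₁).cast (r := 1)) f₀ t) := by
  refine tensor_ext (f := g.comp ((runit M').comp (tmap f₁ f₀)))
    (g := -((lunit (GrMod.unit 𝒜)).comp (tmap ((g.comp f₁).cast (r := 1)) f₀))) (fun i j x y hx hy => ?_) t
  have hx' := f₁.map_mem hx
  rw [add_zero] at hx'
  have hy' := f₀.map_mem hy
  rw [neg_apply, comp_apply, comp_apply, comp_apply, tmap_tm _ _ _ hy, tmap_tm _ _ _ hy,
    map_zsmul, map_zsmul, map_zsmul, cast_apply, comp_apply, runit_tm hx' hy', lunit_tm,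
    map_zsmul, map_smul]
  have hc : (f₀ y : k) * (g (f₁ x) : k) = ksign ((i + 1) * (j + 1)) •
      ((g (f₁ x) : k) * (f₀ y : k)) := StronglyCommutative.comm (g.map_mem hx') hy'
  show ksign (0 * j) • ksign ((j + 1) * i) • ((f₀ y : k) * (g (f₁ x) : k)) =
    -(ksign (1 * j) • ((g (f₁ x) : k) * (f₀ y : k)))
  rw [hc, zero_mul, ksign_zero, one_smul, smul_smul, ← ksign_add, one_mul,
    show (j + 1) * i + (i + 1) * (j + 1) = 2 * ((j + 1) * i) + (j + 1) by ring, ksign_add,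
    ksign_of_even (even_two_mul _), one_mul, ksign_add, ksign_of_odd odd_one, mul_neg_one, neg_smul]

end GHom

section curved
variable [GradedRing 𝒜] [StronglyCommutative 𝒜]

namespace CoalgHomData
variable {C D E : CoalgData 𝒜}

theorem isHom_id (C : CoalgData 𝒜) : (id C).IsHom where
  map_comul x := GHom.tmap_id_id _
  map_codiff x := by
    show C.codiff x + (GHom.lunit C.C (GHom.tmap (0 : GHom 1 _ _) (GHom.id C.C) (C.comul x)) -
      GHom.runit C.C (GHom.tmap (GHom.id C.C) (0 : GHom 1 _ _) (C.comul x))) = C.codiff x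
    rw [GHom.tmap_zero_left, GHom.tmap_zero_right, map_zero, map_zero, sub_zero, add_zero]
  map_cocurv x := by
    show C.cocurv x - (0 : GrMod.unit 𝒜) - GHom.lunit (GrMod.unit 𝒜)
      (GHom.tmap (0 : GHom 1 _ _) (0 : GHom 1 _ _) (C.comul x)) = C.cocurv x
    rw [GHom.tmap_zero_left, map_zero, sub_zero, sub_zero]
  map_counit _ := rfl
  map_aug := rfl

theorem IsHom.comp {f : CoalgHomData C D} {g : CoalgHomData D E} (hf : f.IsHom) (hg : g.IsHom) :
    (f.comp g).IsHom where
  map_comul x := by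
    show GHom.tmap ((g.g₁.comp f.g₁).cast (r := 0)) ((g.g₁.comp f.g₁).cast (r := 0)) (C.comul x) = E.comul (g.g₁ (f.g₁ x))
    rw [← hg.map_comul, ← hf.map_comul, GHom.tmap_comp]
  map_codiff x := by
    show g.g₁ (f.g₁ (C.codiff x)) +
      (GHom.lunit E.C (GHom.tmap (f.g₀ + (g.g₀.comp f.g₁).cast (r := 1)) ((g.g₁.comp f.g₁).cast (r := 0)) (C.comul x)) -
      GHom.runit E.C (GHom.tmap ((g.g₁.comp f.g₁).cast (r := 0)) (f.g₀ + (g.g₀.comp f.g₁).cast (r := 1))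
        (C.comul x))) = E.codiff (g.g₁ (f.g₁ x))
    rw [← hg.map_codiff, ← hf.map_codiff, ← hf.map_comul, GHom.tmap_comp, GHom.tmap_comp,
      GHom.tmap_add_left, GHom.tmap_add_right, map_add g.g₁, map_sub g.g₁, GHom.map_lunit_tmap,
      GHom.map_runit_tmap, map_add, map_add]
    abel
  map_cocurv x := by
    show C.cocurv x - (f.g₀ (C.codiff x) + g.g₀ (f.g₁ (C.codiff x))) -
      GHom.lunit (GrMod.unit 𝒜) (GHom.tmap (f.g₀ + (g.g₀.comp f.g₁).cast (r := 1))
        (f.g₀ + (g.g₀.comp f.g₁).cast (r := 1)) (C.comul x)) = E.cocurv (g.g₁ (f.g₁ x))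
    rw [← hg.map_cocurv, ← hf.map_cocurv, ← hf.map_codiff, ← hf.map_comul, GHom.tmap_comp,
      GHom.tmap_add_left, GHom.tmap_add_right, GHom.tmap_add_right, map_add g.g₀, map_sub g.g₀,
      GHom.map_lunit_tmap, GHom.map_runit_tmap_unit, map_add, map_add, map_add]
    abel
  map_counit x := by
    show E.counit (g.g₁ (f.g₁ x)) = _
    rw [hg.map_counit, hf.map_counit]
  map_aug := by
    show g.g₁ (f.g₁ _) = _
    rw [hf.map_aug, hg.map_aug]

end CoalgHomData

variable (𝒜) in
/-- Curved augmented coalgebras. -/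
structure CACoalg where
  data : CoalgData 𝒜
  isCACoalg : data.IsCACoalg

namespace CACoalg

/-- Morphisms of curved augmented coalgebras. -/
@[ext] structure Hom (C D : CACoalg 𝒜) where
  data : CoalgHomData C.data D.data
  isHom : data.IsHom

/-- The category of curved augmented coalgebras. -/
instance : Category (CACoalg 𝒜) where
  Hom := Hom
  id C := ⟨CoalgHomData.id C.data, CoalgHomData.isHom_id C.data⟩
  comp f g := ⟨f.data.comp g.data, f.isHom.comp g.isHom⟩
  id_comp f := Hom.ext (CoalgHomData.ext rfl (GHom.ext fun x => zero_add (f.data.g₀ x)))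
  comp_id f := Hom.ext (CoalgHomData.ext rfl (GHom.ext fun x => add_zero (f.data.g₀ x)))
  assoc f g h := Hom.ext (CoalgHomData.ext rfl (GHom.ext fun x =>
    add_assoc (f.data.g₀ x) (g.data.g₀ (f.data.g₁ x)) (h.data.g₀ (g.data.g₁ (f.data.g₁ x)))))

end CACoalg
end curved

/-! ### The bar construction -/

section barCobar
variable [GradedRing 𝒜] [StronglyCommutative 𝒜]

namespace AlgData

/-- `b₀ = m₀ σ : k → A[1]`. -/
def b₀ (A : AlgData 𝒜) : GHom 1 (GrMod.unit 𝒜) (A.A.shift 1) :=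
  ((GHom.sigma 1 A.A).comp (GHom.ofElem A.curv A.curv_mem)).cast

/-- `b₁ = -σ⁻¹ m₁ σ : A[1] → A[1]`. -/
def b₁ (A : AlgData 𝒜) : GHom 1 (A.A.shift 1) (A.A.shift 1) :=
  (-((GHom.sigma 1 A.A).comp (A.diff.comp (GHom.sigmaInv 1 A.A)))).cast

/-- `b₂ = (σ ⊗ σ)⁻¹ m₂ σ = -(σ⁻¹ ⊗ σ⁻¹) m₂ σ : A[1] ⊗ A[1] → A[1]`. -/
noncomputable def b₂ (A : AlgData 𝒜) :
    GHom 1 ((A.A.shift 1).tensor (A.A.shift 1)) (A.A.shift 1) :=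
  (-((GHom.sigma 1 A.A).comp (A.mul.comp
    (GHom.tmap (GHom.sigmaInv 1 A.A) (GHom.sigmaInv 1 A.A))))).cast

/-- The map `T(A[1]) → A[1]` with components `b₀`, `b₁`, `b₂` and `0` on `A[1]^{⊗n}`, `n > 2`. -/
noncomputable def bCheck (A : AlgData 𝒜) : GHom 1 (A.A.shift 1).T (A.A.shift 1) :=
  GHom.desc fun n => match n with
    | 0 => A.b₀
    | 1 => (A.b₁.comp (GHom.runit (A.A.shift 1))).cast
    | 2 => (A.b₂.comp (GHom.tmap (GHom.id (A.A.shift 1)) (GHom.runit (A.A.shift 1)))).cast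
    | _ + 3 => 0

/-- The shifted splitting `σ⁻¹ v : A[1] → k`. -/
def shiftSplit (A : AlgData 𝒜) : GHom 1 (A.A.shift 1) (GrMod.unit 𝒜) :=
  (A.split.comp (GHom.sigmaInv 1 A.A)).cast

/-- `Ā = Ker v`. -/
abbrev bar (A : AlgData 𝒜) : GrMod 𝒜 := A.split.ker

/-- The projection `A → Ā`, `x ↦ x - v(x) 1`. -/
def barPr (A : AlgData 𝒜) (h : A.split A.one = (1 : k)) : GHom 0 A.A A.bar :=
  GHom.kerLift A.split
    (GHom.id A.A + (-((GHom.ofElem A.one A.one_mem).comp A.split)).cast) (by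
      intro x
      show A.split (x + -((A.split x : k) • A.one)) = 0
      rw [map_add, map_neg, map_smul, h]
      show (A.split x : k) + -((A.split x : k) * 1) = 0
      rw [mul_one, add_neg_cancel])

/-- The inclusion `Ā[1] → A[1]`. -/
def shiftIncl (A : AlgData 𝒜) : GHom 0 (A.bar.shift 1) (A.A.shift 1) :=
  ((GHom.sigma 1 A.A).comp ((GHom.kerIncl A.split).comp (GHom.sigmaInv 1 A.bar))).cast

/-- The projection `A[1] → Ā[1]`. -/
def shiftPr (A : AlgData 𝒜) (h : A.split A.one = (1 : k)) :
    GHom 0 (A.A.shift 1) (A.bar.shift 1) :=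
  ((GHom.sigma 1 A.bar).comp ((A.barPr h).comp (GHom.sigmaInv 1 A.A))).cast

end AlgData

/-- The map `f̌ : T(A[1]) → B[1]` with components `f₀ = (1 ↦ und · 1_B) σ`, `f₁` (shifted), and
`0` on `A[1]^{⊗n}`, `n > 1`. -/
noncomputable def AlgHomData.fCheck {A B : AlgData 𝒜} (f : AlgHomData A B) :
    GHom 0 (A.A.shift 1).T (B.A.shift 1) :=
  GHom.desc fun n => match n with
    | 0 => ((GHom.sigma 1 B.A).comp (GHom.ofElem (d := 1) ((f.und : k) • B.one)
        (by simpa using B.A.smul_mem f.und.2 B.one_mem))).cast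
    | 1 => ((GHom.sigma 1 B.A).comp (f.f₁.comp ((GHom.sigmaInv 1 A.A).comp
        (GHom.runit (A.A.shift 1))))).cast
    | _ + 2 => 0

/-- The coalgebra `Bar A = T(Ā[1])` with the cut comultiplication, the coderivation with
components `Ā[1]^{⊗n} → A[1]^{⊗n} → A[1] → Ā[1]`, and the curvature functional
`-(T(Ā[1]) → T(A[1]) → A[1] → k)`. -/
noncomputable def barData (A : UCCAlg 𝒜) : CoalgData 𝒜 where
  C := (A.data.bar.shift 1).T
  comul := GHom.cut (A.data.bar.shift 1)
  codiff := GHom.coderiv (((A.data.shiftPr A.isUCCAlg.split_one).comp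
    (A.data.bCheck.comp (GHom.Tmap A.data.shiftIncl))).cast)
  cocurv := (-(A.data.shiftSplit.comp
    (A.data.bCheck.comp (GHom.Tmap A.data.shiftIncl)))).cast
  counit := GHom.prZero (A.data.bar.shift 1)
  aug := GHom.oneT (A.data.bar.shift 1)
  aug_mem := GHom.oneT_mem (A.data.bar.shift 1)

/-- The bar construction on morphisms: `g₁ = T(f̄₁)` with
`f̄₁ : Ā[1] → A[1] → B[1] → B̄[1]`, and `g₀ : T(Ā[1]) → T(A[1]) → B[1] → k`. -/
noncomputable def barMap {A B : UCCAlg 𝒜} (f : A ⟶ B) : CoalgHomData (barData A) (barData B) where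
  g₁ := GHom.Tmap (((B.data.shiftPr B.isUCCAlg.split_one).comp
    ((GHom.sigma 1 B.data.A).comp (f.data.f₁.comp
      ((GHom.sigmaInv 1 A.data.A).comp A.data.shiftIncl)))).cast)
  g₀ := (B.data.shiftSplit.comp (f.data.fCheck.comp (GHom.Tmap A.data.shiftIncl))).cast

variable (𝒜) in
/-- The bar construction is a well-defined functor. -/
structure BarIsFunctor : Prop where
  obj : ∀ A : UCCAlg 𝒜, (barData A).IsCACoalg
  map : ∀ {A B : UCCAlg 𝒜} (f : A ⟶ B), (barMap f).IsHom
  map_id : ∀ A : UCCAlg 𝒜, barMap (𝟙 A) = CoalgHomData.id (barData A)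
  map_comp : ∀ {A B C : UCCAlg 𝒜} (f : A ⟶ B) (g : B ⟶ C),
    barMap (f ≫ g) = (barMap f).comp (barMap g)

/-- The bar construction as a functor. -/
noncomputable def Bar (h : BarIsFunctor 𝒜) : UCCAlg 𝒜 ⥤ CACoalg 𝒜 where
  obj A := ⟨barData A, h.obj A⟩
  map f := ⟨barMap f, h.map f⟩
  map_id A := CACoalg.Hom.ext (h.map_id A)
  map_comp f g := CACoalg.Hom.ext (h.map_comp f g)

/-! ### The cobar construction -/

namespace CoalgData

/-- `ξ₀ = σ δ₀ : C[-1] → k`. -/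
def ξ₀ (C : CoalgData 𝒜) : GHom 1 (C.C.shift (-1)) (GrMod.unit 𝒜) :=
  (C.cocurv.comp (GHom.sigmaInv (-1) C.C)).cast

/-- `ξ₁ = -σ δ₁ σ⁻¹ : C[-1] → C[-1]`. -/
def ξ₁ (C : CoalgData 𝒜) : GHom 1 (C.C.shift (-1)) (C.C.shift (-1)) :=
  (-((GHom.sigma (-1) C.C).comp (C.codiff.comp (GHom.sigmaInv (-1) C.C)))).cast

/-- `ξ₂ = σ δ₂ (σ ⊗ σ)⁻¹ = -σ δ₂ (σ⁻¹ ⊗ σ⁻¹) : C[-1] → C[-1] ⊗ C[-1]`. -/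
noncomputable def ξ₂ (C : CoalgData 𝒜) :
    GHom 1 (C.C.shift (-1)) ((C.C.shift (-1)).tensor (C.C.shift (-1))) :=
  (-((GHom.tmap (GHom.sigma (-1) C.C) (GHom.sigma (-1) C.C)).comp
    (C.comul.comp (GHom.sigmaInv (-1) C.C)))).cast

/-- The map `C[-1] → T(C[-1])` with components `ξ₀`, `ξ₁`, `ξ₂`. -/
noncomputable def ξCheck (C : CoalgData 𝒜) : GHom 1 (C.C.shift (-1)) (C.C.shift (-1)).T :=
  ((GHom.injZero (C.C.shift (-1))).comp C.ξ₀).cast +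
    ((GHom.inj₁ (C.C.shift (-1))).comp C.ξ₁).cast +
    ((GHom.inj₂ (C.C.shift (-1))).comp C.ξ₂).cast

/-- The shifted augmentation `w σ⁻¹ ∈ C[-1]`. -/
def shiftAug (C : CoalgData 𝒜) : C.C.shift (-1) := GHom.sigma (-1) C.C C.aug

/-- The inclusion `C̄[-1] → C[-1]`. -/
def shiftIncl (C : CoalgData 𝒜) : GHom 0 (C.bar.shift (-1)) (C.C.shift (-1)) :=
  ((GHom.sigma (-1) C.C).comp ((GHom.kerIncl C.counit).comp (GHom.sigmaInv (-1) C.bar))).cast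

/-- The projection `C[-1] → C̄[-1]`. -/
def shiftPr (C : CoalgData 𝒜) (h : C.counit C.aug = (1 : k)) :
    GHom 0 (C.C.shift (-1)) (C.bar.shift (-1)) :=
  ((GHom.sigma (-1) C.bar).comp ((C.barPr h).comp (GHom.sigmaInv (-1) C.C))).cast

theorem shiftAug_mem (C : CoalgData 𝒜) : C.shiftAug ∈ (C.C.shift (-1)).deg 1 := by
  have h := (GHom.sigma (-1) C.C).map_mem C.aug_mem
  rwa [show (0 : ℤ) + -(-1) = 1 by norm_num] at h

/-- The curvature `-w ⊗ w - ∑ₙ w ξₙ` of the cobar construction, where `w` stands for the shifted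
augmentation. It lies in `T(C̄[-1]) ⊆ T(C[-1])`; as an element of `T(C̄[-1])` it is obtained by
applying the projection `T(C[-1]) → T(C̄[-1])`. -/
noncomputable def cobarCurv (C : CoalgData 𝒜) (h : C.counit C.aug = (1 : k)) :
    (C.bar.shift (-1)).T :=
  GHom.Tmap (C.shiftPr h)
    (-GHom.inj₂ (C.C.shift (-1)) (tm C.shiftAug C.shiftAug) - C.ξCheck C.shiftAug)

theorem cobarCurv_mem (C : CoalgData 𝒜) (h : C.counit C.aug = (1 : k)) :
    C.cobarCurv h ∈ (C.bar.shift (-1)).T.deg 2 := by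
  have h1 := (GHom.inj₂ (C.C.shift (-1))).map_mem (tm_mem C.shiftAug_mem C.shiftAug_mem)
  have h2 := C.ξCheck.map_mem C.shiftAug_mem
  rw [add_zero] at h1
  have h3 := (GHom.Tmap (C.shiftPr h)).map_mem (sub_mem (neg_mem h1) h2)
  rw [add_zero] at h3
  exact h3

end CoalgData

/-- The algebra `Cobar C = T(C̄[-1])` with the multiplication of the tensor algebra, the derivation
with components `C̄[-1] → C[-1] → C[-1]^{⊗n} → C̄[-1]^{⊗n}`, and the splitting
`T(C̄[-1]) → k`. -/
noncomputable def cobarData (C : CACoalg 𝒜) : AlgData 𝒜 where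
  A := (C.data.bar.shift (-1)).T
  mul := GHom.mulT (C.data.bar.shift (-1))
  diff := GHom.deriv (((GHom.Tmap (C.data.shiftPr C.isCACoalg.counit_aug)).comp
    (C.data.ξCheck.comp C.data.shiftIncl)).cast)
  curv := C.data.cobarCurv C.isCACoalg.counit_aug
  curv_mem := C.data.cobarCurv_mem _
  one := GHom.oneT (C.data.bar.shift (-1))
  one_mem := GHom.oneT_mem (C.data.bar.shift (-1))
  split := GHom.prZero (C.data.bar.shift (-1))

/-- The cobar construction on morphisms: the algebra homomorphism with components
`C̄[-1] → C[-1] → D[-1] → D̄[-1]` and `C̄[-1] → C[-1] → k`, and the element `g₀(w) ∈ k¹`. -/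
noncomputable def cobarMap {C D : CACoalg 𝒜} (g : C ⟶ D) :
    AlgHomData (cobarData C) (cobarData D) where
  f₁ := GHom.algExt (GHom.mulT (D.data.bar.shift (-1))) (GHom.oneT (D.data.bar.shift (-1)))
    (GHom.oneT_mem (D.data.bar.shift (-1)))
    (((GHom.inj₁ (D.data.bar.shift (-1))).comp ((D.data.shiftPr D.isCACoalg.counit_aug).comp
      ((GHom.sigma (-1) D.data.C).comp (g.data.g₁.comp ((GHom.sigmaInv (-1) C.data.C).comp
        C.data.shiftIncl))))).cast +
    ((GHom.injZero (D.data.bar.shift (-1))).comp (g.data.g₀.comp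
      ((GHom.sigmaInv (-1) C.data.C).comp C.data.shiftIncl))).cast)
  und := ⟨g.data.g₀ C.data.aug, by
    have h := g.data.g₀.map_mem C.data.aug_mem
    rwa [zero_add] at h⟩

variable (𝒜) in
/-- The cobar construction is a well-defined functor. -/
structure CobarIsFunctor : Prop where
  obj : ∀ C : CACoalg 𝒜, (cobarData C).IsUCCAlg
  map : ∀ {C D : CACoalg 𝒜} (g : C ⟶ D), (cobarMap g).IsHom
  map_id : ∀ C : CACoalg 𝒜, cobarMap (𝟙 C) = AlgHomData.id (cobarData C)
  map_comp : ∀ {C D E : CACoalg 𝒜} (f : C ⟶ D) (g : D ⟶ E),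
    cobarMap (f ≫ g) = (cobarMap f).comp (cobarMap g)

/-- The cobar construction as a functor. -/
noncomputable def Cobar (h : CobarIsFunctor 𝒜) : CACoalg 𝒜 ⥤ UCCAlg 𝒜 where
  obj C := ⟨cobarData C, h.obj C⟩
  map g := ⟨cobarMap g, h.map g⟩
  map_id C := UCCAlg.Hom.ext (h.map_id C)
  map_comp f g := UCCAlg.Hom.ext (h.map_comp f g)

end barCobar

end
end CurvedBarCobar

open CategoryTheory
open scoped DirectSum TensorProduct

namespace CurvedBarCobar

universe u

set_option linter.unusedSectionVars false

section calculus
variable {k : Type u} [Ring k] {𝒜 : ℤ → AddSubgroup k}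

/-! ### Calculus of homogeneous maps -/

/-! Both Hom sets of the adjunction are the same set of twisting cochains. A twisting cochain from C
to A is a map θ : C → A of degree 1 with δ₁θ + θm₁ + θ∗θ = δ₀η + εm₀ (`IsTwisting`), where ∗ is
convolution; the Hom sets see those for which wθ is a multiple of η by an element of k¹. There are
universal ones, C → C̄[-1] → Cobar C and Bar A → Ā[1] → A. A morphism f : Cobar C → A pushes the
first forward to τf₁ + ε·f̲·η, and a morphism g : C → Bar A pulls the second back to g₁τ + g₀η. Each
of the two assignments is a bijection onto the twisting cochains with the condition at w, which
gives the bijection of Hom sets; it is natural because pushing commutes with pulling (`push_pull`).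

The same cochains prove that the two constructions are well defined. Applying m₁ and δ₁ to the
Maurer–Cartan equation, and convolving it with θ on both sides, gives a Bianchi identity
(`IsTwisting.curvature`) in which the curvature axioms of A stand on one side and those of C on the
other. For C → Cobar C the axioms of C kill one side, and what remains is m₁² = [m₀, –] on
generators together with m₀m₁ = 0. For Bar A → A the axioms of A kill the other side, and splitting
A = Ā ⊕ kη yields δ₁δ₀ = 0 and the formula for δ₁² after projection to Ā[1]. Likewise a
multiplicative unital map out of Cobar C, or a coaugmented coalgebra map into Bar A, completed by
its scalar component, is a morphism as soon as the induced cochain is twisting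
(`isHom_of_isTwisting`, `isHom_of_isTwisting_pull`), and morphisms are equal when their cochains are
equal (`algHom_ext`, `coalgHom_ext`). Functoriality is read off from this.

On the algebra side everything extends from generators. On the coalgebra side this is replaced by
recursion on the first letter: a coalgebra map g : C → T X with component γ : C → X solves g = ε·1 +
γ∗g, where ∗ prepends the letter γ to g. Codifferentials and commutators with functionals satisfy
equations of the same kind, so a difference of two candidates satisfies E = γ∗E. When γ(w) = 0,
conilpotency forces E = 0 (`fix_unique`), and it also makes the series solving the equation for g
finite at each point (`exists_fix`). On T X itself uniqueness is induction on the length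
(`T_fix_unique`). -/

theorem ksign_smul_self {M : Type*} [AddCommGroup M] (i : ℤ) (x : M) :
    ksign i • ksign i • x = x := by
  rw [smul_smul, ksign_mul_self, one_smul]

theorem ksign_eq_of_even_sub {i j : ℤ} (h : Even (i - j)) : ksign i = ksign j := by
  have := ksign_add (i - j) j
  rwa [sub_add_cancel, ksign_of_even h, one_mul] at this

theorem ksign_one : ksign 1 = -1 := ksign_of_odd odd_one

theorem GrMod.sgn_even (M : GrMod 𝒜) {p : ℤ} (hp : Even p) (x : M) : M.sgn p x = x := by
  refine M.hom_induction (p := fun x => M.sgn p x = x) (map_zero _) (fun i x hx => ?_)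
    (fun x y hx hy => by rw [map_add, hx, hy]) x
  rw [M.sgn_of_mem p hx, ksign_of_even (hp.mul_right i), one_smul]

namespace GHom
variable {M N : GrMod 𝒜} {d e : ℤ}

/-- Two homogeneous maps agree if they agree on homogeneous elements. -/
theorem hom_ext {f : GHom d M N} {g : GHom e M N}
    (h : ∀ i (x : M), x ∈ M.deg i → f x = g x) (x : M) : f x = g x :=
  M.hom_induction (p := fun x => f x = g x) (by rw [map_zero f, map_zero g]) h
    (fun x y hx hy => by rw [map_add f, map_add g, hx, hy]) x

theorem map_sgn (f : GHom d M N) (p : ℤ) (x : M) :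
    f (M.sgn p x) = ksign (p * d) • N.sgn p (f x) := by
  refine M.hom_induction (p := fun x => f (M.sgn p x) = ksign (p * d) • N.sgn p (f x)) (by simp)
    (fun i x hx => ?_) (fun x y hx hy => by simp only [map_add, hx, hy, smul_add]) x
  rw [M.sgn_of_mem p hx, N.sgn_of_mem p (f.map_mem hx), map_zsmul, mul_add, ksign_add,
    mul_comm (ksign _), mul_smul, ksign_smul_self]

theorem map_sgn₀ (f : GHom 0 M N) (p : ℤ) (x : M) : f (M.sgn p x) = N.sgn p (f x) := by
  rw [map_sgn, mul_zero, ksign_zero, one_smul]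

theorem map_mem₀ (f : GHom 0 M N) {i : ℤ} {x : M} (h : x ∈ M.deg i) : f x ∈ N.deg i := by
  simpa using f.map_mem h

theorem sub_apply_eq (f g : GHom d M N) (x : M) : (f + -g) x = f x - g x :=
  (sub_eq_add_neg _ _).symm

end GHom

variable [GradedRing 𝒜] [StronglyCommutative 𝒜]

section tm
variable {M N : GrMod 𝒜}

theorem tm_add_left (x x' : M) (y : N) : tm (x + x') y = tm x y + tm x' y := tmk_add_left _ _ _
theorem tm_add_right (x : M) (y y' : N) : tm x (y + y') = tm x y + tm x y' := tmk_add_right _ _ _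
theorem smul_tm (a : k) (x : M) (y : N) : tm (a • x) y = a • tm x y := smul_tmk _ _ _
theorem tm_zero_left (y : N) : tm (0 : M) y = 0 := tmk_zero_left _
theorem tm_zero_right (x : M) : tm x (0 : N) = 0 := tmk_zero_right _
theorem tm_zsmul_left (c : ℤ) (x : M) (y : N) : tm (c • x) y = c • tm x y := tmk_zsmul_left _ _ _
theorem tm_zsmul_right (c : ℤ) (x : M) (y : N) : tm x (c • y) = c • tm x y :=
  tmk_zsmul_right _ _ _
theorem tm_neg_left (x : M) (y : N) : tm (-x) y = -tm x y := by
  rw [← neg_one_zsmul, tm_zsmul_left, neg_one_zsmul]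
theorem tm_neg_right (x : M) (y : N) : tm x (-y) = -tm x y := by
  rw [← neg_one_zsmul, tm_zsmul_right, neg_one_zsmul]
theorem tm_smul {i j : ℤ} {a : k} {x : M} (ha : a ∈ 𝒜 i) (hx : x ∈ M.deg j) (y : N) :
    tm x (a • y) = ksign (i * j) • (a • tm x y) := tmk_smul ha hx y

/-- Induction on elements of a tensor product. -/
theorem tm_induction {p : M.tensor N → Prop} (h0 : p 0)
    (hh : ∀ i j x y, x ∈ M.deg i → y ∈ N.deg j → p (tm x y))
    (ha : ∀ x y, p x → p y → p (x + y)) (t : M.tensor N) : p t :=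
  tensor_hom_induction h0 hh ha t

/-- Induction on homogeneous elements of a tensor product. -/
theorem tm_induction_deg {n : ℤ} {p : M.tensor N → Prop} (h0 : p 0)
    (hh : ∀ i j x y, x ∈ M.deg i → y ∈ N.deg j → i + j = n → p (tm x y))
    (ha : ∀ x y, p x → p y → p (x + y)) {t : M.tensor N} (ht : t ∈ (M.tensor N).deg n) : p t := by
  -- The homogeneous part is a generated subgroup, so negatives must be carried along; the negative
  -- of a pure tensor is again pure.
  refine (AddSubgroup.closure_induction (p := fun t _ => p t ∧ p (-t)) ?_ ?_ ?_ ?_ ht).1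
  · rintro _ ⟨i, j, x, y, hx, hy, h, rfl⟩
    refine ⟨hh i j x y hx hy h, ?_⟩
    have := hh i j (-x) y (neg_mem hx) hy h
    rwa [tm_neg_left] at this
  · exact ⟨h0, by rwa [neg_zero]⟩
  · intro x y _ _ hx hy
    exact ⟨ha _ _ hx.1 hy.1, by rw [neg_add]; exact ha _ _ hx.2 hy.2⟩
  · intro x _ hx
    exact ⟨hx.2, by rw [neg_neg]; exact hx.1⟩

theorem tensor_sgn_tm (p : ℤ) {i j : ℤ} {x : M} {y : N} (hx : x ∈ M.deg i) (hy : y ∈ N.deg j) :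
    (M.tensor N).sgn p (tm x y) = ksign (p * (i + j)) • tm x y :=
  (M.tensor N).sgn_of_mem p (tm_mem hx hy)

end tm

/-! ### Tensor products and convolutions of homogeneous maps -/

namespace GHom
variable {M M' M'' N N' N'' P Q R S C D : GrMod 𝒜} {d e p p' q q' r s : ℤ}

/-- Equal maps often carry degrees that agree only after computation, so pointwise equality is the
usable notion. Only the degree of the left factor enters the Koszul sign, hence the right degrees
are unconstrained. -/
theorem tmap_congr {f : GHom p M M'} {f' : GHom p' M M'} {g : GHom q N N'} {g' : GHom q' N N'}
    (hp : p = p') (hf : ∀ x, f x = f' x) (hg : ∀ y, g y = g' y) (t : M.tensor N) :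
    tmap f g t = tmap f' g' t :=
  tensor_ext (fun i j x y hx hy => by
    subst hp
    rw [tmap_tm _ _ _ hy, tmap_tm _ _ _ hy, hf, hg]) t

/-- `(f ⊗ g) (f' ⊗ g') = (-1)^(|g||f'|) f f' ⊗ g g'`, maps being composed from left to right. -/
theorem tmap_tmap (f : GHom p M M') (g : GHom q N N') (f' : GHom p' M' M'') (g' : GHom q' N' N'')
    (F : GHom r M M'') (G : GHom s N N'') (hr : r = p + p') (hF : ∀ x, F x = f' (f x))
    (hG : ∀ y, G y = g' (g y)) (t : M.tensor N) :
    tmap f' g' (tmap f g t) = ksign (q * p') • tmap F G t := by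
  refine tm_induction (p := fun t => tmap f' g' (tmap f g t) = ksign (q * p') • tmap F G t)
    (by simp only [map_zero, smul_zero]) (fun i j x y hx hy => ?_)
    (fun x y hx hy => by simp only [map_add, hx, hy, smul_add]) t
  rw [tmap_tm _ _ _ hy, tmap_tm _ _ _ hy, map_zsmul, tmap_tm _ _ _ (g.map_mem hy), hF, hG,
    smul_smul, smul_smul, ← ksign_add, ← ksign_add, hr]
  congr 2; ring

/-- The case of `tmap_tmap` without a sign. -/
theorem tmap_tmap₀ (f : GHom p M M') (g : GHom 0 N N') (f' : GHom p' M' M'')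
    (g' : GHom q' N' N'')
    (F : GHom r M M'') (G : GHom s N N'') (hr : r = p + p') (hF : ∀ x, F x = f' (f x))
    (hG : ∀ y, G y = g' (g y)) (t : M.tensor N) :
    tmap f' g' (tmap f g t) = tmap F G t := by
  rw [tmap_tmap f g f' g' F G hr hF hG, zero_mul, ksign_zero, one_smul]

/-- The other case of `tmap_tmap` without a sign. -/
theorem tmap_tmap₁ (f : GHom p M M') (g : GHom q N N') (f' : GHom 0 M' M'')
    (g' : GHom q' N' N'')
    (F : GHom p M M'') (G : GHom s N N'') (hF : ∀ x, F x = f' (f x))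
    (hG : ∀ y, G y = g' (g y)) (t : M.tensor N) :
    tmap f' g' (tmap f g t) = tmap F G t := by
  rw [tmap_tmap f g f' g' F G (add_zero p).symm hF hG, mul_zero, ksign_zero, one_smul]

theorem tmap_neg_left (f : GHom p M M') (g : GHom q N N') (t : M.tensor N) :
    tmap (-f) g t = -tmap f g t := by
  rw [eq_neg_iff_add_eq_zero, ← tmap_add_left,
    show (-f + f) = 0 from ext fun _ => neg_add_cancel _, tmap_zero_left]

theorem tmap_neg_right (f : GHom p M M') (g : GHom q N N') (t : M.tensor N) :
    tmap f (-g) t = -tmap f g t := by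
  rw [eq_neg_iff_add_eq_zero, ← tmap_add_right,
    show (-g + g) = 0 from ext fun _ => neg_add_cancel _, tmap_zero_right]

/-- The convolution of `f : C → M` and `g : C → N` along `δ : C → C ⊗ C` and `μ : M ⊗ N → P`. -/
noncomputable def conv (δ : GHom 0 C (D.tensor S)) (μ : GHom 0 (M.tensor N) P) (f : GHom p D M)
    (g : GHom q S N) : GHom (p + q) C P :=
  (μ.comp ((tmap f g).comp δ)).cast (by ring)

theorem conv_apply (δ : GHom 0 C (D.tensor S)) (μ : GHom 0 (M.tensor N) P) (f : GHom p D M)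
    (g : GHom q S N) (c : C) : conv δ μ f g c = μ (tmap f g (δ c)) := rfl

/-- On x ⊗ (y ⊗ z) both sides carry the sign with exponent p(|y| + |z|) + q|z|. Four independent
pairings are allowed so that products, scalar actions and concatenation with a letter are all
covered. -/
theorem tmap_assoc {μ₁ : GHom 0 (M.tensor Q) R} {μ₂ : GHom 0 (N.tensor P) Q}
    {μ₃ : GHom 0 (S.tensor P) R} {μ₄ : GHom 0 (M.tensor N) S}
    (hμ : ∀ {i j l : ℤ} (x : M) (y : N) (z : P), x ∈ M.deg i → y ∈ N.deg j → z ∈ P.deg l →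
      μ₁ (tm x (μ₂ (tm y z))) = μ₃ (tm (μ₄ (tm x y)) z))
    (f : GHom p M' M) (g : GHom q N' N) (h : GHom r C P) (t : M'.tensor (N'.tensor C)) :
    μ₁ (tmap f (μ₂.comp (tmap g h)) t) =
      μ₃ (tmap ((μ₄.comp (tmap f g)).cast (r := p + q)) h (assocInv M' N' C t)) := by
  refine tm_induction (p := fun t => μ₁ (tmap f (μ₂.comp (tmap g h)) t) =
      μ₃ (tmap ((μ₄.comp (tmap f g)).cast (r := p + q)) h (assocInv M' N' C t)))
    (by simp only [map_zero]) (fun i j x t hx ht => ?_)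
    (fun x y hx hy => by simp only [map_add, hx, hy]) t
  refine tm_induction_deg (p := fun t => μ₁ (tmap f (μ₂.comp (tmap g h)) (tm x t)) =
      μ₃ (tmap ((μ₄.comp (tmap f g)).cast (r := p + q)) h (assocInv M' N' C (tm x t))))
      (by simp only [tm_zero_right, map_zero]) (fun l m y z hy hz hlm => ?_)
      (fun s t hs ht => ?_) ht
  · subst hlm
    rw [assocInv_tm, tmap_tm _ _ _ (tm_mem hy hz), tmap_tm _ _ _ hz, comp_apply, cast_apply,
      comp_apply, tmap_tm _ _ _ hy, tmap_tm _ _ _ hz]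
    simp only [map_zsmul, tm_zsmul_left, tm_zsmul_right]
    rw [hμ _ _ _ (f.map_mem hx) (g.map_mem hy) (h.map_mem hz), smul_smul, smul_smul, ← ksign_add,
      ← ksign_add]
    congr 2; ring
  · rw [tm_add_right, map_add, map_add, map_add, map_add, hs, ht]
    exact (map_add _ _ _).symm

/-- Associativity of convolution. -/
theorem conv_assoc {δ : GHom 0 C (C.tensor C)}
    (hδ : ∀ x, assocInv C C C (tmap (GHom.id C) δ (δ x)) = tmap δ (GHom.id C) (δ x))
    {μ₁ : GHom 0 (M.tensor Q) R} {μ₂ : GHom 0 (N.tensor P) Q}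
    {μ₃ : GHom 0 (S.tensor P) R} {μ₄ : GHom 0 (M.tensor N) S}
    (hμ : ∀ {i j l : ℤ} (x : M) (y : N) (z : P), x ∈ M.deg i → y ∈ N.deg j → z ∈ P.deg l →
      μ₁ (tm x (μ₂ (tm y z))) = μ₃ (tm (μ₄ (tm x y)) z))
    (f : GHom p C M) (g : GHom q C N) (h : GHom r C P) (c : C) :
    conv δ μ₁ f (conv δ μ₂ g h) c = conv δ μ₃ (conv δ μ₄ f g) h c := by
  rw [conv_apply, conv_apply,
    ← tmap_tmap₀ (GHom.id C) δ f (μ₂.comp (tmap g h)) f (conv δ μ₂ g h) (zero_add p).symm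
      (fun _ => rfl) (fun _ => rfl), tmap_assoc hμ, hδ,
    tmap_tmap₀ δ (GHom.id C) _ h (conv δ μ₄ f g) h (zero_add _).symm
      (fun _ => rfl) (fun _ => rfl)]

section
variable (δ : GHom 0 C (D.tensor S)) (μ : GHom 0 (M.tensor N) P)

theorem conv_add_left (f f' : GHom p D M) (g : GHom q S N) (c : C) :
    conv δ μ (f + f') g c = conv δ μ f g c + conv δ μ f' g c := by
  rw [conv_apply, tmap_add_left, map_add]; rfl

theorem conv_add_right (f : GHom p D M) (g g' : GHom q S N) (c : C) :
    conv δ μ f (g + g') c = conv δ μ f g c + conv δ μ f g' c := by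
  rw [conv_apply, tmap_add_right, map_add]; rfl

theorem conv_neg_left (f : GHom p D M) (g : GHom q S N) (c : C) :
    conv δ μ (-f) g c = -conv δ μ f g c := by
  rw [conv_apply, tmap_neg_left, map_neg]; rfl

theorem conv_neg_right (f : GHom p D M) (g : GHom q S N) (c : C) :
    conv δ μ f (-g) c = -conv δ μ f g c := by
  rw [conv_apply, tmap_neg_right, map_neg]; rfl

theorem conv_congr {f : GHom p D M} {f' : GHom p' D M} {g : GHom q S N} {g' : GHom q' S N}
    (hp : p = p') (hf : ∀ x, f x = f' x) (hg : ∀ y, g y = g' y) (c : C) :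
    conv δ μ f g c = conv δ μ f' g' c :=
  congrArg μ (tmap_congr hp hf hg _)
end

/-- A coderivation composed with a convolution. -/
theorem conv_coderiv {δ : GHom 0 C (C.tensor C)} {θ : GHom d C C}
    (hθ : ∀ x, δ (θ x) = tmap (GHom.id C) θ (δ x) + tmap θ (GHom.id C) (δ x))
    (μ : GHom 0 (M.tensor N) P) (f : GHom p C M) (g : GHom q C N) (c : C) :
    conv δ μ f g (θ c) = ksign (d * p) • conv δ μ f (g.comp θ) c + conv δ μ (f.comp θ) g c := by
  rw [conv_apply, hθ, map_add, map_add,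
    tmap_tmap (GHom.id C) θ f g f (g.comp θ) (zero_add p).symm (fun _ => rfl) (fun _ => rfl),
    tmap_tmap₀ θ (GHom.id C) f g (f.comp θ) g rfl (fun _ => rfl) (fun _ => rfl), map_zsmul]
  rfl

/-- A convolution composed with a derivation. -/
theorem deriv_conv {δ : GHom 0 C (C.tensor C)} {μ : GHom 0 (M.tensor M) M} {θ : GHom d M M}
    (hθ : ∀ x, θ (μ x) = μ (tmap (GHom.id M) θ x) + μ (tmap θ (GHom.id M) x))
    (f : GHom p C M) (g : GHom q C M) (c : C) :
    θ (conv δ μ f g c) = conv δ μ f (θ.comp g) c + ksign (q * d) • conv δ μ (θ.comp f) g c := by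
  rw [conv_apply, hθ,
    tmap_tmap₁ f g (GHom.id M) θ f (θ.comp g) (fun _ => rfl) (fun _ => rfl),
    tmap_tmap f g θ (GHom.id M) (θ.comp f) g rfl (fun _ => rfl) (fun _ => rfl), map_zsmul]
  rfl

end GHom
end calculus

section twisting
variable {k : Type u} [Ring k] {𝒜 : ℤ → AddSubgroup k} [GradedRing 𝒜] [StronglyCommutative 𝒜]

/-! ### Twisting cochains -/

/-- The axioms of a unit-complemented curved algebra that do not involve the curvature. -/
structure AlgData.IsPrecurved (A : AlgData 𝒜) : Prop where
  mul_assoc : ∀ x y z : A.A, A.mul (tm x (A.mul (tm y z))) = A.mul (tm (A.mul (tm x y)) z)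
  leibniz : ∀ t : A.A.tensor A.A, A.diff (A.mul t) =
    A.mul (GHom.tmap (GHom.id A.A) A.diff t) + A.mul (GHom.tmap A.diff (GHom.id A.A) t)
  mul_one : ∀ x : A.A, A.mul (tm x A.one) = x
  one_mul : ∀ x : A.A, A.mul (tm A.one x) = x
  diff_one : A.diff A.one = 0

theorem AlgData.IsUCCAlg.isPrecurved {A : AlgData 𝒜} (h : A.IsUCCAlg) : A.IsPrecurved :=
  ⟨h.mul_assoc, h.leibniz, h.mul_one, h.one_mul, h.diff_one⟩

/-- The axioms of a curved augmented coalgebra that involve neither the curvature nor the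
augmentation. -/
structure CoalgData.IsPrecurved (C : CoalgData 𝒜) : Prop where
  coassoc : ∀ x : C.C, GHom.assocInv C.C C.C C.C (GHom.tmap (GHom.id C.C) C.comul (C.comul x)) =
    GHom.tmap C.comul (GHom.id C.C) (C.comul x)
  coleibniz : ∀ x : C.C, C.comul (C.codiff x) =
    GHom.tmap (GHom.id C.C) C.codiff (C.comul x) + GHom.tmap C.codiff (GHom.id C.C) (C.comul x)
  comul_counit : ∀ x : C.C,
    GHom.runit C.C (GHom.tmap (GHom.id C.C) C.counit (C.comul x)) = x
  counit_comul : ∀ x : C.C,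
    GHom.lunit C.C (GHom.tmap C.counit (GHom.id C.C) (C.comul x)) = x
  counit_codiff : ∀ x : C.C, C.counit (C.codiff x) = 0

theorem CoalgData.IsCACoalg.isPrecurved {C : CoalgData 𝒜} (h : C.IsCACoalg) : C.IsPrecurved :=
  ⟨h.coassoc, h.coleibniz, h.comul_counit, h.counit_comul, h.counit_codiff⟩

/-- The Maurer–Cartan equation `δ₁ θ + θ m₁ + θ ∗ θ = δ₀ η + ε m₀`. -/
def IsTwisting (C : CoalgData 𝒜) (A : AlgData 𝒜) (θ : GHom 1 C.C A.A) : Prop :=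
  ∀ c, θ (C.codiff c) + A.diff (θ c) + A.mul (GHom.tmap θ θ (C.comul c)) =
    C.cocurv c • A.one + C.counit c • A.curv

namespace GHom
variable {M N : GrMod 𝒜} {d p q : ℤ}

/-- The map `x ↦ f(x) m`, for a functional `f` and an element `m`. -/
noncomputable def smulElem (f : GHom p M (GrMod.unit 𝒜)) {m : N} (hm : m ∈ N.deg d) :
    GHom (p + d) M N := (ofElem m hm).comp f

theorem _root_.CurvedBarCobar.zero_smul_unit (x : M) : (0 : GrMod.unit 𝒜) • x = 0 :=
  zero_smul k x

/-- The map `x ↦ f(x) m`, of degree `r`. -/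
noncomputable def smulElem' {r : ℤ} (f : GHom p M (GrMod.unit 𝒜)) {m : N} (hm : m ∈ N.deg d)
    (h : p + d = r := by norm_num) : GHom r M N := (smulElem f hm).cast h

theorem smulElem'_apply {r : ℤ} (f : GHom p M (GrMod.unit 𝒜)) {m : N} (hm : m ∈ N.deg d)
    (h : p + d = r) (x : M) : smulElem' f hm h x = f x • m := rfl

end GHom

namespace AlgData
variable {A : AlgData 𝒜} {M N : GrMod 𝒜} {d p q r : ℤ}

theorem smul_mul (a : k) (x y : A.A) : A.mul (tm (a • x) y) = a • A.mul (tm x y) := by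
  rw [smul_tm, map_smul]

theorem mul_smul {i j : ℤ} {a : k} {x : A.A} (ha : a ∈ 𝒜 i) (hx : x ∈ A.A.deg j) (y : A.A) :
    A.mul (tm x (a • y)) = ksign (i * j) • a • A.mul (tm x y) := by
  rw [tm_smul ha hx, map_zsmul, map_smul]

/-- A factor with values in multiples of the unit acts by scalars. This turns convolutions into the
expressions in `lunit` in which the coalgebra axioms are written. -/
theorem mul_tmap_smul_one (h1 : ∀ x : A.A, A.mul (tm A.one x) = x)
    (f : GHom p M (GrMod.unit 𝒜)) (F : GHom p M A.A) (hF : ∀ x, F x = f x • A.one)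
    (g : GHom q N A.A) (t : M.tensor N) :
    A.mul (GHom.tmap F g t) = GHom.lunit A.A (GHom.tmap f g t) := by
  refine GHom.tensor_ext (f := A.mul.comp (GHom.tmap F g))
    (g := (GHom.lunit A.A).comp (GHom.tmap f g)) (fun i j x y hx hy => ?_) t
  rw [GHom.comp_apply, GHom.comp_apply, GHom.tmap_tm _ _ _ hy, GHom.tmap_tm _ _ _ hy, map_zsmul,
    map_zsmul, GHom.lunit_tm, hF, smul_mul, h1]

theorem mul_tmap_one_smul (h1 : ∀ x : A.A, A.mul (tm x A.one) = x)
    (f : GHom q N (GrMod.unit 𝒜)) (F : GHom q N A.A) (hF : ∀ x, F x = f x • A.one)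
    (g : GHom p M A.A) (t : M.tensor N) :
    A.mul (GHom.tmap g F t) = GHom.runit A.A (GHom.tmap g f t) := by
  refine GHom.tensor_ext (f := A.mul.comp (GHom.tmap g F))
    (g := (GHom.runit A.A).comp (GHom.tmap g f)) (fun i j x y hx hy => ?_) t
  rw [GHom.comp_apply, GHom.comp_apply, GHom.tmap_tm _ _ _ hy, GHom.tmap_tm _ _ _ hy, map_zsmul,
    map_zsmul, GHom.runit_tm (g.map_mem hx) (f.map_mem hy), hF,
    mul_smul (f.map_mem hy) (g.map_mem hx), h1]

/-- Combined with the counit axiom this collapses a convolution with ε·m to multiplication by m. The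
sign operator compensates for F having degree d while ε has degree 0; it disappears for m = m₀ and
matters for odd multiples of the unit. -/
theorem mul_tmap_counit_left {m : A.A} (hm : m ∈ A.A.deg d) (ε : GHom 0 M (GrMod.unit 𝒜))
    (F : GHom d M A.A) (hF : ∀ x, F x = ε x • m) (g : GHom q N A.A) (t : M.tensor N) :
    A.mul (GHom.tmap F g t) =
      A.mul (tm m (g (GHom.lunit N (GHom.tmap ε (GHom.id N) ((M.tensor N).sgn d t))))) := by
  refine tm_induction (p := fun t => A.mul (GHom.tmap F g t) =
      A.mul (tm m (g (GHom.lunit N (GHom.tmap ε (GHom.id N) ((M.tensor N).sgn d t))))))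
    (by simp only [map_zero, tm_zero_right]) (fun i j x y hx hy => ?_)
    (fun x y hx hy => by rw [map_add, map_add, hx, hy, map_add, map_add, map_add, map_add,
      tm_add_right, map_add]) t
  rw [GHom.tmap_tm _ _ _ hy, tensor_sgn_tm _ hx hy, map_zsmul (GHom.tmap ε (GHom.id N)),
    GHom.tmap_tm _ _ _ hy, zero_mul, ksign_zero, one_smul, map_zsmul, map_zsmul, map_zsmul,
    GHom.lunit_tm, map_smul, tm_zsmul_right, map_zsmul, hF, smul_mul]
  have hε := ε.map_mem₀ hx
  rw [mul_smul hε hm, smul_smul, ← ksign_add]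
  congr 1
  exact ksign_eq_of_even_sub ⟨-(i * d), by ring⟩

theorem mul_tmap_counit_right {m : A.A} (_ : m ∈ A.A.deg d) (ε : GHom 0 N (GrMod.unit 𝒜))
    (F : GHom d N A.A) (hF : ∀ x, F x = ε x • m) (g : GHom q M A.A) (t : M.tensor N) :
    A.mul (GHom.tmap g F t) =
      A.mul (tm (g (GHom.runit M (GHom.tmap (GHom.id M) ε t))) m) := by
  refine tm_induction (p := fun t => A.mul (GHom.tmap g F t) =
      A.mul (tm (g (GHom.runit M (GHom.tmap (GHom.id M) ε t))) m))
    (by simp only [map_zero, tm_zero_left]) (fun i j x y hx hy => ?_)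
    (fun x y hx hy => by rw [map_add, map_add, hx, hy, map_add, map_add, map_add,
      tm_add_left, map_add]) t
  have hε := ε.map_mem₀ hy
  rw [GHom.tmap_tm _ _ _ hy, GHom.tmap_tm _ _ _ hy, zero_mul, ksign_zero, one_smul, map_zsmul,
    GHom.id_apply, GHom.runit_tm hx hε, map_zsmul, tm_zsmul_left, map_zsmul, hF,
    mul_smul hε (g.map_mem hx), map_smul, smul_mul, smul_smul, ← ksign_add]
  congr 1
  exact ksign_eq_of_even_sub ⟨q * j, by ring⟩

end AlgData

section
variable {C : CoalgData 𝒜} {A : AlgData 𝒜}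

open GHom in
/-- The Bianchi-type identity for twisting cochains: it relates the curvature equation of the
algebra to that of the coalgebra. -/
theorem IsTwisting.curvature (hC : C.IsPrecurved) (hA : A.IsPrecurved) {θ : GHom 1 C.C A.A}
    (hθ : IsTwisting C A θ) (c : C.C) :
    A.diff (A.diff (θ c)) - A.mul (tm A.curv (θ c)) + A.mul (tm (θ c) A.curv) -
      C.counit c • A.diff A.curv =
    θ (C.codiff (C.codiff c)) + lunit A.A (tmap C.cocurv θ (C.comul c)) -
      runit A.A (tmap θ C.cocurv (C.comul c)) - C.cocurv (C.codiff c) • A.one := by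
  set f₁ : GHom 2 C.C A.A := smulElem' C.cocurv A.one_mem with hf₁
  set f₂ : GHom 2 C.C A.A := smulElem' C.counit A.curv_mem with hf₂
  set f₃ : GHom 2 C.C A.A := (conv C.comul A.mul θ θ).cast with hf₃
  -- The Maurer–Cartan equation in the form θδ₁ + m₁θ = δ₀η + εm₀ − θ∗θ is convolved with θ on the
  -- right and on the left.
  have hl : ∀ c, ((θ.comp C.codiff).cast + (A.diff.comp θ).cast : GHom 2 C.C A.A) c =
      (f₁ + f₂ + -f₃) c := fun c => by
    have := hθ c
    rw [← eq_sub_iff_add_eq] at this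
    rw [GHom.sub_apply_eq]
    exact this
  have e₁ := conv_congr C.comul A.mul (g := θ) (g' := θ) rfl hl (fun _ => rfl) c
  have e₂ := conv_congr C.comul A.mul (f := θ) (f' := θ) rfl (fun _ => rfl) hl c
  rw [conv_add_left, conv_add_left, conv_add_left, conv_neg_left] at e₁
  rw [conv_add_right, conv_add_right, conv_add_right, conv_neg_right] at e₂
  -- The cubic terms (θ∗θ)∗θ and θ∗(θ∗θ) coincide.
  have as : conv C.comul A.mul θ f₃ c = conv C.comul A.mul f₃ θ c := by
    rw [← conv_congr C.comul A.mul (f := θ) (f' := θ) (g := conv C.comul A.mul θ θ) (g' := f₃) rfl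
      (fun _ => rfl) (fun _ => rfl) c,
      conv_assoc hC.coassoc (fun x y z _ _ _ => hA.mul_assoc x y z)]
    exact conv_congr _ _ rfl (fun _ => rfl) (fun _ => rfl) c
  have h1l : conv C.comul A.mul f₁ θ c = lunit A.A (tmap C.cocurv θ (C.comul c)) :=
    AlgData.mul_tmap_smul_one hA.one_mul _ _ (fun _ => rfl) _ _
  have h1r : conv C.comul A.mul θ f₁ c = runit A.A (tmap θ C.cocurv (C.comul c)) :=
    AlgData.mul_tmap_one_smul hA.mul_one _ _ (fun _ => rfl) _ _
  have h2l : conv C.comul A.mul f₂ θ c = A.mul (tm A.curv (θ c)) := by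
    rw [conv_apply, AlgData.mul_tmap_counit_left A.curv_mem C.counit _ (fun _ => rfl),
      GrMod.sgn_even _ even_two, hC.counit_comul]
  have h2r : conv C.comul A.mul θ f₂ c = A.mul (tm (θ c) A.curv) := by
    rw [conv_apply, AlgData.mul_tmap_counit_right A.curv_mem C.counit _ (fun _ => rfl),
      hC.comul_counit]
  -- θ, δ₁ and m₁ are all odd, so each Leibniz rule has one term with a minus sign.
  have hd := conv_coderiv hC.coleibniz A.mul θ θ c
  have hm := deriv_conv (δ := C.comul) hA.leibniz θ θ c
  rw [one_mul, ksign_one, neg_one_smul] at hd hm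
  have m₁ := congrArg A.diff (hθ c)
  have m₂ := hθ (C.codiff c)
  rw [map_add, map_add, map_add, map_smul, map_smul, hA.diff_one, smul_zero, zero_add] at m₁
  rw [hC.counit_codiff, zero_smul_unit, add_zero] at m₂
  change _ + _ + A.diff (conv C.comul A.mul θ θ c) = _ at m₁
  change _ + _ + conv C.comul A.mul θ θ (C.codiff c) = _ at m₂
  rw [hm] at m₁
  rw [hd] at m₂
  rw [h1l, h2l] at e₁
  rw [h1r, h2r, as] at e₂
  have c₁ : conv C.comul A.mul ((θ.comp C.codiff).cast (r := 2)) θ c =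
    conv C.comul A.mul (θ.comp C.codiff) θ c := rfl
  have c₂ : conv C.comul A.mul ((A.diff.comp θ).cast (r := 2)) θ c =
    conv C.comul A.mul (A.diff.comp θ) θ c := rfl
  have c₃ : conv C.comul A.mul θ ((θ.comp C.codiff).cast (r := 2)) c =
    conv C.comul A.mul θ (θ.comp C.codiff) c := rfl
  have c₄ : conv C.comul A.mul θ ((A.diff.comp θ).cast (r := 2)) c =
    conv C.comul A.mul θ (A.diff.comp θ) c := rfl
  rw [c₁, c₂] at e₁
  rw [c₃, c₄] at e₂
  generalize conv C.comul A.mul f₃ θ c = z at *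
  rw [← sub_eq_zero] at e₁ e₂ m₁ m₂ ⊢
  -- In (m₁ of the equation) − (the equation at δ₁c) + (right convolution) − (left convolution), all
  -- convolutions of θ with θδ₁ and with m₁θ cancel.
  have := congrArg₂ (· + ·) (congrArg₂ (· - ·) m₁ m₂) (congrArg₂ (· - ·) e₁ e₂)
  simp only [sub_zero, add_zero] at this
  rw [← this]
  abel

/-- Adding a multiple of the unit of odd degree to a twisting cochain. -/
theorem IsTwisting.add_smul_one (hC : C.IsPrecurved) (hA : A.IsPrecurved) {θ θ' : GHom 1 C.C A.A}
    (hθ : IsTwisting C A θ) {l : k} (hl : l ∈ 𝒜 1)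
    (h : ∀ c, θ' c = θ c + C.counit c • l • A.one) : IsTwisting C A θ' := by
  have hl1 : l • A.one ∈ A.A.deg 1 := by simpa using A.A.smul_mem hl A.one_mem
  set f : GHom 1 C.C A.A := GHom.smulElem' C.counit hl1 with hf
  intro c
  have hθ' : ∀ c, θ' c = (θ + f) c := h
  rw [GHom.tmap_congr rfl hθ' hθ', GHom.tmap_add_left, GHom.tmap_add_right, GHom.tmap_add_right,
    map_add, map_add, map_add, h, h, hC.counit_codiff, zero_smul_unit, add_zero,
    map_add, map_smul, map_smul, hA.diff_one, smul_zero, smul_zero, add_zero, ← hθ c]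
  -- The square of the added term is a multiple of l², which vanishes because l is odd; this uses
  -- strong commutativity.
  have e₁ : A.mul (GHom.tmap f f (C.comul c)) = 0 := by
    rw [AlgData.mul_tmap_counit_right hl1 C.counit f (fun _ => rfl), hC.comul_counit]
    change A.mul (tm (C.counit c • l • A.one) _) = 0
    rw [AlgData.smul_mul, AlgData.smul_mul, hA.one_mul, smul_smul l,
      StronglyCommutative.sq_zero odd_one hl, zero_smul, smul_zero]
  -- The element l·1 is central in the graded sense, and it and θ are both odd, so the two cross
  -- terms are opposite.
  have e₂ : A.mul (GHom.tmap f θ (C.comul c)) + A.mul (GHom.tmap θ f (C.comul c)) = 0 := by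
    rw [AlgData.mul_tmap_counit_right hl1 C.counit f (fun _ => rfl), hC.comul_counit,
      AlgData.mul_tmap_counit_left hl1 C.counit f (fun _ => rfl),
      ← GHom.map_sgn₀, hC.counit_comul]
    refine C.C.hom_induction (p := fun c => A.mul (tm (l • A.one) (θ (C.C.sgn 1 c))) +
      A.mul (tm (θ c) (l • A.one)) = 0) (by simp [tm_zero_left, tm_zero_right]) (fun i c hc => ?_)
      (fun x y hx hy => ?_) c
    · rw [C.C.sgn_of_mem 1 hc, map_zsmul, tm_zsmul_right, map_zsmul, AlgData.smul_mul, hA.one_mul,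
        AlgData.mul_smul hl (θ.map_mem hc), hA.mul_one, ← add_smul, one_mul, one_mul, ksign_add,
        ksign_one, mul_neg_one, add_neg_cancel, zero_smul]
    · rw [map_add, map_add, map_add, tm_add_left, tm_add_right, map_add, map_add,
        ← add_zero (0 : A.A)]
      nth_rewrite 1 [← hx]
      rw [← hy]
      abel
  rw [e₁, add_zero]
  have : ∀ a b c d e : A.A, d + e = 0 → a + b + (c + e + d) = a + b + c := by
    intro a b c d e h
    rw [add_assoc c, add_comm e, h, add_zero]
  rw [this]
  exact e₂

end
end twisting

section tensorModule
variable {k : Type u} [Ring k] {𝒜 : ℤ → AddSubgroup k} [GradedRing 𝒜] [StronglyCommutative 𝒜]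

/-! ### The tensor module -/

namespace GHom
variable {X Y M N P Q : GrMod 𝒜} {d e p q : ℤ}

theorem injZero_eq (a : k) : injZero X a = a • oneT X := by
  rw [oneT, ← map_smul, smul_eq_mul, mul_one]

theorem cons_mem {i j : ℤ} {x : X} {t : X.T} (hx : x ∈ X.deg i) (ht : t ∈ X.T.deg j) :
    cons X (tm x t) ∈ X.T.deg (i + j) := consAux_mem hx ht

theorem inj_mem {n : ℕ} {i : ℤ} {t : X.tpow n} (ht : t ∈ (X.tpow n).deg i) :
    inj X.tpow n t ∈ X.T.deg i := (inj X.tpow n).map_mem₀ ht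

theorem inj_succ (n : ℕ) (s : X.tensor (X.tpow n)) :
    inj X.tpow (n + 1) s = cons X (tmap (GHom.id X) (inj X.tpow n) s) := by
  refine tensor_ext (f := injSucc X n) (g := (cons X).comp (tmap (GHom.id X) (inj X.tpow n)))
    (fun i j x y hx hy => ?_) s
  rw [comp_apply, tmap_tm _ _ _ hy, zero_mul, ksign_zero, one_smul, id_apply, cons_tm_inj]

/-- Induction on the length for elements of `T X`. -/
theorem T_cons_induction {p : X.T → Prop} (h0 : p 0) (h1 : ∀ a : k, p (a • oneT X))
    (hc : ∀ i j x t, x ∈ X.deg i → t ∈ X.T.deg j → p t → p (cons X (tm x t)))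
    (ha : ∀ x y, p x → p y → p (x + y)) (u : X.T) : p u := by
  refine T_induction h0 (fun n => ?_) ha u
  induction n with
  | zero => exact fun a => (congrArg p (injZero_eq (X := X) (show k from a))).mpr (h1 a)
  | succ n ih =>
    intro s
    refine tm_induction (p := fun s => p (injSucc X n s)) (by rw [map_zero]; exact h0)
      (fun i j x y hx hy => ?_) (fun x y hx hy => by rw [map_add]; exact ha _ _ hx hy) s
    rw [← cons_tm_inj]
    exact hc i j x _ hx (inj_mem hy) (ih y)

/-- The version of `T_cons_induction` for homogeneous elements. -/
theorem T_cons_induction_deg {p : ℤ → X.T → Prop} (h0 : ∀ n, p n 0)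
    (h1 : ∀ i (a : k), a ∈ 𝒜 i → p i (a • oneT X))
    (hc : ∀ i j x t, x ∈ X.deg i → t ∈ X.T.deg j → p j t → p (i + j) (cons X (tm x t)))
    (ha : ∀ n x y, p n x → p n y → p n (x + y)) {n : ℤ} {u : X.T} (hu : u ∈ X.T.deg n) :
    p n u := by
  refine dsum_induction (h0 n) (fun m => ?_) (ha n) hu
  induction m generalizing n u with
  | zero => exact fun a ha => (congrArg (p n) (injZero_eq (X := X) (show k from a))).mpr (h1 n a ha)
  | succ m ih =>
    intro s hs
    refine tm_induction_deg (p := fun s => p n (injSucc X m s)) (by rw [map_zero]; exact h0 n)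
      (fun i j x y hx hy hij => ?_) (fun x y hx hy => by rw [map_add]; exact ha _ _ _ hx hy) hs
    subst hij
    rw [← cons_tm_inj]
    exact hc i j x _ hx (inj_mem hy) (ih (inj_mem hy) y hy)

/-- Homogeneous maps on `T X` agree if they agree on `1` and on products `x t`. -/
theorem T_ext {f : GHom d X.T P} {g : GHom e X.T P} (h1 : f (oneT X) = g (oneT X))
    (hc : ∀ i j x t, x ∈ X.deg i → t ∈ X.T.deg j → f t = g t →
      f (cons X (tm x t)) = g (cons X (tm x t))) (u : X.T) : f u = g u :=
  T_cons_induction (p := fun u => f u = g u) (by rw [map_zero, map_zero])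
    (fun a => by rw [map_smul, map_smul, h1]) hc
    (fun x y hx hy => by rw [map_add, map_add, hx, hy]) u

/-- Homogeneous maps on `X ⊗ T X` agree if they agree on `x ⊗ t` with `t` of a fixed length. -/
theorem XT_ext {f : GHom d (X.tensor X.T) P} {g : GHom e (X.tensor X.T) P}
    (h : ∀ i j n x (t : X.tpow n), x ∈ X.deg i → t ∈ (X.tpow n).deg j →
      f (tm x (inj X.tpow n t)) = g (tm x (inj X.tpow n t))) (s : X.tensor X.T) : f s = g s :=
  tensor_ext (fun i j x t hx ht => dsum_induction (p := fun t => f (tm x t) = g (tm x t))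
    (by rw [tm_zero_right, map_zero, map_zero]) (fun n t ht => h i j n x t hx ht)
    (fun t u ht hu => by rw [tm_add_right, map_add, map_add, ht, hu]) ht) s

theorem tmap_tm₀ (f : GHom 0 M N) (g : GHom q P Q) (x : M) (y : P) :
    tmap f g (tm x y) = tm (f x) (g y) :=
  P.hom_induction (p := fun y => tmap f g (tm x y) = tm (f x) (g y))
    (by rw [tm_zero_right, map_zero, map_zero, tm_zero_right])
    (fun j y hy => by rw [tmap_tm _ _ _ hy, zero_mul, ksign_zero, one_smul])
    (fun y y' h h' => by rw [tm_add_right, map_add, h, h', map_add, tm_add_right]) y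

/-- `M → M ⊗ k → M` followed by the right action of `1`. -/
theorem runit_tm_one (x : M) : runit M (tm x (1 : k)) = x :=
  hom_ext (f := ((runit M).comp (runitInv M))) (g := GHom.id M) (fun i x hx =>
    (runit_tm hx one_mem_unit).trans (by rw [zero_mul, ksign_zero, one_smul, one_smul]; rfl)) x

/-- The projection `T X → X`. -/
noncomputable def prOne (X : GrMod 𝒜) : GHom 0 X.T X :=
  ((runit X).comp (show GHom 0 X.T (X.tensor (GrMod.unit 𝒜)) from pr X.tpow 1)).cast

theorem pr_inj_same (F : ℕ → GrMod 𝒜) (n : ℕ) (t : F n) : pr F n (inj F n t) = t :=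
  DirectSum.component.lof_self k (M := fun n => (F n : Type u)) n t

theorem pr_inj_ne (F : ℕ → GrMod 𝒜) {m n : ℕ} (h : m ≠ n) (t : F n) : pr F m (inj F n t) = 0 :=
  DirectSum.of_eq_of_ne (β := fun n => (F n : Type u)) _ _ t h

theorem prZero_one : prZero X (oneT X) = (1 : k) := pr_inj_same X.tpow 0 (1 : k)

theorem prZero_cons (s : X.tensor X.T) : prZero X (cons X s) = 0 :=
  XT_ext (f := (prZero X).comp (cons X)) (g := (0 : GHom 0 _ _)) (fun i j n x t hx ht => by
    rw [comp_apply, cons_tm_inj]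
    exact pr_inj_ne X.tpow (Nat.succ_ne_zero n).symm _) s

theorem prOne_one : prOne X (oneT X) = 0 :=
  (congrArg (runit X) (pr_inj_ne X.tpow one_ne_zero (1 : k))).trans (map_zero _)

/-- A word x t has length one only if t is a scalar. -/
theorem prOne_cons (s : X.tensor X.T) :
    prOne X (cons X s) = runit X (tmap (GHom.id X) (prZero X) s) := by
  refine XT_ext (f := (prOne X).comp (cons X))
    (g := (runit X).comp (tmap (GHom.id X) (prZero X))) (fun i j n x t hx ht => ?_) s
  rw [comp_apply, comp_apply, cons_tm_inj, tmap_tm₀]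
  refine congrArg (runit X) ?_
  cases n with
  | zero =>
    refine (pr_inj_same X.tpow 1 _).trans ?_
    exact congrArg (tm x) (pr_inj_same X.tpow 0 t).symm
  | succ n =>
    refine (pr_inj_ne X.tpow (by omega) _).trans ?_
    rw [show prZero X (inj X.tpow (n + 1) t) = 0 from
      pr_inj_ne X.tpow (Nat.succ_ne_zero n).symm t, tm_zero_right]
    rfl

theorem inj₁_eq (x : X) : inj₁ X x = cons X (tm x (oneT X)) :=
  (cons_tm_inj x 0 (1 : k)).symm

/-! ### Concatenation -/

theorem mulT_one_left (u : X.T) : mulT X (tm (oneT X) u) = u :=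
  (mulT_injZero 1 u).trans (one_smul k u)

theorem mulT_cons_tm (x : X) (t u : X.T) :
    mulT X (tm (cons X (tm x t)) u) = cons X (tm x (mulT X (tm t u))) := by
  refine T_induction (p := fun t => mulT X (tm (cons X (tm x t)) u) =
    cons X (tm x (mulT X (tm t u)))) ?_ (fun n t => ?_) (fun s t hs ht => ?_) t
  · rw [tm_zero_right, map_zero, tm_zero_left, map_zero, tm_zero_right, map_zero]
  · rw [cons_tm_inj, mulT_injSucc]
  · rw [tm_add_right, map_add, tm_add_left, map_add, hs, ht, tm_add_left, map_add, tm_add_right,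
      map_add]

theorem mulT_smul_left (a : k) (t u : X.T) : mulT X (tm (a • t) u) = a • mulT X (tm t u) := by
  rw [smul_tm, map_smul]

theorem mulT_assoc (s t u : X.T) :
    mulT X (tm s (mulT X (tm t u))) = mulT X (tm (mulT X (tm s t)) u) := by
  refine T_cons_induction (p := fun s => mulT X (tm s (mulT X (tm t u))) =
    mulT X (tm (mulT X (tm s t)) u)) ?_ (fun a => ?_) (fun i j x s _ _ h => ?_)
    (fun x y hx hy => ?_) s
  · simp only [tm_zero_left, map_zero]
  · rw [mulT_smul_left, mulT_smul_left, mulT_smul_left, mulT_one_left, mulT_one_left]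
  · rw [mulT_cons_tm, mulT_cons_tm, mulT_cons_tm, h]
  · rw [tm_add_left, map_add, hx, hy, tm_add_left, map_add, tm_add_left, map_add]

theorem mulT_one_right (t : X.T) : mulT X (tm t (oneT X)) = t := by
  refine T_cons_induction (p := fun t => mulT X (tm t (oneT X)) = t) ?_ (fun a => ?_)
    (fun i j x s _ _ h => ?_) (fun x y hx hy => ?_) t
  · rw [tm_zero_left, map_zero]
  · rw [mulT_smul_left, mulT_one_left]
  · rw [mulT_cons_tm, h]
  · rw [tm_add_left, map_add, hx, hy]

theorem cons_eq_mulT (x : X) (t : X.T) : cons X (tm x t) = mulT X (tm (inj₁ X x) t) := by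
  rw [inj₁_eq, mulT_cons_tm, mulT_one_left]

/-! ### Functoriality, extensions of maps to homomorphisms and derivations -/

theorem Tmap_inj (f : GHom 0 X Y) (n : ℕ) (t : X.tpow n) :
    Tmap f (inj X.tpow n t) = inj Y.tpow n (tpowMap f n t) := desc_inj _ n t

theorem Tmap_one (f : GHom 0 X Y) : Tmap f (oneT X) = oneT Y := Tmap_inj f 0 (1 : k)

theorem Tmap_cons (f : GHom 0 X Y) (s : X.tensor X.T) :
    Tmap f (cons X s) = cons Y (tmap f (Tmap f) s) := by
  refine XT_ext (f := (Tmap f).comp (cons X)) (g := (cons Y).comp (tmap f (Tmap f)))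
    (fun i j n x t hx ht => ?_) s
  rw [comp_apply, comp_apply, cons_tm_inj, tmap_tm₀, Tmap_inj, cons_tm_inj]
  refine (Tmap_inj f (n + 1) _).trans (congrArg (inj Y.tpow (n + 1)) ?_)
  exact tmap_tm₀ f (tpowMap f n) x t

section algExt
variable (μ : GHom 0 (P.tensor P) P) (η : P) (hη : η ∈ P.deg 0) (f : GHom 0 X P)

theorem algExt_one : algExt μ η hη f (oneT X) = η :=
  (desc_inj (algExt.go μ η hη f) 0 (1 : k)).trans (one_smul k η)

theorem algExt_cons (s : X.tensor X.T) :
    algExt μ η hη f (cons X s) = μ (tmap f (algExt μ η hη f) s) := by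
  refine XT_ext (f := (algExt μ η hη f).comp (cons X))
    (g := μ.comp (tmap f (algExt μ η hη f))) (fun i j n x t hx ht => ?_) s
  rw [comp_apply, comp_apply, cons_tm_inj, tmap_tm₀]
  refine (desc_inj (algExt.go μ η hη f) (n + 1) _).trans ?_
  refine (congrArg μ (tmap_tm₀ f _ x t)).trans ?_
  exact congrArg (fun z => μ (tm (f x) z)) (desc_inj (algExt.go μ η hη f) n t).symm

theorem algExt_inj₁ (h1 : ∀ y, μ (tm y η) = y) (x : X) : algExt μ η hη f (inj₁ X x) = f x := by
  rw [inj₁_eq, algExt_cons, tmap_tm₀, algExt_one, h1]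

/-- Induction on the length of the left factor: the extension multiplies the letters with all
brackets to the right, so one letter is moved out at a time by associativity. -/
theorem algExt_mul (h1 : ∀ y, μ (tm η y) = y)
    (hμ : ∀ x y z, μ (tm x (μ (tm y z))) = μ (tm (μ (tm x y)) z)) (t u : X.T) :
    algExt μ η hη f (mulT X (tm t u)) = μ (tm (algExt μ η hη f t) (algExt μ η hη f u)) := by
  refine T_cons_induction (p := fun t => algExt μ η hη f (mulT X (tm t u)) =
    μ (tm (algExt μ η hη f t) (algExt μ η hη f u))) ?_ (fun a => ?_) (fun i j x s _ _ h => ?_)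
    (fun x y hx hy => ?_) t
  · simp only [tm_zero_left, map_zero]
  · rw [mulT_smul_left, map_smul, map_smul, mulT_one_left, algExt_one, smul_tm, map_smul, h1]
  · rw [mulT_cons_tm, algExt_cons, algExt_cons, tmap_tm₀, tmap_tm₀, h, hμ]
  · rw [tm_add_left, map_add, map_add, hx, hy, map_add, tm_add_left, map_add]

end algExt

section deriv
variable (ξ : GHom d X X.T)

theorem deriv_one : deriv ξ (oneT X) = 0 := desc_inj (deriv.go ξ) 0 (1 : k)

theorem deriv_cons (s : X.tensor X.T) :
    deriv ξ (cons X s) = cons X (tmap (GHom.id X) (deriv ξ) s) +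
      mulT X (tmap ξ (GHom.id X.T) s) := by
  refine XT_ext (f := (deriv ξ).comp (cons X))
    (g := ((cons X).comp (tmap (GHom.id X) (deriv ξ))).cast (r := d) +
      ((mulT X).comp (tmap ξ (GHom.id X.T))).cast) (fun i j n x t hx ht => ?_) s
  rw [comp_apply, cons_tm_inj]
  refine (desc_inj (deriv.go ξ) (n + 1) _).trans ?_
  rw [add_apply]
  refine congrArg₂ (fun a b : X.T => a + b) ?_ ?_
  · refine (congrArg (cons X) (tmap_tm₀ _ _ x t)).trans ?_
    rw [cast_apply, comp_apply, tmap_tm₀]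
    refine congrArg (cons X) ?_
    exact congrArg (tm x) (desc_inj (deriv.go ξ) n t).symm
  · refine (congrArg (mulT X) (tmap_tm _ _ _ ht)).trans ?_
    rw [cast_apply, comp_apply, tmap_tm _ _ _ (inj_mem ht)]; rfl

theorem deriv_cons_tm {j : ℤ} (x : X) {t : X.T} (ht : t ∈ X.T.deg j) :
    deriv ξ (cons X (tm x t)) =
      cons X (tm x (deriv ξ t)) + ksign (d * j) • mulT X (tm (ξ x) t) := by
  rw [deriv_cons, tmap_tm₀, tmap_tm _ _ _ ht, map_zsmul]; rfl

theorem deriv_inj₁ (x : X) : deriv ξ (inj₁ X x) = ξ x := by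
  rw [inj₁_eq, deriv_cons_tm ξ x (oneT_mem X), deriv_one, tm_zero_right, map_zero, zero_add,
    mul_zero, ksign_zero, one_smul, mulT_one_right]

/-- The one-letter Leibniz rule is iterated over the letters of t. The sign of each step depends on
the degree of what follows, so the induction has to keep track of degrees. -/
theorem deriv_mul_tm {i j : ℤ} {t u : X.T} (ht : t ∈ X.T.deg i) (hu : u ∈ X.T.deg j) :
    deriv ξ (mulT X (tm t u)) =
      mulT X (tm t (deriv ξ u)) + ksign (d * j) • mulT X (tm (deriv ξ t) u) := by
  refine T_cons_induction_deg (p := fun i t => deriv ξ (mulT X (tm t u)) =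
      mulT X (tm t (deriv ξ u)) + ksign (d * j) • mulT X (tm (deriv ξ t) u)) (fun n => ?_)
    (fun i a ha => ?_) (fun i l x s hx hs h => ?_) (fun n x y hx hy => ?_) ht
  · simp only [tm_zero_left, map_zero, smul_zero, add_zero]
  · rw [mulT_smul_left, map_smul, map_smul, mulT_one_left, deriv_one, smul_zero, tm_zero_left,
      map_zero, smul_zero, add_zero, mulT_smul_left, mulT_one_left]
  · rw [mulT_cons_tm, deriv_cons_tm ξ x ((mulT X).map_mem₀ (tm_mem hs hu)), h,
      deriv_cons_tm ξ x hs, mulT_cons_tm, tm_add_right, map_add, tm_add_left, map_add,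
      mulT_cons_tm, tm_zsmul_right, map_zsmul, tm_zsmul_left, map_zsmul, mulT_assoc, smul_add,
      smul_smul, ← ksign_add, add_assoc, mul_add, add_comm (d * j)]
  · rw [tm_add_left, map_add, map_add, hx, hy, map_add (deriv ξ), tm_add_left, tm_add_left,
      map_add, map_add, smul_add]
    abel

theorem deriv_mul (s : X.T.tensor X.T) : deriv ξ (mulT X s) =
    mulT X (tmap (GHom.id X.T) (deriv ξ) s) + mulT X (tmap (deriv ξ) (GHom.id X.T) s) := by
  refine tensor_ext (f := (deriv ξ).comp (mulT X))
    (g := ((mulT X).comp (tmap (GHom.id X.T) (deriv ξ))).cast (r := d) +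
      ((mulT X).comp (tmap (deriv ξ) (GHom.id X.T))).cast) (fun i j t u ht hu => ?_) s
  rw [comp_apply, add_apply, cast_apply, cast_apply, comp_apply, comp_apply, tmap_tm₀,
    tmap_tm _ _ _ hu, map_zsmul, deriv_mul_tm ξ ht hu]
  rfl

end deriv
end GHom
end tensorModule

section functoriality
variable {k : Type u} [Ring k] {𝒜 : ℤ → AddSubgroup k} [GradedRing 𝒜] [StronglyCommutative 𝒜]

/-! ### Functoriality of twisting cochains -/

theorem sub_smul_unit {M : GrMod 𝒜} (a b : GrMod.unit 𝒜) (x : M) :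
    (a - b) • x = a • x - b • x := sub_smul (R := k) a b x

/-- The sign is the Koszul sign of exchanging g with f₀: applied after f₁ ⊗ f₀, the map g has to
pass f₀ to reach the left factor. -/
theorem GHom.map_runit_tmap_sign {M M' N P : GrMod 𝒜} {p q : ℤ} (g : GHom q M' P)
    (f₁ : GHom 0 M M') (f₀ : GHom p N (GrMod.unit 𝒜)) (F : GHom q M P) (hF : ∀ x, F x = g (f₁ x))
    (t : M.tensor N) :
    g (runit M' (tmap f₁ f₀ t)) = ksign (q * p) • runit P (tmap F f₀ t) := by
  refine tm_induction (p := fun t => g (runit M' (tmap f₁ f₀ t)) =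
    ksign (q * p) • runit P (tmap F f₀ t)) (by simp only [map_zero, smul_zero])
    (fun i j x y hx hy => ?_) (fun x y hx hy => ?_) t
  · have hx' := f₁.map_mem₀ hx
    rw [tmap_tm₀, tmap_tm _ _ _ hy, map_zsmul, runit_tm hx' (f₀.map_mem hy), hF,
      runit_tm (g.map_mem hx') (f₀.map_mem hy), map_zsmul, map_smul, smul_smul, smul_smul,
      ← ksign_add, ← ksign_add]
    congr 1
    exact ksign_eq_of_even_sub ⟨-(q * j + q * p), by ring⟩
  · rw [map_add, map_add, map_add, hx, hy, map_add, map_add, smul_add]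

section
variable {C D : CoalgData 𝒜} {A B : AlgData 𝒜}

/-- The pushforward of twisting cochains along a morphism of algebras. -/
noncomputable def AlgHomData.push (f : AlgHomData A B) (θ : GHom 1 C.C A.A) : GHom 1 C.C B.A :=
  (f.f₁.comp θ).cast +
    GHom.smulElem' C.counit (d := 1) (m := (f.und : k) • B.one)
      (by simpa using B.A.smul_mem f.und.2 B.one_mem)

theorem AlgHomData.push_apply (f : AlgHomData A B) (θ : GHom 1 C.C A.A) (c : C.C) :
    f.push θ c = f.f₁ (θ c) + C.counit c • (f.und : k) • B.one := rfl

theorem IsTwisting.comp_algHom {θ : GHom 1 C.C A.A} (hθ : IsTwisting C A θ) (f : GHom 0 A.A B.A)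
    (hmul : ∀ x y : A.A, f (A.mul (tm x y)) = B.mul (tm (f x) (f y)))
    (hdiff : ∀ x : A.A, f (A.diff x) = B.diff (f x)) (hcurv : f A.curv = B.curv)
    (hone : f A.one = B.one) : IsTwisting C B ((f.comp θ).cast (r := 1)) := by
  intro c
  have h := congrArg f (hθ c)
  have hm : ∀ t : A.A.tensor A.A, f (A.mul t) = B.mul (GHom.tmap f f t) :=
    GHom.tensor_ext (f := f.comp A.mul) (g := B.mul.comp (GHom.tmap f f))
      (fun i j x y hx hy => by
        rw [GHom.comp_apply, GHom.comp_apply, hmul, GHom.tmap_tm₀])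
  rw [map_add, map_add, map_add, map_smul, map_smul, hm, hdiff, hcurv, hone,
    GHom.tmap_tmap₁ θ θ f f ((f.comp θ).cast (r := 1)) ((f.comp θ).cast (r := 1)) (fun _ => rfl) (fun _ => rfl)] at h
  exact h

/-- The first component preserves all operations and carries the equation over; the summand coming
from `und` is harmless by `add_smul_one`. -/
theorem IsTwisting.push (hC : C.IsPrecurved) (hB : B.IsPrecurved) {θ : GHom 1 C.C A.A}
    (hθ : IsTwisting C A θ) {f : AlgHomData A B} (hf : f.IsHom) : IsTwisting C B (f.push θ) :=
  (hθ.comp_algHom f.f₁ hf.map_mul hf.map_diff hf.map_curv hf.map_one).add_smul_one hC hB f.und.2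
    (fun _ => rfl)

/-- The pullback of twisting cochains along a morphism of coalgebras. -/
noncomputable def CoalgHomData.pull (g : CoalgHomData C D) (θ : GHom 1 D.C A.A) :
    GHom 1 C.C A.A :=
  (θ.comp g.g₁).cast + GHom.smulElem' g.g₀ A.one_mem

theorem CoalgHomData.pull_apply (g : CoalgHomData C D) (θ : GHom 1 D.C A.A) (c : C.C) :
    g.pull θ c = θ (g.g₁ c) + g.g₀ c • A.one := rfl

/-- The convolution square of a pullback of a twisting cochain. -/
theorem CoalgHomData.mul_tmap_pull (hA : A.IsPrecurved) (g : CoalgHomData C D)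
    (θ : GHom 1 D.C A.A) (t : C.C.tensor C.C) :
    A.mul (GHom.tmap (g.pull θ) (g.pull θ) t) =
      A.mul (GHom.tmap θ θ (GHom.tmap g.g₁ g.g₁ t)) + θ (GHom.lunit D.C (GHom.tmap g.g₀ g.g₁ t)) -
      θ (GHom.runit D.C (GHom.tmap g.g₁ g.g₀ t)) +
      GHom.lunit (GrMod.unit 𝒜) (GHom.tmap g.g₀ g.g₀ t) • A.one := by
  set f : GHom 1 C.C A.A := GHom.smulElem' g.g₀ A.one_mem
  set h : GHom 1 C.C A.A := (θ.comp g.g₁).cast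
  have e₁ : A.mul (GHom.tmap f h t) = θ (GHom.lunit D.C (GHom.tmap g.g₀ g.g₁ t)) := by
    rw [AlgData.mul_tmap_smul_one hA.one_mul g.g₀ _ (fun _ => rfl), GHom.map_lunit_tmap]
  -- The minus sign comes from exchanging the two odd maps θ and g₀, and produces the commutator
  -- found in the second morphism condition.
  have e₂ : A.mul (GHom.tmap h f t) = -θ (GHom.runit D.C (GHom.tmap g.g₁ g.g₀ t)) := by
    rw [AlgData.mul_tmap_one_smul hA.mul_one g.g₀ _ (fun _ => rfl),
      GHom.map_runit_tmap_sign θ g.g₁ g.g₀ h (fun _ => rfl), mul_one, ksign_one, neg_one_smul,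
      neg_neg]
  have e₃ : A.mul (GHom.tmap f f t) =
      GHom.lunit (GrMod.unit 𝒜) (GHom.tmap g.g₀ g.g₀ t) • A.one := by
    rw [AlgData.mul_tmap_smul_one hA.one_mul g.g₀ _ (fun _ => rfl)]
    refine GHom.tensor_ext (f := (GHom.lunit A.A).comp (GHom.tmap g.g₀ f))
      (g := (GHom.ofElem A.one A.one_mem).comp
        ((GHom.lunit (GrMod.unit 𝒜)).comp (GHom.tmap g.g₀ g.g₀))) (fun i j x y hx hy => ?_) t
    rw [GHom.comp_apply, GHom.comp_apply, GHom.comp_apply, GHom.tmap_tm _ _ _ hy,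
      GHom.tmap_tm _ _ _ hy, map_zsmul, map_zsmul, map_zsmul]
    exact congrArg (ksign (1 * j) • ·) (smul_smul (g.g₀ x : k) (g.g₀ y : k) A.one)
  change A.mul (GHom.tmap (h + f) (h + f) t) = _
  rw [GHom.tmap_add_left, GHom.tmap_add_right, GHom.tmap_add_right, map_add, map_add, map_add,
    e₁, e₂, e₃, GHom.tmap_tmap₀ g.g₁ g.g₁ θ θ h h (zero_add 1).symm (fun _ => rfl)
    (fun _ => rfl)]
  abel

/-- Evaluate the equation for θ at g₁(c) and rewrite it by the morphism conditions. Their correction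
terms are exactly the cross terms and the g₀∗g₀ term of `mul_tmap_pull`. -/
theorem IsTwisting.pull (hA : A.IsPrecurved) {θ : GHom 1 D.C A.A}
    (hθ : IsTwisting D A θ) {g : CoalgHomData C D} (hg : g.IsHom) :
    IsTwisting C A (g.pull θ) := by
  intro c
  have h := hθ (g.g₁ c)
  rw [← hg.map_codiff, ← hg.map_comul, ← hg.map_cocurv, hg.map_counit, map_add, map_sub] at h
  rw [CoalgHomData.mul_tmap_pull hA, g.pull_apply, g.pull_apply, map_add, map_smul, hA.diff_one,
    smul_zero, add_zero]
  have e : C.cocurv c • A.one = (C.cocurv c - g.g₀ (C.codiff c) -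
      GHom.lunit (GrMod.unit 𝒜) (GHom.tmap g.g₀ g.g₀ (C.comul c))) • A.one +
      g.g₀ (C.codiff c) • A.one +
      GHom.lunit (GrMod.unit 𝒜) (GHom.tmap g.g₀ g.g₀ (C.comul c)) • A.one := by
    rw [sub_smul_unit, sub_smul_unit]
    abel
  rw [e]
  rw [← sub_eq_zero] at h ⊢
  rw [← h]
  abel

end
end functoriality

section cobar
variable {k : Type u} [Ring k] {𝒜 : ℤ → AddSubgroup k} [GradedRing 𝒜] [StronglyCommutative 𝒜]

/-! ### The cobar construction -/

namespace CACoalg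
variable (C : CACoalg 𝒜)

/-- The map `C → C̄[-1]`. -/
def toBarShift : GHom 1 C.data.C (C.data.bar.shift (-1)) :=
  ((C.data.shiftPr C.isCACoalg.counit_aug).comp (GHom.sigma (-1) C.data.C)).cast

/-- The inclusion `C̄[-1] → C`. -/
def ofBarShift : GHom (-1) (C.data.bar.shift (-1)) C.data.C :=
  ((GHom.sigmaInv (-1) C.data.C).comp C.data.shiftIncl).cast

theorem toBarShift_ofBarShift (x : C.data.bar.shift (-1)) :
    C.toBarShift (C.ofBarShift x) = x := by
  refine Subtype.ext ?_
  change C.ofBarShift x + -(C.data.counit (C.ofBarShift x) • C.data.aug) = C.ofBarShift x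
  rw [show C.data.counit (C.ofBarShift x) = 0 from x.2, zero_smul_unit, neg_zero, add_zero]

theorem ofBarShift_toBarShift (c : C.data.C) :
    C.ofBarShift (C.toBarShift c) = c - C.data.counit c • C.data.aug :=
  (sub_eq_add_neg _ _).symm

theorem counit_ofBarShift (x : C.data.bar.shift (-1)) : C.data.counit (C.ofBarShift x) = 0 := x.2

theorem toBarShift_aug : C.toBarShift C.data.aug = 0 := by
  refine Subtype.ext ?_
  change C.data.aug + -(C.data.counit C.data.aug • C.data.aug) = 0
  rw [C.isCACoalg.counit_aug]
  exact (congrArg (C.data.aug + -·) (one_smul k _)).trans (add_neg_cancel _)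

/-- The universal twisting cochain `C → Cobar C`. -/
noncomputable def univTw : GHom 1 C.data.C (cobarData C).A :=
  ((GHom.inj₁ (C.data.bar.shift (-1))).comp C.toBarShift).cast

theorem univTw_apply (c : C.data.C) : C.univTw c = GHom.inj₁ _ (C.toBarShift c) := rfl

theorem univTw_aug : C.univTw C.data.aug = 0 := by
  rw [univTw_apply, toBarShift_aug]
  exact map_zero (GHom.inj₁ _)

theorem univTw_ofBarShift (x : C.data.bar.shift (-1)) :
    C.univTw (C.ofBarShift x) = GHom.inj₁ _ x := by
  rw [univTw_apply, toBarShift_ofBarShift]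

end CACoalg

namespace GHom
variable {X Y : GrMod 𝒜}

theorem Tmap_injZero (f : GHom 0 X Y) (a : k) : Tmap f (injZero X a) = injZero Y a := by
  rw [injZero_eq, injZero_eq, map_smul, Tmap_one]

theorem Tmap_inj₁ (f : GHom 0 X Y) (x : X) : Tmap f (inj₁ X x) = inj₁ Y (f x) := by
  rw [inj₁_eq, inj₁_eq, Tmap_cons, tmap_tm₀, Tmap_one]

theorem mulT_tmap_inj₁ (s : X.tensor X) : mulT X (tmap (inj₁ X) (inj₁ X) s) = inj₂ X s := by
  refine tensor_ext (f := (mulT X).comp (tmap (inj₁ X) (inj₁ X))) (g := inj₂ X)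
    (fun i j x y hx hy => ?_) s
  rw [comp_apply, tmap_tm₀, ← cons_eq_mulT]
  refine (cons_tm_inj x 1 _).trans ?_
  exact (congrArg (inj X.tpow 2) (tmap_tm₀ (GHom.id X) (runitInv X) x y)).symm

theorem Tmap_mulT (f : GHom 0 X Y) (t u : X.T) :
    Tmap f (mulT X (tm t u)) = mulT Y (tm (Tmap f t) (Tmap f u)) := by
  refine T_cons_induction (p := fun t => Tmap f (mulT X (tm t u)) =
    mulT Y (tm (Tmap f t) (Tmap f u))) ?_ (fun a => ?_) (fun i j x s _ _ h => ?_)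
    (fun x y hx hy => ?_) t
  · simp only [tm_zero_left, map_zero]
  · rw [mulT_smul_left, map_smul, map_smul, mulT_one_left, Tmap_one, mulT_smul_left,
      mulT_one_left]
  · rw [mulT_cons_tm, Tmap_cons, Tmap_cons, tmap_tm₀, tmap_tm₀, h, mulT_cons_tm]
  · rw [tm_add_left, map_add, map_add, hx, hy, map_add, tm_add_left, map_add]

theorem Tmap_inj₂ (f : GHom 0 X Y) (s : X.tensor X) :
    Tmap f (inj₂ X s) = inj₂ Y (tmap f f s) := by
  refine tensor_ext (f := (Tmap f).comp (inj₂ X)) (g := (inj₂ Y).comp (tmap f f))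
    (fun i j x y hx hy => ?_) s
  rw [comp_apply, comp_apply, ← mulT_tmap_inj₁, ← mulT_tmap_inj₁, tmap_tm₀, tmap_tm₀, tmap_tm₀,
    Tmap_mulT, Tmap_inj₁, Tmap_inj₁]

/-- The square of an odd derivation is inner if it is so on generators. -/
theorem deriv_deriv (ξ : GHom 1 X X.T) {m : X.T} (hm : m ∈ X.T.deg 2)
    (h : ∀ x, deriv ξ (deriv ξ (inj₁ X x)) =
      mulT X (tm m (inj₁ X x)) - mulT X (tm (inj₁ X x) m)) (u : X.T) :
    deriv ξ (deriv ξ u) = mulT X (tm m u) - mulT X (tm u m) := by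
  refine T_cons_induction (p := fun u => deriv ξ (deriv ξ u) =
    mulT X (tm m u) - mulT X (tm u m)) ?_ (fun a => ?_) (fun i j x t hx ht ih => ?_)
    (fun x y hx hy => ?_) u
  · rw [map_zero, map_zero, tm_zero_right, tm_zero_left, map_zero, sub_zero]
  · rw [map_smul, map_smul, deriv_one, map_zero, smul_zero, mulT_smul_left, mulT_one_left]
    -- The element m has even degree, so it commutes with scalars without a sign.
    refine ring_induction (𝒜 := 𝒜) (p := fun a => 0 = mulT X (tm m (a • oneT X)) - a • m)
      ?_ (fun i a ha => ?_) (fun a b ha hb => ?_) a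
    · rw [zero_smul, tm_zero_right, map_zero, zero_smul, sub_zero]
    · rw [tm_smul ha hm, map_zsmul, map_smul, mulT_one_right, ksign_of_even ⟨i, by ring⟩,
        one_smul, sub_self]
    · rw [add_smul, tm_add_right, map_add, add_smul, add_sub_add_comm, ← ha, ← hb, add_zero]
  -- The mixed terms D(x)D(t) occur twice, with opposite signs because D is odd; the two middle
  -- terms x m t of the commutators cancel as well.
  · have hx' := (inj₁ X).map_mem₀ hx
    have hDt := (deriv ξ).map_mem ht
    rw [cons_eq_mulT, deriv_mul_tm ξ hx' ht, map_add, map_zsmul, deriv_mul_tm ξ hx' hDt,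
      deriv_mul_tm ξ ((deriv ξ).map_mem hx') ht, ih, h, smul_add, ksign_smul_self, one_mul, one_mul,
      ksign_add, ksign_one, mul_neg_one, neg_smul, sub_eq_add_neg, sub_eq_add_neg, tm_add_right,
      tm_add_left, tm_neg_right, tm_neg_left, map_add, map_add, map_neg, map_neg, mulT_assoc,
      mulT_assoc, mulT_assoc, sub_eq_add_neg]
    abel
  · rw [map_add, map_add, hx, hy, tm_add_left, tm_add_right, map_add, map_add]
    abel

end GHom

/-! ### The universal twisting cochain of the cobar construction and its curvature -/

namespace CACoalg
variable (C : CACoalg 𝒜)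

/-- The composite `C → C[-1] → T(C[-1]) → T(C̄[-1])`. -/
noncomputable def ξBar : GHom 2 C.data.C (cobarData C).A :=
  ((GHom.Tmap (C.data.shiftPr C.isCACoalg.counit_aug)).comp
    (C.data.ξCheck.comp (GHom.sigma (-1) C.data.C))).cast

/-- The components ξ₀, ξ₁, ξ₂ become δ₀η, −δ₁τ and −τ∗τ for the universal cochain τ: the quadratic
part of T is a product of two generators, so ξ₂ is a convolution square. -/
theorem ξBar_apply (c : C.data.C) : C.ξBar c = C.data.cocurv c • (cobarData C).one +
    -C.univTw (C.data.codiff c) +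
    -(cobarData C).mul (GHom.tmap C.univTw C.univTw (C.data.comul c)) := by
  have e : C.ξBar c = GHom.Tmap (C.data.shiftPr C.isCACoalg.counit_aug)
    (GHom.injZero _ (C.data.cocurv c) +
      GHom.inj₁ _ (-(GHom.sigma (-1) C.data.C (C.data.codiff c))) +
      GHom.inj₂ _ (-(GHom.tmap (GHom.sigma (-1) C.data.C) (GHom.sigma (-1) C.data.C)
        (C.data.comul c)))) := rfl
  rw [e, map_add, map_add, GHom.Tmap_injZero, GHom.Tmap_inj₁, GHom.Tmap_inj₂, map_neg, map_neg,
    map_neg, map_neg, GHom.injZero_eq,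
    GHom.tmap_tmap₁ _ _ _ _ C.toBarShift C.toBarShift (fun _ => rfl) (fun _ => rfl),
    ← GHom.mulT_tmap_inj₁]
  exact congrArg (fun t => _ + -GHom.mulT _ t)
    (GHom.tmap_tmap₁ _ _ _ _ C.univTw C.univTw (fun _ => rfl) (fun _ => rfl) _)

/-- The summand w ⊗ w dies under the projection to C̄, since w projects to 0. -/
theorem cobarCurv_eq : (cobarData C).curv = -C.ξBar C.data.aug := by
  have e : (cobarData C).curv = GHom.Tmap (C.data.shiftPr C.isCACoalg.counit_aug)
    (-GHom.inj₂ _ (tm C.data.shiftAug C.data.shiftAug) - C.data.ξCheck C.data.shiftAug) := rfl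
  rw [e, map_sub, map_neg, GHom.Tmap_inj₂, GHom.tmap_tm₀,
    show C.data.shiftPr C.isCACoalg.counit_aug C.data.shiftAug = 0 from C.toBarShift_aug,
    tm_zero_left, map_zero, neg_zero, zero_sub]
  rfl

/-- The universal cochain sees c only through c − ε(c)w, and the w-part of the differential is minus
the curvature. This is the Maurer–Cartan equation in disguise. -/
theorem cobar_diff_univTw (c : C.data.C) :
    (cobarData C).diff (C.univTw c) = C.ξBar c + C.data.counit c • (cobarData C).curv := by
  have e : (cobarData C).diff (C.univTw c) = C.ξBar (C.ofBarShift (C.toBarShift c)) :=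
    GHom.deriv_inj₁ _ _
  rw [e, ofBarShift_toBarShift, map_sub, map_smul, cobarCurv_eq, smul_neg, sub_eq_add_neg]

theorem isTwisting_univTw : IsTwisting C.data (cobarData C) C.univTw := by
  intro c
  rw [cobar_diff_univTw, ξBar_apply]
  abel

theorem cobar_isPrecurved : (cobarData C).IsPrecurved where
  mul_assoc := GHom.mulT_assoc
  leibniz := GHom.deriv_mul _
  mul_one := GHom.mulT_one_right
  one_mul := GHom.mulT_one_left
  diff_one := GHom.deriv_one _

/-- The Bianchi identity for the universal cochain; its right side vanishes by the axioms for δ₁²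
and δ₁δ₀. -/
theorem cobar_curvature (c : C.data.C) :
    (cobarData C).diff ((cobarData C).diff (C.univTw c)) -
      (cobarData C).mul (tm (cobarData C).curv (C.univTw c)) +
      (cobarData C).mul (tm (C.univTw c) (cobarData C).curv) -
      C.data.counit c • (cobarData C).diff (cobarData C).curv = 0 := by
  refine (C.isTwisting_univTw.curvature C.isCACoalg.isPrecurved C.cobar_isPrecurved c).trans ?_
  rw [C.isCACoalg.codiff_codiff, C.isCACoalg.cocurv_codiff, zero_smul_unit, map_sub,
    GHom.map_runit_tmap_sign C.univTw (GHom.id _) C.data.cocurv C.univTw (fun _ => rfl), GHom.map_lunit_tmap,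
    ksign_of_even (i := 1 * 2) ⟨1, rfl⟩, one_smul, sub_zero]
  have : GHom.tmap C.data.cocurv ((C.univTw.comp (GHom.id C.data.C)).cast (r := 1))
    (C.data.comul c) = GHom.tmap C.data.cocurv C.univTw (C.data.comul c) := rfl
  rw [this]
  abel

/-- Evaluate `cobar_curvature` at w, where the universal cochain vanishes and ε is 1. -/
theorem cobar_diff_curv : (cobarData C).diff (cobarData C).curv = 0 := by
  have h := C.cobar_curvature C.data.aug
  rw [univTw_aug, map_zero, map_zero, tm_zero_right, tm_zero_left, map_zero, sub_zero, add_zero,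
    C.isCACoalg.counit_aug, zero_sub, neg_eq_zero] at h
  exact (one_smul k _).symm.trans h

theorem isUCCAlg_cobarData : (cobarData C).IsUCCAlg :=
  { C.cobar_isPrecurved with
    -- On C̄ the counit vanishes, and `cobar_curvature` becomes the formula for m₁² on generators.
    diff_diff := GHom.deriv_deriv _ (C.data.cobarCurv_mem _) fun x => by
      have h := C.cobar_curvature (C.ofBarShift x)
      rw [univTw_ofBarShift, counit_ofBarShift, zero_smul_unit, sub_zero] at h
      rw [← sub_eq_zero, ← sub_add]
      exact h
    diff_curv := C.cobar_diff_curv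
    split_one := GHom.prZero_one }

end CACoalg
end cobar

section cobarFunctor
variable {k : Type u} [Ring k] {𝒜 : ℤ → AddSubgroup k} [GradedRing 𝒜] [StronglyCommutative 𝒜]

/-! ### Functoriality of the cobar construction -/

theorem AlgHomData.push_comp {C : CoalgData 𝒜} {A B D : AlgData 𝒜} (f : AlgHomData A B)
    {g : AlgHomData B D} (hg : g.IsHom) (θ : GHom 1 C.C A.A) (c : C.C) :
    (f.comp g).push θ c = g.push (f.push θ) c := by
  rw [g.push_apply, f.push_apply, map_add, map_smul, map_smul, hg.map_one]
  change g.f₁ (f.f₁ (θ c)) + C.counit c • ((g.und : k) + (f.und : k)) • D.one = _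
  rw [add_smul, smul_add]
  abel

theorem AlgHomData.push_id {C : CoalgData 𝒜} {A : AlgData 𝒜} (θ : GHom 1 C.C A.A) (c : C.C) :
    (AlgHomData.id A).push θ c = θ c := by
  rw [AlgHomData.push_apply]
  change θ c + C.counit c • (0 : k) • A.one = θ c
  rw [zero_smul, smul_zero, add_zero]

theorem CoalgHomData.pull_comp {C D E : CoalgData 𝒜} {A : AlgData 𝒜} (f : CoalgHomData C D)
    (g : CoalgHomData D E) (θ : GHom 1 E.C A.A) (c : C.C) :
    (f.comp g).pull θ c = f.pull (g.pull θ) c := by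
  rw [f.pull_apply, g.pull_apply]
  change θ (g.g₁ (f.g₁ c)) + ((f.g₀ c : k) + (g.g₀ (f.g₁ c) : k)) • A.one = _
  rw [add_smul, add_comm ((f.g₀ c : k) • A.one), add_assoc]

theorem CoalgHomData.pull_id {C : CoalgData 𝒜} {A : AlgData 𝒜} (θ : GHom 1 C.C A.A) (c : C.C) :
    (CoalgHomData.id C).pull θ c = θ c := by
  rw [CoalgHomData.pull_apply]
  change θ c + (0 : GrMod.unit 𝒜) • A.one = θ c
  rw [zero_smul_unit, add_zero]

/-- The source of naturality. Beyond linearity it needs only that f preserves the unit and g the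
counit. -/
theorem AlgHomData.push_pull {C D : CoalgData 𝒜} {A B : AlgData 𝒜} {f : AlgHomData A B}
    (hf : f.f₁ A.one = B.one) {g : CoalgHomData C D} (hg : ∀ c, D.counit (g.g₁ c) = C.counit c)
    (θ : GHom 1 D.C A.A) (c : C.C) : f.push (g.pull θ) c = g.pull (f.push θ) c := by
  rw [g.pull_apply, f.push_apply, f.push_apply, g.pull_apply, map_add, map_smul, hf, hg]
  abel

theorem AlgHomData.push_congr {C : CoalgData 𝒜} {A B : AlgData 𝒜} (f : AlgHomData A B)
    {θ θ' : GHom 1 C.C A.A} (h : ∀ c, θ c = θ' c) (c : C.C) : f.push θ c = f.push θ' c := by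
  rw [f.push_apply, f.push_apply, h]

theorem CoalgHomData.pull_congr {C D : CoalgData 𝒜} {A : AlgData 𝒜} (g : CoalgHomData C D)
    {θ θ' : GHom 1 D.C A.A} (h : ∀ c, θ c = θ' c) (c : C.C) : g.pull θ c = g.pull θ' c := by
  rw [g.pull_apply, g.pull_apply, h]

namespace GHom
variable {X P : GrMod 𝒜} {d : ℤ}

/-- By the two Leibniz rules a multiplicative map intertwines the derivations once it does so on
generators and on 1. -/
theorem map_deriv (ξ : GHom d X X.T) {μ : GHom 0 (P.tensor P) P} {D : GHom d P P}
    (hD : ∀ t, D (μ t) = μ (tmap (GHom.id P) D t) + μ (tmap D (GHom.id P) t))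
    {f : GHom 0 X.T P} (hmul : ∀ x y, f (mulT X (tm x y)) = μ (tm (f x) (f y)))
    (hone : D (f (oneT X)) = 0) (h : ∀ x, f (ξ x) = D (f (inj₁ X x))) (u : X.T) :
    f (deriv ξ u) = D (f u) := by
  refine T_ext (f := f.comp (deriv ξ)) (g := D.comp f) ?_ (fun i j x t hx ht ih => ?_) u
  · rw [comp_apply, comp_apply, deriv_one, map_zero, hone]
  · rw [comp_apply, comp_apply] at ih ⊢
    rw [deriv_cons_tm ξ x ht, map_add, map_zsmul, hmul, cons_eq_mulT, cons_eq_mulT, hmul, hmul, hD,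
      tmap_tm₀, tmap_tm _ _ _ (f.map_mem₀ ht), map_zsmul, ih, h]
    rfl

/-- Multiplicative unital maps on `T X` which agree on `X` are equal. -/
theorem T_algHom_ext {μ : GHom 0 (P.tensor P) P}
    {f g : GHom 0 X.T P} (hf : ∀ x y, f (mulT X (tm x y)) = μ (tm (f x) (f y)))
    (hg : ∀ x y, g (mulT X (tm x y)) = μ (tm (g x) (g y)))
    (h1 : f (oneT X) = g (oneT X)) (h : ∀ x, f (inj₁ X x) = g (inj₁ X x)) : f = g :=
  GHom.ext (T_ext h1 fun i j x t _ _ ih => by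
    rw [cons_eq_mulT, hf, hg, ih, h])

end GHom

/-! ### Morphisms out of the cobar construction -/

namespace CACoalg
variable (C : CACoalg 𝒜) {A : AlgData 𝒜}

theorem counit_ofBar_decomp (c : C.data.C) :
    c = C.ofBarShift (C.toBarShift c) + C.data.counit c • C.data.aug := by
  rw [ofBarShift_toBarShift, sub_add_cancel]

theorem push_univTw_aug (f : AlgHomData (cobarData C) A) :
    f.push C.univTw C.data.aug = (f.und : k) • A.one := by
  rw [f.push_apply, univTw_aug, map_zero, C.isCACoalg.counit_aug, zero_add]
  exact one_smul k _

theorem push_univTw_ofBarShift (f : AlgHomData (cobarData C) A)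
    (x : C.data.bar.shift (-1)) :
    f.push C.univTw (C.ofBarShift x) = f.f₁ (GHom.inj₁ _ x) := by
  rw [f.push_apply, univTw_ofBarShift, counit_ofBarShift, zero_smul_unit, add_zero]

/-- Comparing the image of the equation for the universal cochain with the equation for its push
leaves only terms in m₁ and m₀. These separate, because C = C̄ ⊕ kw. -/
theorem isHom_of_isTwisting (hA : A.IsPrecurved) {f : AlgHomData (cobarData C) A}
    (hmul : ∀ x y, f.f₁ ((cobarData C).mul (tm x y)) = A.mul (tm (f.f₁ x) (f.f₁ y)))
    (hone : f.f₁ (cobarData C).one = A.one)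
    (hθ : IsTwisting C.data A (f.push C.univTw)) : f.IsHom := by
  -- The summand coming from `und` is removed by adding its negative, which keeps the cochain
  -- twisting.
  have hθ' : IsTwisting C.data A ((f.f₁.comp C.univTw).cast (r := 1)) := by
    refine hθ.add_smul_one C.isCACoalg.isPrecurved hA (neg_mem f.und.2) fun c => ?_
    rw [f.push_apply, neg_smul, smul_neg, add_neg_cancel_right]
    rfl
  have hm : ∀ t, f.f₁ ((cobarData C).mul t) = A.mul (GHom.tmap f.f₁ f.f₁ t) :=
    GHom.tensor_ext (f := f.f₁.comp (cobarData C).mul) (g := A.mul.comp (GHom.tmap f.f₁ f.f₁))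
      (fun i j x y hx hy => by
        rw [GHom.comp_apply, GHom.comp_apply, hmul, GHom.tmap_tm₀])
  have key : ∀ c, f.f₁ ((cobarData C).diff (C.univTw c)) - C.data.counit c •
      f.f₁ (cobarData C).curv = A.diff (f.f₁ (C.univTw c)) - C.data.counit c • A.curv := by
    intro c
    have h₁ := congrArg f.f₁ (C.isTwisting_univTw c)
    have h₂ := hθ' c
    rw [map_add, map_add, map_add, map_smul, map_smul, hm, hone,
      GHom.tmap_tmap₁ C.univTw C.univTw f.f₁ f.f₁ ((f.f₁.comp C.univTw).cast (r := 1))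
      ((f.f₁.comp C.univTw).cast (r := 1)) (fun _ => rfl) (fun _ => rfl)] at h₁
    simp only [GHom.cast_apply, GHom.comp_apply] at h₂
    rw [← sub_eq_zero] at h₁ h₂ ⊢
    rw [← sub_zero (0 : A.A)]
    nth_rewrite 1 [← h₁]
    rw [← h₂]
    abel
  -- At w the terms in m₁ disappear, leaving the compatibility with the curvature.
  have hcurv : f.f₁ (cobarData C).curv = A.curv := by
    have h := key C.data.aug
    rw [univTw_aug, map_zero, map_zero, map_zero, C.isCACoalg.counit_aug, zero_sub,
      zero_sub, neg_inj] at h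
    exact (one_smul k _).symm.trans (h.trans (one_smul k _))
  refine ⟨hmul, ?_, hcurv, hone⟩
  refine GHom.map_deriv _ hA.leibniz hmul ((congrArg A.diff hone).trans hA.diff_one) fun x => ?_
  -- On C̄ the curvature terms disappear, leaving the compatibility with the differentials on
  -- generators.
  have h := key (C.ofBarShift x)
  rw [univTw_ofBarShift, hcurv, sub_left_inj] at h
  exact (congrArg f.f₁ (GHom.deriv_inj₁ _ x).symm).trans h

/-- The restriction of the cochain to C̄ gives f₁ on generators; its value at w is `und` times the
unit, from which the splitting recovers `und`. -/
theorem algHom_ext (hA : A.split A.one = (1 : k)) {f g : AlgHomData (cobarData C) A}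
    (hf : f.IsHom) (hg : g.IsHom) (h : ∀ c, f.push C.univTw c = g.push C.univTw c) : f = g := by
  refine AlgHomData.ext (GHom.T_algHom_ext hf.map_mul hg.map_mul
    (hf.map_one.trans hg.map_one.symm) fun x => ?_) (Subtype.ext ?_)
  · have := h (C.ofBarShift x)
    rwa [push_univTw_ofBarShift, push_univTw_ofBarShift] at this
  · have := congrArg A.split (h C.data.aug)
    rw [push_univTw_aug, push_univTw_aug, map_smul, map_smul, hA] at this
    exact (mul_one (f.und : k)).symm.trans (this.trans (mul_one (g.und : k)))

/-- The algebra map `Cobar C → A` given by a twisting cochain. -/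
noncomputable def ofTw (θ : GHom 1 C.data.C A.A) (l : 𝒜 1) : AlgHomData (cobarData C) A where
  f₁ := GHom.algExt A.mul A.one A.one_mem (θ.comp C.ofBarShift).cast
  und := l

theorem ofTw_inj₁ (hA : A.IsPrecurved) (θ : GHom 1 C.data.C A.A) (l : 𝒜 1)
    (x : C.data.bar.shift (-1)) : (C.ofTw θ l).f₁ (GHom.inj₁ _ x) = θ (C.ofBarShift x) :=
  GHom.algExt_inj₁ _ _ _ _ hA.mul_one x

/-- Since C = C̄ ⊕ kw, a cochain is determined by its restriction to C̄ and its value at w. -/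
theorem push_eq_of_aug {f : AlgHomData (cobarData C) A} {θ : GHom 1 C.data.C A.A}
    (h : ∀ x, f.f₁ (GHom.inj₁ _ x) = θ (C.ofBarShift x))
    (hl : θ C.data.aug = (f.und : k) • A.one) (c : C.data.C) : f.push C.univTw c = θ c := by
  conv_rhs => rw [C.counit_ofBar_decomp c, map_add, map_smul, hl]
  rw [f.push_apply, univTw_apply, h]

theorem isHom_ofTw (hA : A.IsPrecurved) {θ : GHom 1 C.data.C A.A} {l : 𝒜 1}
    (hθ : IsTwisting C.data A θ) (hl : θ C.data.aug = (l : k) • A.one) : (C.ofTw θ l).IsHom := by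
  refine C.isHom_of_isTwisting hA (GHom.algExt_mul _ _ _ _ hA.one_mul hA.mul_assoc)
    (GHom.algExt_one _ _ _ _) ?_
  rwa [show (C.ofTw θ l).push C.univTw = θ from
    GHom.ext (C.push_eq_of_aug (f := C.ofTw θ l) (C.ofTw_inj₁ hA θ l) hl)]

end CACoalg

section
variable {C D : CACoalg 𝒜} (g : C ⟶ D)

theorem cobarMap_inj₁ (x : C.data.bar.shift (-1)) :
    (cobarMap g).f₁ (GHom.inj₁ _ x) = g.data.pull D.univTw (C.ofBarShift x) := by
  refine (GHom.algExt_inj₁ _ _ _ _ GHom.mulT_one_right x).trans ?_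
  exact congrArg (fun z => D.univTw (g.data.g₁ (C.ofBarShift x)) + z)
    (GHom.injZero_eq (g.data.g₀ (C.ofBarShift x)))

theorem pull_univTw_aug : g.data.pull D.univTw C.data.aug =
    (g.data.g₀ C.data.aug : k) • (cobarData D).one := by
  rw [g.data.pull_apply, g.isHom.map_aug, D.univTw_aug, zero_add]

/-- Naturality of C → Cobar C. It characterizes Cobar g, and both its being a morphism and
functoriality are deduced from it. -/
theorem push_cobarMap (c : C.data.C) :
    (cobarMap g).push C.univTw c = g.data.pull D.univTw c :=
  C.push_eq_of_aug (cobarMap_inj₁ g) (pull_univTw_aug g) c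

theorem isHom_cobarMap : (cobarMap g).IsHom := by
  refine C.isHom_of_isTwisting D.cobar_isPrecurved
    (GHom.algExt_mul _ _ _ _ GHom.mulT_one_left GHom.mulT_assoc) (GHom.algExt_one _ _ _ _) ?_
  rw [show (cobarMap g).push C.univTw = g.data.pull D.univTw from GHom.ext (push_cobarMap g)]
  exact D.isTwisting_univTw.pull D.cobar_isPrecurved g.isHom

end

variable (𝒜) in
-- For identities and composites the two morphisms are compared on the universal cochain, where
-- pushing along Cobar g may be exchanged for pulling back along g.
theorem cobarIsFunctor : CobarIsFunctor 𝒜 where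
  obj := CACoalg.isUCCAlg_cobarData
  map := isHom_cobarMap
  map_id C := by
    refine C.algHom_ext GHom.prZero_one (isHom_cobarMap _) (AlgHomData.isHom_id _) fun c => ?_
    rw [push_cobarMap, AlgHomData.push_id]
    exact CoalgHomData.pull_id _ c
  map_comp {C D E} f g := by
    refine C.algHom_ext GHom.prZero_one (isHom_cobarMap _)
      ((isHom_cobarMap f).comp (isHom_cobarMap g)) fun c => ?_
    rw [push_cobarMap, AlgHomData.push_comp _ (isHom_cobarMap g),
      AlgHomData.push_congr _ (push_cobarMap f),
      AlgHomData.push_pull (isHom_cobarMap g).map_one f.isHom.map_counit,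
      CoalgHomData.pull_congr _ (push_cobarMap g)]
    exact CoalgHomData.pull_comp f.data g.data _ c

end cobarFunctor

section cutCoalgebra
variable {k : Type u} [Ring k] {𝒜 : ℤ → AddSubgroup k} [GradedRing 𝒜] [StronglyCommutative 𝒜]

/-! ### The cut coalgebra -/

namespace GHom
variable {X Y M N P Q C : GrMod 𝒜} {d e p q : ℤ}

/-- Homogeneous maps on `M ⊗ (N ⊗ P)` agree if they agree on pure tensors. -/
theorem tensor_ext₃ {f : GHom d (M.tensor (N.tensor P)) Q} {g : GHom e (M.tensor (N.tensor P)) Q}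
    (h : ∀ i j l (x : M) (y : N) (z : P), x ∈ M.deg i → y ∈ N.deg j → z ∈ P.deg l →
      f (tm x (tm y z)) = g (tm x (tm y z))) (t : M.tensor (N.tensor P)) : f t = g t :=
  tensor_ext (fun i j x s hx hs =>
    tm_induction (p := fun s => f (tm x s) = g (tm x s))
      (by rw [tm_zero_right, map_zero, map_zero]) (fun j l y z hy hz => h i j l x y z hx hy hz)
      (fun s t hs ht => by rw [tm_add_right, map_add, map_add, hs, ht]) s) t

/-- `X ⊗ (T X ⊗ T X) → T X ⊗ T X`, `x ⊗ (t ⊗ u) ↦ x t ⊗ u`. -/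
noncomputable def consT (X : GrMod 𝒜) : GHom 0 (X.tensor (X.T.tensor X.T)) (X.T.tensor X.T) :=
  ((tmap (cons X) (GHom.id X.T)).comp (assocInv X X.T X.T)).cast

theorem consT_tm (x : X) (t u : X.T) : consT X (tm x (tm t u)) = tm (cons X (tm x t)) u :=
  tmap_tm₀ (cons X) (GHom.id X.T) (tm x t) u

theorem cut_one : cut X (oneT X) = tm (oneT X) (oneT X) :=
  (desc_inj (cut.go X) 0 (1 : k)).trans (one_smul k (tm (oneT X) (oneT X)))

/-- A word is cut either in front of its first letter or somewhere behind it. -/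
theorem cut_cons (s : X.tensor X.T) :
    cut X (cons X s) = tm (oneT X) (cons X s) + consT X (tmap (GHom.id X) (cut X) s) := by
  refine XT_ext (f := (cut X).comp (cons X))
    (g := ((tmap (injZero X) (GHom.id X.T)).comp ((lunitInv X.T).comp (cons X))).cast +
      ((consT X).comp (tmap (GHom.id X) (cut X))).cast (r := 0)) (fun i j n x t hx ht => ?_) s
    |>.trans ?_
  · rw [comp_apply, cons_tm_inj]
    refine (desc_inj (cut.go X) (n + 1) _).trans ?_
    rw [add_apply, cast_apply, cast_apply, comp_apply, comp_apply, comp_apply, cons_tm_inj]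
    refine congrArg (fun z => tmap (injZero X) (GHom.id X.T) (lunitInv X.T
      (injSucc X n (tm x t))) + z) ?_
    refine congrArg (consT X) ((tmap_tm₀ _ _ x t).trans ?_)
    rw [tmap_tm₀]
    exact congrArg (tm x) (desc_inj (cut.go X) n t).symm
  · rw [add_apply]
    exact congrArg (· + _) (tmap_tm₀ (injZero X) (GHom.id X.T) (1 : k) (cons X s))

theorem tmap_zero_fst {f : GHom p M P} {x : M} (hx : f x = 0) (g : GHom q N Q) (y : N) :
    tmap f g (tm x y) = 0 :=
  N.hom_induction (p := fun y => tmap f g (tm x y) = 0) (by rw [tm_zero_right, map_zero])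
    (fun j y hy => by rw [tmap_tm _ _ _ hy, hx, tm_zero_left, smul_zero])
    (fun y y' h h' => by rw [tm_add_right, map_add, h, h', add_zero]) y

theorem counit_cut (u : X.T) : lunit X.T (tmap (prZero X) (GHom.id X.T) (cut X u)) = u := by
  refine T_ext (f := (lunit X.T).comp ((tmap (prZero X) (GHom.id X.T)).comp (cut X)))
    (g := GHom.id X.T) ?_ (fun i j x t _ _ _ => ?_) u
  · rw [comp_apply, comp_apply, cut_one, tmap_tm₀, lunit_tm, prZero_one]
    exact one_smul k _
  · rw [comp_apply, comp_apply, cut_cons, map_add, map_add, tmap_tm₀, lunit_tm, prZero_one]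
    have : ∀ s, lunit X.T (tmap (prZero X) (GHom.id X.T) (consT X s)) = 0 :=
      tensor_ext₃ (f := (lunit X.T).comp ((tmap (prZero X) (GHom.id X.T)).comp (consT X)))
        (g := (0 : GHom 0 _ _)) (fun i j l x y z _ _ _ => by
          rw [comp_apply, comp_apply, consT_tm, tmap_zero_fst (prZero_cons _), map_zero]; rfl)
    rw [this, add_zero]
    exact one_smul k _

theorem cut_counit (u : X.T) : runit X.T (tmap (GHom.id X.T) (prZero X) (cut X u)) = u := by
  have h : ∀ s, runit X.T (tmap (GHom.id X.T) (prZero X) (consT X s)) =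
      cons X (tmap (GHom.id X) ((runit X.T).comp (tmap (GHom.id X.T) (prZero X))) s) :=
    tensor_ext₃ (f := (runit X.T).comp ((tmap (GHom.id X.T) (prZero X)).comp (consT X)))
      (g := (cons X).comp (tmap (GHom.id X) ((runit X.T).comp (tmap (GHom.id X.T) (prZero X)))))
      (fun i j l x y z hx hy hz => by
        rw [comp_apply, comp_apply, comp_apply, consT_tm, tmap_tm₀, tmap_tm₀, comp_apply, tmap_tm₀]
        have hz' := (prZero X).map_mem₀ hz
        rw [id_apply, id_apply, id_apply, runit_tm (cons_mem hx hy) hz', runit_tm hy hz',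
          tm_zsmul_right, tm_smul hz' hx, map_zsmul, map_zsmul, map_smul, smul_smul, ← ksign_add,
          mul_add, add_comm])
  refine T_ext (f := (runit X.T).comp ((tmap (GHom.id X.T) (prZero X)).comp (cut X)))
    (g := GHom.id X.T) ?_ (fun i j x t _ _ ih => ?_) u
  · rw [comp_apply, comp_apply, cut_one, tmap_tm₀, prZero_one]
    exact runit_tm_one _
  · rw [comp_apply, comp_apply] at ih
    rw [comp_apply, comp_apply, cut_cons, map_add, map_add, tmap_tm₀, prZero_cons, tm_zero_right,
      map_zero, zero_add, h, tmap_tm₀, tmap_tm₀, comp_apply, ih]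
    rfl

/-- Induction on the length: both sides expand in the same way when a letter is put in front. -/
theorem cut_coassoc (u : X.T) : assocInv X.T X.T X.T (tmap (GHom.id X.T) (cut X) (cut X u)) =
    tmap (cut X) (GHom.id X.T) (cut X u) := by
  -- W puts a letter in front of the first of three words: x ⊗ ((s ⊗ t) ⊗ u) goes to (xs ⊗ t) ⊗ u.
  set W : GHom 0 (X.tensor ((X.T.tensor X.T).tensor X.T)) ((X.T.tensor X.T).tensor X.T) :=
    ((tmap (consT X) (GHom.id X.T)).comp (assocInv X (X.T.tensor X.T) X.T)).cast with hW
  have hWtm : ∀ x s u, W (tm x (tm s u)) = tm (consT X (tm x s)) u :=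
    fun x s u => tmap_tm₀ (consT X) (GHom.id X.T) (tm x s) u
  have h₀ : ∀ (x : X) (a : X.T) (s : X.T.tensor X.T),
      assocInv X.T X.T X.T (tm (cons X (tm x a)) s) =
        W (tm x (assocInv X.T X.T X.T (tm a s))) := fun x a s =>
    tm_induction (p := fun s => assocInv X.T X.T X.T (tm (cons X (tm x a)) s) =
        W (tm x (assocInv X.T X.T X.T (tm a s))))
      (by rw [tm_zero_right, map_zero, tm_zero_right, map_zero, tm_zero_right, map_zero])
      (fun i j y z _ _ => by rw [assocInv_tm, assocInv_tm, hWtm, consT_tm])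
      (fun s t hs ht => by
        rw [tm_add_right, map_add, hs, ht, tm_add_right, map_add, tm_add_right, map_add]) s
  have h₁ : ∀ (x : X) (v : X.T.tensor X.T),
      assocInv X.T X.T X.T (tmap (GHom.id X.T) (cut X) (consT X (tm x v))) =
        W (tm x (assocInv X.T X.T X.T (tmap (GHom.id X.T) (cut X) v))) := fun x v =>
    tm_induction (p := fun v =>
        assocInv X.T X.T X.T (tmap (GHom.id X.T) (cut X) (consT X (tm x v))) =
        W (tm x (assocInv X.T X.T X.T (tmap (GHom.id X.T) (cut X) v))))
      (by simp only [tm_zero_right, map_zero])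
      (fun i j y z _ _ => by rw [consT_tm, tmap_tm₀, tmap_tm₀, id_apply, id_apply, h₀])
      (fun s t hs ht => by
        rw [tm_add_right, map_add, map_add, map_add, hs, ht, map_add, map_add, tm_add_right,
          map_add]) v
  have h₂ : ∀ (x : X) (v : X.T.tensor X.T), tmap (cut X) (GHom.id X.T) (consT X (tm x v)) =
      assocInv X.T X.T X.T (tm (oneT X) (consT X (tm x v))) +
        W (tm x (tmap (cut X) (GHom.id X.T) v)) := fun x v =>
    tm_induction (p := fun v => tmap (cut X) (GHom.id X.T) (consT X (tm x v)) =
      assocInv X.T X.T X.T (tm (oneT X) (consT X (tm x v))) +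
        W (tm x (tmap (cut X) (GHom.id X.T) v)))
      (by simp only [tm_zero_right, map_zero, add_zero])
      (fun i j y z _ _ => by
        rw [consT_tm, tmap_tm₀, tmap_tm₀, id_apply, cut_cons, tmap_tm₀, tm_add_left, assocInv_tm,
          hWtm, id_apply])
      (fun s t hs ht => by
        rw [tm_add_right, map_add, map_add, hs, ht, tm_add_right, map_add, map_add, tm_add_right,
          map_add]
        abel) v
  refine T_ext (f := (assocInv X.T X.T X.T).comp ((tmap (GHom.id X.T) (cut X)).comp (cut X)))
    (g := (tmap (cut X) (GHom.id X.T)).comp (cut X)) ?_ (fun i j x t _ _ ih => ?_) u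
  · rw [comp_apply, comp_apply, comp_apply, cut_one, tmap_tm₀, tmap_tm₀, cut_one, id_apply,
      assocInv_tm]
  · rw [comp_apply, comp_apply, comp_apply] at ih
    rw [comp_apply, comp_apply, comp_apply, cut_cons, map_add, map_add, map_add, tmap_tm₀,
      tmap_tm₀, cut_cons, tmap_tm₀, tmap_tm₀, cut_one, tm_add_right, map_add, h₁, h₂, ih, id_apply, id_apply,
      id_apply, assocInv_tm, add_assoc]

/-- The projection of the cut comultiplication to `X ⊗ T X`. -/
theorem tmap_prOne_cut_cons (F : GHom q X.T N) (s : X.tensor X.T) :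
    tmap (prOne X) F (cut X (cons X s)) = tmap (GHom.id X) F s := by
  -- Only the cut right behind the first letter leaves a word of length one on the left.
  have h : ∀ s, tmap (prOne X) (GHom.id X.T) (consT X s) =
      tmap (GHom.id X) ((lunit X.T).comp (tmap (prZero X) (GHom.id X.T))) s :=
    tensor_ext₃ (f := (tmap (prOne X) (GHom.id X.T)).comp (consT X))
      (g := tmap (GHom.id X) ((lunit X.T).comp (tmap (prZero X) (GHom.id X.T))))
      (fun i j l x y z hx hy _ => by
        have hy' := (prZero X).map_mem₀ hy
        rw [comp_apply, consT_tm, tmap_tm₀, tmap_tm₀, comp_apply, tmap_tm₀, prOne_cons, tmap_tm₀,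
          id_apply, id_apply, lunit_tm, runit_tm hx hy', tm_smul hy' hx, tm_zsmul_left, smul_tm])
  rw [← tmap_tmap₀ (prOne X) (GHom.id X.T) (GHom.id X) F (prOne X) F (add_zero 0).symm
    (fun _ => rfl) (fun _ => rfl), cut_cons, map_add, tmap_tm₀, prOne_one, tm_zero_left]
  refine (congrArg (tmap (GHom.id X) F) (zero_add _)).trans ?_
  rw [h, tmap_tmap₀ (GHom.id X) (cut X) (GHom.id X)
    ((lunit X.T).comp (tmap (prZero X) (GHom.id X.T))) (GHom.id X) (GHom.id X.T) (add_zero 0).symm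
    (fun _ => rfl) (fun u => (counit_cut u).symm), tmap_id_id]

theorem tmap_prOne_cut_one (F : GHom q X.T N) : tmap (prOne X) F (cut X (oneT X)) = 0 := by
  rw [cut_one, tmap_zero_fst prOne_one]

/-- Uniqueness of solutions of `E = (pr₁ ⊗ E) Θ` on `T X`. -/
theorem T_fix_unique (Θ : GHom 0 (X.tensor P) P) (E : GHom d X.T P)
    (h : ∀ u, E u = Θ (tmap (prOne X) E (cut X u))) (u : X.T) : E u = 0 := by
  refine T_ext (f := E) (g := (0 : GHom d _ _)) ?_ (fun i j x t _ _ ih => ?_) u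
  -- No condition at 1 is needed: no cut of the empty word has a letter on its left, so the equation
  -- itself gives E(1) = 0.
  · rw [h, tmap_prOne_cut_one, map_zero]; rfl
  · rw [h, tmap_prOne_cut_cons, tmap_tm₀, ih, zero_apply, tm_zero_right, map_zero]; rfl

/-- The rule `cut_cons` in a form valid for every u. This is the form to which `T_fix_unique`
applies. -/
theorem cut_rec (u : X.T) :
    cut X u = tm (oneT X) u + consT X (tmap (prOne X) (cut X) (cut X u)) := by
  refine T_cons_induction (p := fun u =>
    cut X u = tm (oneT X) u + consT X (tmap (prOne X) (cut X) (cut X u))) ?_ (fun a => ?_)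
    (fun i j x t _ _ _ => ?_) (fun x y hx hy => ?_) u
  · simp only [map_zero, tm_zero_right, add_zero]
  · rw [map_smul, map_smul, map_smul, tmap_prOne_cut_one, map_zero, smul_zero, add_zero, cut_one]
    refine ring_induction (𝒜 := 𝒜) (p := fun a => a • tm (oneT X) (oneT X) =
      tm (oneT X) (a • oneT X)) ?_ (fun i a ha => ?_) (fun a b ha hb => ?_) a
    · rw [zero_smul, zero_smul, tm_zero_right]
    · rw [tm_smul ha (oneT_mem X), mul_zero, ksign_zero, one_smul]
    · rw [add_smul, add_smul, tm_add_right, ha, hb]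
  · rw [tmap_prOne_cut_cons, ← cut_cons]
  · rw [map_add, map_add, map_add, tm_add_right]
    nth_rewrite 1 [hx]
    nth_rewrite 1 [hy]
    abel

/-- The recursion of a coalgebra map for the identity: an element is its scalar part plus its first
letters followed by the rest. -/
theorem T_rec (u : X.T) :
    u = prZero X u • oneT X + cons X (tmap (prOne X) (GHom.id X.T) (cut X u)) := by
  refine T_ext (f := GHom.id X.T) (g := smulElem' (prZero X) (oneT_mem X) +
    conv (cut X) (cons X) (prOne X) (GHom.id X.T)) ?_ (fun i j x t _ _ _ => ?_) u
  · rw [add_apply, conv_apply, tmap_prOne_cut_one, smulElem'_apply, prZero_one, map_zero, add_zero]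
    exact (one_smul k _).symm
  · rw [add_apply, conv_apply, tmap_prOne_cut_cons, smulElem'_apply, prZero_cons, zero_smul_unit,
      zero_add, tmap_id_id]
    rfl

/-! ### Coderivations of the cut coalgebra -/

section coderiv
variable (b : GHom d X.T X)

/-- In each term either b consumes an initial segment, possibly empty, or the first letter is kept
and the coderivation acts on the rest. -/
theorem coderiv_rec (u : X.T) : coderiv b u =
    cons X (tmap b (GHom.id X.T) (cut X u)) + cons X (tmap (prOne X) (coderiv b) (cut X u)) := by
  set L : GHom d X.T X.T := (conv (cut X) (cons X) b (GHom.id X.T)).cast with hL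
  have hD : ∀ u, coderiv b u = mulT X (tmap (GHom.id X.T) L (cut X u)) := fun _ => rfl
  have h : ∀ s, mulT X (tmap (GHom.id X.T) L (consT X s)) =
      cons X (tmap (GHom.id X) ((mulT X).comp (tmap (GHom.id X.T) L)) s) :=
    tensor_ext₃ (f := (mulT X).comp ((tmap (GHom.id X.T) L).comp (consT X)))
      (g := (cons X).comp (tmap (GHom.id X) ((mulT X).comp (tmap (GHom.id X.T) L))))
      (fun i j l x y z hx hy _ => by
        rw [comp_apply, comp_apply, comp_apply, consT_tm, tmap_tm₀, tmap_tm₀, comp_apply, tmap_tm₀,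
          id_apply, id_apply, id_apply, mulT_cons_tm])
  refine T_ext (f := coderiv b) (g := L + (conv (cut X) (cons X) (prOne X) (coderiv b)).cast)
    ?_ (fun i j x t _ _ _ => ?_) u
  · change _ = L (oneT X) + cons X (tmap (prOne X) (coderiv b) (cut X (oneT X)))
    rw [tmap_prOne_cut_one, map_zero, add_zero, hD, cut_one,
      tmap_tm₀, id_apply, mulT_one_left]
  · change _ = L (cons X (tm x t)) +
      cons X (tmap (prOne X) (coderiv b) (cut X (cons X (tm x t))))
    rw [tmap_prOne_cut_cons, hD, cut_cons, map_add, map_add,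
      tmap_tm₀, id_apply, mulT_one_left, h,
      tmap_tmap₀ (GHom.id X) (cut X) _ _ (GHom.id X) (coderiv b) (add_zero 0).symm
        (fun _ => rfl) (fun _ => rfl)]

theorem prZero_coderiv (u : X.T) : prZero X (coderiv b u) = 0 := by
  rw [coderiv_rec, map_add, prZero_cons, prZero_cons, add_zero]

/-- In `coderiv_rec` a single letter results only if nothing follows it. The terms that keep the
first letter do not contribute, since a coderivation has no scalar component. -/
theorem prOne_coderiv (u : X.T) : prOne X (coderiv b u) = b u := by
  rw [coderiv_rec, map_add, prOne_cons, prOne_cons,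
    tmap_tmap₁ (prOne X) (coderiv b) (GHom.id X) (prZero X) (prOne X)
      (0 : GHom d X.T (GrMod.unit 𝒜)) (fun _ => rfl) (fun u => (prZero_coderiv b u).symm),
    tmap_zero_right, map_zero, add_zero,
    tmap_tmap₁ b (GHom.id X.T) (GHom.id X) (prZero X) b (prZero X) (fun _ => rfl) (fun _ => rfl)]
  have h := map_runit_tmap_sign b (GHom.id X.T) (prZero X) b (fun _ => rfl) (cut X u)
  rw [cut_counit, mul_zero, ksign_zero, one_smul] at h
  exact h.symm

/-- Each of the three terms satisfies a recursion in the first letter. The inhomogeneous parts, 1 ⊗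
D(u) and those where b consumes the front, add up correctly, so the difference vanishes by
`T_fix_unique`. -/
theorem cut_coderiv (u : X.T) : cut X (coderiv b u) =
    tmap (GHom.id X.T) (coderiv b) (cut X u) + tmap (coderiv b) (GHom.id X.T) (cut X u) := by
  set D := coderiv b with hD
  set F₁ : GHom d X.T (X.T.tensor X.T) := ((cut X).comp D).cast with hF₁
  set F₂ : GHom d X.T (X.T.tensor X.T) := ((tmap (GHom.id X.T) D).comp (cut X)).cast with hF₂
  set F₃ : GHom d X.T (X.T.tensor X.T) := ((tmap D (GHom.id X.T)).comp (cut X)).cast with hF₃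
  have e₁ : ∀ u, F₁ u = tm (oneT X) (D u) + consT X (tmap b (cut X) (cut X u)) +
      consT X (tmap (prOne X) F₁ (cut X u)) := by
    intro u
    change cut X (D u) = _
    conv_lhs => rw [hD, coderiv_rec, ← hD]
    rw [map_add, cut_cons, cut_cons, ← tmap_tmap₁ b (GHom.id X.T) (GHom.id X) (cut X) b (cut X)
      (fun _ => rfl) (fun _ => rfl), ← tmap_tmap₁ (prOne X) D (GHom.id X) (cut X) (prOne X) F₁
      (fun _ => rfl) (fun _ => rfl)]
    nth_rewrite 4 [hD]
    rw [coderiv_rec, ← hD, tm_add_right]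
    abel
  have e₂ : ∀ u, F₂ u = tm (oneT X) (D u) + consT X (tmap (prOne X) F₂ (cut X u)) := by
    intro u
    have h : ∀ s, tmap (GHom.id X.T) D (consT X s) =
        consT X (tmap (GHom.id X) (tmap (GHom.id X.T) D) s) :=
      tensor_ext₃ (f := (tmap (GHom.id X.T) D).comp (consT X))
        (g := (consT X).comp (tmap (GHom.id X) (tmap (GHom.id X.T) D)))
        (fun i j l x y z hx hy _ => by
          rw [comp_apply, comp_apply, consT_tm, tmap_tm₀, tmap_tm₀, tmap_tm₀, consT_tm]; rfl)
    change tmap (GHom.id X.T) D (cut X u) = _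
    rw [cut_rec, map_add, tmap_tm₀, h, tmap_tmap₀ (prOne X) (cut X) _ _ (prOne X) F₂
      (add_zero 0).symm (fun _ => rfl) (fun _ => rfl), ← cut_rec]
    rfl
  have e₃ : ∀ u, F₃ u = consT X (tmap b (cut X) (cut X u)) +
      consT X (tmap (prOne X) F₃ (cut X u)) := by
    intro u
    have hμ : ∀ {i j l : ℤ} (x : X) (y z : X.T), x ∈ X.deg i → y ∈ X.T.deg j → z ∈ X.T.deg l →
        consT X (tm x (GHom.id (X.T.tensor X.T) (tm y z))) =
        GHom.id (X.T.tensor X.T) (tm (cons X (tm x y)) z) := fun x y z _ _ _ => consT_tm x y z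
    have h₁ := conv_assoc cut_coassoc hμ b (GHom.id X.T) (GHom.id X.T) u
    have h₂ := conv_assoc cut_coassoc hμ (prOne X) D (GHom.id X.T) u
    rw [conv_apply, conv_apply, tmap_congr (f' := b) (g' := cut X) rfl (fun _ => rfl)
      (fun u => tmap_id_id (cut X u)), id_apply] at h₁
    rw [conv_apply, conv_apply, tmap_congr (f := prOne X) (f' := prOne X)
      (g := conv (cut X) (GHom.id _) D (GHom.id X.T)) (g' := F₃) rfl (fun _ => rfl)
      (fun _ => rfl), id_apply] at h₂
    set M₁ : GHom d X.T X.T := (conv (cut X) (cons X) b (GHom.id X.T)).cast with hM₁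
    set M₂ : GHom d X.T X.T := (conv (cut X) (cons X) (prOne X) D).cast with hM₂
    have hDM : ∀ u, D u = (M₁ + M₂) u := coderiv_rec b
    rw [tmap_congr (f := conv (cut X) (cons X) b (GHom.id X.T)) (f' := M₁) (g := GHom.id X.T)
      (g' := GHom.id X.T) (add_zero d) (fun _ => rfl) (fun _ => rfl)] at h₁
    rw [tmap_congr (f := conv (cut X) (cons X) (prOne X) D) (f' := M₂) (g := GHom.id X.T)
      (g' := GHom.id X.T) (zero_add d) (fun _ => rfl) (fun _ => rfl)] at h₂
    change tmap D (GHom.id X.T) (cut X u) = _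
    rw [tmap_congr (f' := M₁ + M₂) (g' := GHom.id X.T) rfl hDM (fun _ => rfl), tmap_add_left, h₁,
      h₂]

  have h := T_fix_unique (consT X) (F₁ + -(F₂ + F₃)) (fun u => by
    rw [tmap_add_right, tmap_neg_right, tmap_add_right, map_add, map_neg, map_add, add_apply,
      neg_apply, add_apply, e₁, e₂, e₃]
    abel) u
  rw [add_apply, neg_apply, add_apply, add_neg_eq_zero] at h
  exact h

end coderiv
end GHom
end cutCoalgebra

/-! ### Commutators of coalgebra maps with functionals -/

section recursion
variable {k : Type u} [Ring k] {𝒜 : ℤ → AddSubgroup k} [GradedRing 𝒜] [StronglyCommutative 𝒜]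

namespace GHom
variable {X Y M N P Q C : GrMod 𝒜} {d e p q : ℤ}

/-- With the counit axiom this reduces φ∗(ε·m) to φ·m. The mirror statement for (ε·m)∗φ has the same
value, so unit terms drop out of commutators. -/
theorem lunit_tmap_smulElem {m : P} (hm : m ∈ P.deg 0) (φ : GHom p M (GrMod.unit 𝒜))
    (ε : GHom 0 N (GrMod.unit 𝒜)) (t : M.tensor N) :
    lunit P (tmap φ (smulElem' ε hm (r := 0)) t) = φ (runit M (tmap (GHom.id M) ε t)) • m := by
  refine tensor_ext (f := (lunit P).comp (tmap φ (smulElem' ε hm (r := 0))))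
    (g := smulElem' (φ.comp ((runit M).comp (tmap (GHom.id M) ε))) hm rfl)
    (fun i j x y hx hy => ?_) t
  have hy' := ε.map_mem₀ hy
  rw [comp_apply, smulElem'_apply, comp_apply, comp_apply, tmap_tm _ _ _ hy, tmap_tm₀, id_apply,
    map_zsmul, lunit_tm, runit_tm hx hy', map_zsmul, map_smul, smulElem'_apply]
  change ksign (p * j) • (φ x : k) • (ε y : k) • m = (ksign (j * i) • ((ε y : k) * (φ x : k))) • m
  rw [smul_smul, smul_assoc, StronglyCommutative.comm (φ.map_mem hx) hy', smul_assoc, smul_smul,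
    ← ksign_add]
  congr 1
  exact ksign_eq_of_even_sub ⟨-(j * i), by ring⟩

theorem runit_tmap_smulElem {m : P} (hm : m ∈ P.deg 0) (φ : GHom p N (GrMod.unit 𝒜))
    (ε : GHom 0 M (GrMod.unit 𝒜)) (t : M.tensor N) :
    runit P (tmap (smulElem' ε hm (r := 0)) φ t) = φ (lunit N (tmap ε (GHom.id N) t)) • m := by
  refine tensor_ext (f := (runit P).comp (tmap (smulElem' ε hm (r := 0)) φ))
    (g := smulElem' (φ.comp ((lunit N).comp (tmap ε (GHom.id N)))) hm rfl)
    (fun i j x y hx hy => ?_) t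
  have hx' := ε.map_mem₀ hx
  have hxm := P.smul_mem hx' hm
  rw [add_zero] at hxm
  rw [comp_apply, smulElem'_apply, comp_apply, comp_apply, tmap_tm₀, tmap_tm₀, id_apply,
    smulElem'_apply, runit_tm hxm (φ.map_mem hy), lunit_tm, map_smul]
  change ksign ((j + p) * i) • (φ y : k) • (ε x : k) • m = ((ε x : k) * (φ y : k)) • m
  rw [smul_smul, StronglyCommutative.comm hx' (φ.map_mem hy), smul_assoc, mul_comm i,
    ksign_smul_self]

theorem runit_cons {i j l : ℤ} {x : X} {t : X.T} {a : GrMod.unit 𝒜} (hx : x ∈ X.deg i)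
    (ht : t ∈ X.T.deg j) (ha : a ∈ 𝒜 l) :
    cons X (tm x (runit X.T (tm t a))) = runit X.T (tm (cons X (tm x t)) a) := by
  rw [runit_tm (cons_mem hx ht) ha, runit_tm ht ha, tm_zsmul_right, tm_smul ha hx, map_zsmul,
    map_zsmul, map_smul, smul_smul, ← ksign_add, mul_add, add_comm]

theorem cons_lunit {i l : ℤ} {x : X} {a : GrMod.unit 𝒜} (hx : x ∈ X.deg i) (ha : a ∈ 𝒜 l)
    (t : X.T) : cons X (tm x (lunit X.T (tm a t))) = cons X (tm (runit X (tm x a)) t) := by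
  rw [runit_tm hx ha, lunit_tm, tm_smul ha hx, tm_zsmul_left, smul_tm]

/-- A recursive formula for the commutator of a map `g : C → T X` with a functional. -/
theorem commutator_rec {δ : GHom 0 C (C.tensor C)} {ε : GHom 0 C (GrMod.unit 𝒜)}
    (hδ : ∀ x, assocInv C C C (tmap (GHom.id C) δ (δ x)) = tmap δ (GHom.id C) (δ x))
    (hr : ∀ x, runit C (tmap (GHom.id C) ε (δ x)) = x)
    (hl : ∀ x, lunit C (tmap ε (GHom.id C) (δ x)) = x)
    {γ : GHom 0 C X} {g : GHom 0 C X.T}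
    (hg : ∀ c, g c = ε c • oneT X + cons X (tmap γ g (δ c)))
    (φ : GHom p C (GrMod.unit 𝒜)) {G : GHom p C X.T} {κ : GHom p C X}
    (hG : ∀ c, G c = lunit X.T (tmap φ g (δ c)) - runit X.T (tmap g φ (δ c)))
    (hκ : ∀ c, κ c = lunit X (tmap φ γ (δ c)) - runit X (tmap γ φ (δ c))) (c : C) :
    G c = cons X (tmap γ G (δ c)) + cons X (tmap κ g (δ c)) := by
  set η : GHom 0 C X.T := smulElem' ε (oneT_mem X) with hη
  set Nn : GHom 0 C X.T := (conv δ (cons X) γ g).cast (by norm_num) with hN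
  set L : GHom p C X.T := (conv δ (lunit X.T) φ g).cast (by ring) with hL
  set R : GHom p C X.T := (conv δ (runit X.T) g φ).cast (by ring) with hR
  set κ₁ : GHom p C X := (conv δ (lunit X) φ γ).cast (by ring) with hκ₁
  set κ₂ : GHom p C X := (conv δ (runit X) γ φ).cast (by ring) with hκ₂
  have hgN : ∀ c, g c = (η + Nn) c := hg
  -- In convolution notation φ∗g = φ·1 + (φ∗γ)∗g and g∗φ = φ·1 + γ∗(g∗φ), while γ∗(φ∗g) = (γ∗φ)∗g.
  -- Subtracting gives the recursion.
  have e₁ : L c = φ c • oneT X + cons X (tmap κ₁ g (δ c)) := by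
    change lunit X.T (tmap φ g (δ c)) = _
    rw [tmap_congr (f := φ) (f' := φ) (g := g) (g' := η + Nn) rfl (fun _ => rfl) hgN,
      tmap_add_right, map_add, lunit_tmap_smulElem, hr]
    congr 1
    have h := conv_assoc hδ (μ₁ := lunit X.T) (μ₂ := cons X) (μ₃ := cons X) (μ₄ := lunit X)
      (fun a x t _ _ _ => by rw [lunit_tm, lunit_tm, smul_tm, map_smul]) φ γ g c
    refine .trans (congrArg (lunit X.T) (tmap_congr rfl (fun _ => rfl) (fun _ => rfl) _))
      (h.trans (congrArg (cons X) (tmap_congr (add_zero p) (fun _ => rfl) (fun _ => rfl) _)))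
  have e₂ : R c = φ c • oneT X + cons X (tmap γ R (δ c)) := by
    change runit X.T (tmap g φ (δ c)) = _
    rw [tmap_congr (f := g) (f' := η + Nn) (g := φ) (g' := φ) rfl hgN (fun _ => rfl),
      tmap_add_left, map_add, runit_tmap_smulElem, hl]
    congr 1
    have h := conv_assoc hδ (μ₁ := cons X) (μ₂ := runit X.T) (μ₃ := runit X.T) (μ₄ := cons X)
      (fun x t a hx ht ha => runit_cons hx ht ha) γ g φ c
    refine .trans (congrArg (runit X.T) (tmap_congr (add_zero 0).symm (fun _ => rfl)
      (fun _ => rfl) _)) (h.symm.trans (congrArg (cons X)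
      (tmap_congr rfl (fun _ => rfl) (fun _ => rfl) _)))
  have e₃ : cons X (tmap γ L (δ c)) = cons X (tmap κ₂ g (δ c)) := by
    have h := conv_assoc hδ (μ₁ := cons X) (μ₂ := lunit X.T) (μ₃ := cons X) (μ₄ := runit X)
      (fun x a t hx ha _ => cons_lunit hx ha t) γ φ g c
    refine .trans (congrArg (cons X) (tmap_congr rfl (fun _ => rfl)
      (fun _ => rfl) _)) (h.trans (congrArg (cons X)
      (tmap_congr (zero_add p) (fun _ => rfl) (fun _ => rfl) _)))
  have hG' : ∀ c, G c = (L + -R) c := fun c => (hG c).trans (sub_eq_add_neg _ _)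
  have hκ' : ∀ c, κ c = (κ₁ + -κ₂) c := fun c => (hκ c).trans (sub_eq_add_neg _ _)
  rw [tmap_congr (f := γ) (f' := γ) (g := G) (g' := L + -R) rfl (fun _ => rfl) hG',
    tmap_congr (f := κ) (f' := κ₁ + -κ₂) (g := g) (g' := g) rfl hκ' (fun _ => rfl),
    tmap_add_right, tmap_neg_right, tmap_add_left, tmap_neg_left, map_add, map_add, map_neg,
    map_neg, e₃, hG', add_apply, neg_apply, e₁, e₂]
  abel

end GHom

/-! ### Recursive equations on conilpotent coalgebras -/

namespace CoalgData
variable {C : CoalgData 𝒜} {X P : GrMod 𝒜} {d : ℤ}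

theorem incl_barPr (h : C.counit C.aug = (1 : k)) (c : C.C) :
    GHom.kerIncl C.counit (C.barPr h c) = c - C.counit c • C.aug := (sub_eq_add_neg _ _).symm

theorem barPr_incl (h : C.counit C.aug = (1 : k)) (x : C.bar) :
    C.barPr h (GHom.kerIncl C.counit x) = x := by
  refine Subtype.ext ((C.incl_barPr h _).trans ?_)
  rw [show C.counit (GHom.kerIncl C.counit x) = 0 from x.2, zero_smul_unit, sub_zero]
  rfl

theorem barPr_aug (h : C.counit C.aug = (1 : k)) : C.barPr h C.aug = 0 := by
  refine Subtype.ext ((C.incl_barPr h _).trans ?_)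
  rw [h]
  exact (congrArg (C.aug - ·) (one_smul k _)).trans (sub_self _)

/-- The operator `E ↦ δ₂ (γ ⊗ E) Θ`. -/
noncomputable def step (Θ : GHom 0 (X.tensor P) P) (γ : GHom 0 C.C X) (E : GHom d C.C P) :
    GHom d C.C P := (GHom.conv C.comul Θ γ E).cast (by ring)

theorem step_apply (Θ : GHom 0 (X.tensor P) P) (γ : GHom 0 C.C X) (E : GHom d C.C P) (c : C.C) :
    C.step Θ γ E c = Θ (GHom.tmap γ E (C.comul c)) := rfl

section
variable (hC : C.IsCACoalg) (Θ : GHom 0 (X.tensor P) P) {γ : GHom 0 C.C X} (hγ : γ C.aug = 0)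
include hC hγ

theorem step_aug (E : GHom d C.C P) : C.step Θ γ E C.aug = 0 := by
  rw [step_apply, hC.comul_aug, GHom.tmap_zero_fst hγ, map_zero]

/-- Since γ and all the iterates vanish at w, the comultiplication may be replaced by the reduced
one at every step, and the n-th iterate on C̄ factors through C̄ → C̄^{⊗(n+1)}. -/
theorem exists_iterate_step (n : ℕ) {E : GHom d C.C P} (hE : E C.aug = 0) :
    (C.step Θ γ)^[n] E C.aug = 0 ∧ ∃ K : GHom d (C.bar.tpow (n + 1)) P, ∀ x : C.bar,
      (C.step Θ γ)^[n] E (GHom.kerIncl C.counit x) = K (C.iterComul hC.counit_aug n x) := by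
  induction n with
  | zero =>
    refine ⟨hE, (E.comp ((GHom.kerIncl C.counit).comp (GHom.runit C.bar))).cast (by ring),
      fun x => ?_⟩
    exact congrArg (fun z => E (GHom.kerIncl C.counit z)) (GHom.runit_tm_one x).symm
  | succ n ih =>
    obtain ⟨h0, K, hK⟩ := ih
    rw [Function.iterate_succ_apply']
    refine ⟨step_aug hC Θ hγ _,
      (Θ.comp (GHom.tmap (γ.comp (GHom.kerIncl C.counit)) K)).cast (by ring), fun x => ?_⟩
    change _ = Θ (GHom.tmap (γ.comp (GHom.kerIncl C.counit)) K
      (GHom.tmap (GHom.id C.bar) (C.iterComul hC.counit_aug n)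
        (GHom.tmap (C.barPr hC.counit_aug) (C.barPr hC.counit_aug)
          (C.comul (GHom.kerIncl C.counit x)))))
    rw [step_apply, GHom.tmap_tmap₀ (GHom.id C.bar) _ _ K (γ.comp (GHom.kerIncl C.counit))
      (K.comp (C.iterComul hC.counit_aug n)) rfl (fun _ => rfl) (fun _ => rfl),
      GHom.tmap_tmap₀ _ _ _ _ γ ((C.step Θ γ)^[n] E) rfl (fun c => ?_) (fun c => ?_)]
    · rw [GHom.comp_apply, incl_barPr, map_sub, map_smul, hγ, smul_zero, sub_zero]
    · rw [GHom.comp_apply, ← hK, incl_barPr, map_sub, map_smul, h0, smul_zero, sub_zero]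

theorem iterate_step_eq_zero {n : ℕ} {c : C.C}
    (hc : C.iterComul hC.counit_aug n (C.barPr hC.counit_aug c) = 0) {E : GHom d C.C P}
    (hE : E C.aug = 0) : (C.step Θ γ)^[n] E c = 0 := by
  obtain ⟨h0, K, hK⟩ := exists_iterate_step hC Θ hγ n hE
  have h := hK (C.barPr hC.counit_aug c)
  rwa [hc, map_zero, incl_barPr, map_sub, map_smul, h0, smul_zero, sub_zero] at h

/-- Uniqueness of solutions of `E = δ₂ (γ ⊗ E) Θ` on a conilpotent coalgebra. -/
theorem fix_unique {E : GHom d C.C P} (hE : ∀ c, E c = Θ (GHom.tmap γ E (C.comul c))) (c : C.C) :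
    E c = 0 := by
  have h : C.step Θ γ E = E := GHom.ext fun c => (hE c).symm
  obtain ⟨n, _, hn⟩ := hC.conilpotent (C.barPr hC.counit_aug c)
  have h0 : E C.aug = 0 := by rw [← h]; exact step_aug hC Θ hγ E
  rw [← Function.iterate_fixed h n]
  exact iterate_step_eq_zero hC Θ hγ hn h0

theorem exists_iterate_vanish (h : GHom d C.C P) (c : C.C) :
    ∃ M, ∀ m ≥ M, (C.step Θ γ)^[m] h c = 0 := by
  obtain ⟨n, _, hn⟩ := hC.conilpotent (C.barPr hC.counit_aug c)
  -- The map h need not vanish at w, but one application of the operator makes it do so; hence the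
  -- shift by one.
  refine ⟨n + 1, fun m hm => ?_⟩
  obtain ⟨l, rfl⟩ := Nat.exists_eq_add_of_le hm
  rw [add_assoc, Function.iterate_add_apply, add_comm 1 l]
  refine iterate_step_eq_zero hC Θ hγ hn ?_
  rw [Function.iterate_succ_apply']
  exact step_aug hC Θ hγ _

/-- Existence of solutions of `g = h + δ₂ (γ ⊗ g) Θ` on a conilpotent coalgebra. -/
theorem exists_fix (h : GHom d C.C P) :
    ∃ g : GHom d C.C P, ∀ c, g c = h c + Θ (GHom.tmap γ g (C.comul c)) := by
  -- The solution is the series of the iterates of h under the operator; S n is its n-th partial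
  -- sum, starting from 0.
  set S : ℕ → GHom d C.C P := fun n => (fun E => h + C.step Θ γ E)^[n] 0 with hS
  have hS1 : ∀ n c, S (n + 1) c = h c + Θ (GHom.tmap γ (S n) (C.comul c)) := fun n c => by
    rw [hS]
    dsimp only
    rw [Function.iterate_succ_apply']
    rfl
  have hdiff : ∀ n c, S (n + 1) c = S n c + (C.step Θ γ)^[n] h c := by
    intro n
    induction n with
    | zero =>
      intro c
      rw [hS1]
      change _ + Θ (GHom.tmap γ (0 : GHom d C.C P) _) = (0 : P) + h c
      rw [GHom.tmap_zero_right, map_zero, add_comm]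
    | succ n ih =>
      intro c
      have ih' : ∀ c, S (n + 1) c = (S n + (C.step Θ γ)^[n] h) c := ih
      rw [hS1, GHom.tmap_congr (f := γ) (f' := γ) rfl (fun _ => rfl) ih', GHom.tmap_add_right,
        map_add, ← add_assoc, ← hS1, Function.iterate_succ_apply', step_apply]
  have hev : ∀ c, ∃ M, ∀ m ≥ M, S m c = S M c := by
    intro c
    obtain ⟨M, hM⟩ := exists_iterate_vanish hC Θ hγ h c
    refine ⟨M, fun m hm => ?_⟩
    induction m, hm using Nat.le_induction with
    | base => rfl
    | succ m hm ih => rw [hdiff, ih, hM m hm, add_zero]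
  choose M hM using hev
  -- The stabilization index depends on c, but any later index gives the same value. Linearity
  -- follows by evaluating at a common late index.
  have hM' : ∀ c m, M c ≤ m → S (M c) c = S m c := fun c m hm => (hM c m hm).symm
  let g : GHom d C.C P :=
    { lin :=
        { toFun := fun c => S (M c) c
          map_add' := fun x y => by
            have h₁ := hM' (x + y) (M (x + y) + (M x + M y)) (by omega)
            have h₂ := hM' x (M (x + y) + (M x + M y)) (by omega)
            have h₃ := hM' y (M (x + y) + (M x + M y)) (by omega)
            rw [h₁, h₂, h₃, map_add]
          map_smul' := fun a x => by
            have h₁ := hM' (a • x) (M (a • x) + M x) (by omega)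
            have h₂ := hM' x (M (a • x) + M x) (by omega)
            rw [h₁, h₂, map_smul, RingHom.id_apply] }
      deg_mem := fun {i x} hx => (S (M x)).map_mem hx }
  have hg : ∀ c m, M c ≤ m → g c = S m c := hM'
  -- A tensor is a finite sum of pure ones, so a single index serves all its right factors.
  have ht : ∀ t : C.C.tensor C.C, ∃ M', ∀ m ≥ M', GHom.tmap γ g t = GHom.tmap γ (S m) t := by
    refine tm_induction ⟨0, fun m _ => by rw [map_zero, map_zero]⟩ (fun i j x y _ _ => ?_) ?_
    · exact ⟨M y, fun m hm => by rw [GHom.tmap_tm₀, GHom.tmap_tm₀, hg y m hm]⟩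
    · rintro x y ⟨m₁, h₁⟩ ⟨m₂, h₂⟩
      exact ⟨m₁ + m₂, fun m hm => by
        rw [map_add, map_add, h₁ m (by omega), h₂ m (by omega)]⟩
  refine ⟨g, fun c => ?_⟩
  obtain ⟨M', h'⟩ := ht (C.comul c)
  rw [h' (M c + M') (by omega), ← hS1]
  exact hg c _ (by omega)

end
end CoalgData

/-! ### Maps to the cut coalgebra -/

section
variable {C : CoalgData 𝒜} {X : GrMod 𝒜}
open GHom

/-- A map of coalgebras to `T X` satisfies a recursive equation. -/
theorem rec_of_comul {g : GHom 0 C.C X.T} {γ : GHom 0 C.C X} (hγ : ∀ c, γ c = prOne X (g c))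
    (hg : ∀ c, tmap g g (C.comul c) = cut X (g c)) (hε : ∀ c, prZero X (g c) = C.counit c)
    (c : C.C) : g c = C.counit c • oneT X + cons X (tmap γ g (C.comul c)) := by
  conv_lhs => rw [T_rec (g c), hε, ← hg, tmap_tmap₀ g g _ _ γ g (add_zero 0).symm hγ (fun _ => rfl)]

/-- A solution of the recursive equation is a map of coalgebras. -/
theorem comul_of_rec (hC : C.IsCACoalg) {g : GHom 0 C.C X.T} {γ : GHom 0 C.C X}
    (hγ : γ C.aug = 0)
    (hg : ∀ c, g c = C.counit c • oneT X + cons X (tmap γ g (C.comul c))) (c : C.C) :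
    tmap g g (C.comul c) = cut X (g c) := by
  set F₁ : GHom 0 C.C (X.T.tensor X.T) := ((cut X).comp g).cast with hF₁
  set F₂ : GHom 0 C.C (X.T.tensor X.T) := ((tmap g g).comp C.comul).cast with hF₂
  have e₁ : ∀ c, F₁ c = tm (oneT X) (g c) + consT X (tmap γ F₁ (C.comul c)) := by
    intro c
    have h1 : ∀ a : k, a • tm (oneT X) (oneT X) = tm (oneT X) (a • oneT X) := fun a =>
      ring_induction (𝒜 := 𝒜) (p := fun a => a • tm (oneT X) (oneT X) =
        tm (oneT X) (a • oneT X)) (by rw [zero_smul, zero_smul, tm_zero_right])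
        (fun i a ha => by rw [tm_smul ha (oneT_mem X), mul_zero, ksign_zero, one_smul])
        (fun a b ha hb => by rw [add_smul, add_smul, tm_add_right, ha, hb]) a
    change cut X (g c) = _
    conv_lhs => rw [hg c]
    conv_rhs => rw [hg c]
    rw [map_add, map_smul, cut_one, cut_cons, tm_add_right, ← h1, add_assoc,
      tmap_tmap₀ γ g _ _ γ F₁ (add_zero 0).symm (fun _ => rfl) (fun _ => rfl)]
  have e₂ : ∀ c, F₂ c = tm (oneT X) (g c) + consT X (tmap γ F₂ (C.comul c)) := by
    intro c
    set Nn : GHom 0 C.C X.T := (conv C.comul (cons X) γ g).cast with hN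
    have hgN : ∀ c, g c = (smulElem' C.counit (oneT_mem X) + Nn : GHom 0 C.C X.T) c := hg
    change tmap g g (C.comul c) = _
    rw [tmap_congr (f := g) (f' := (smulElem' C.counit (oneT_mem X) + Nn : GHom 0 C.C X.T))
      (g := g) (g' := g) rfl hgN (fun _ => rfl), tmap_add_left]
    congr 1
    · have : ∀ t, tmap (smulElem' C.counit (oneT_mem X) (r := 0)) g t =
          tm (oneT X) (g (lunit C.C (tmap C.counit (GHom.id C.C) t))) := fun t =>
        tm_induction (p := fun t => tmap (smulElem' C.counit (oneT_mem X) (r := 0)) g t =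
          tm (oneT X) (g (lunit C.C (tmap C.counit (GHom.id C.C) t))))
          (by simp only [map_zero, tm_zero_right])
          (fun i j x y hx hy => by
            rw [tmap_tm₀, tmap_tm₀, lunit_tm, map_smul, smulElem'_apply,
              tm_smul (C.counit.map_mem₀ hx) (oneT_mem X), smul_tm, mul_zero, ksign_zero,
              one_smul, GHom.id_apply])
          (fun x y hx hy => by
            rw [map_add, hx, hy, map_add, map_add, map_add, tm_add_right]) t
      rw [this, hC.counit_comul]
    · have h := conv_assoc hC.coassoc (μ₁ := consT X) (μ₂ := GHom.id (X.T.tensor X.T))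
        (μ₃ := GHom.id (X.T.tensor X.T)) (μ₄ := cons X)
        (fun x y z _ _ _ => consT_tm x y z) γ g g c
      refine .trans (tmap_congr (add_zero 0).symm (fun _ => rfl) (fun _ => rfl) _) (h.symm.trans
        (congrArg (consT X) (tmap_congr rfl (fun _ => rfl) (fun _ => rfl) _)))
  -- Both sides have the inhomogeneous term 1 ⊗ g, so their difference solves the homogeneous
  -- equation.
  have h := C.fix_unique hC (consT X) hγ (E := F₂ + -F₁) (fun c => by
    rw [tmap_add_right, tmap_neg_right, map_add, map_neg, GHom.add_apply, GHom.neg_apply, e₁, e₂]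
    abel) c
  rw [GHom.add_apply, GHom.neg_apply, add_neg_eq_zero] at h
  exact h

theorem prZero_of_rec {g : GHom 0 C.C X.T} {γ : GHom 0 C.C X}
    (hg : ∀ c, g c = C.counit c • oneT X + cons X (tmap γ g (C.comul c))) (c : C.C) :
    prZero X (g c) = C.counit c := by
  rw [hg, map_add, prZero_cons, map_smul, prZero_one, add_zero]
  exact mul_one (C.counit c : k)

theorem prOne_of_rec (hr : ∀ x, runit C.C (tmap (GHom.id C.C) C.counit (C.comul x)) = x)
    {g : GHom 0 C.C X.T} {γ : GHom 0 C.C X}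
    (hg : ∀ c, g c = C.counit c • oneT X + cons X (tmap γ g (C.comul c))) (c : C.C) :
    prOne X (g c) = γ c := by
  rw [hg, map_add, map_smul, prOne_one, smul_zero, zero_add, prOne_cons,
    tmap_tmap₀ γ g _ _ γ C.counit (add_zero 0).symm (fun _ => rfl)
      (fun c => (prZero_of_rec hg c).symm)]
  have h := map_runit_tmap_sign γ (GHom.id C.C) C.counit γ (fun _ => rfl) (C.comul c)
  rw [hr, zero_mul, ksign_zero, one_smul] at h
  exact h.symm

end
end recursion

section bar
variable {k : Type u} [Ring k] {𝒜 : ℤ → AddSubgroup k} [GradedRing 𝒜] [StronglyCommutative 𝒜]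

/-! ### The bar construction -/

namespace GHom
variable {X Y : GrMod 𝒜}

theorem prZero_inj_succ (n : ℕ) (s : X.tpow (n + 1)) : prZero X (inj X.tpow (n + 1) s) = 0 :=
  pr_inj_ne X.tpow (Nat.succ_ne_zero n).symm s

theorem prOne_inj_zero (a : X.tpow 0) : prOne X (inj X.tpow 0 a) = 0 :=
  (congrArg (runit X) (pr_inj_ne X.tpow one_ne_zero a)).trans (map_zero _)

theorem prOne_inj_one (s : X.tensor (GrMod.unit 𝒜)) :
    prOne X (inj X.tpow 1 s) = runit X s :=
  congrArg (runit X) (pr_inj_same X.tpow 1 s)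

theorem prOne_inj_add_two (n : ℕ) (s : X.tpow (n + 2)) :
    prOne X (inj X.tpow (n + 2) s) = 0 :=
  (congrArg (runit X) (pr_inj_ne X.tpow (show 1 ≠ n + 2 by omega) s)).trans (map_zero _)

theorem tmap_prOne_cut_smul_one {N : GrMod 𝒜} {q : ℤ} (F : GHom q X.T N) (a : k) :
    tmap (prOne X) F (cut X (a • oneT X)) = 0 := by
  rw [map_smul, map_smul, tmap_prOne_cut_one, smul_zero]

theorem tmap_prOne_prOne_cut_inj (n : ℕ) (s : X.tensor (X.tpow n)) {f : GHom 0 (X.tpow n) X}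
    (hf : ∀ t, f t = prOne X (inj X.tpow n t)) :
    tmap (prOne X) (prOne X) (cut X (inj X.tpow (n + 1) s)) = tmap (GHom.id X) f s := by
  rw [inj_succ, tmap_prOne_cut_cons,
    tmap_tmap₀ (GHom.id X) (inj X.tpow n) (GHom.id X) (prOne X) (GHom.id X) f (add_zero 0).symm
      (fun _ => rfl) hf]

theorem prZero_Tmap (f : GHom 0 X Y) (u : X.T) : prZero Y (Tmap f u) = prZero X u := by
  refine T_ext (f := (prZero Y).comp (Tmap f)) (g := prZero X) ?_ (fun i j x t _ _ _ => ?_) u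
  · rw [comp_apply, Tmap_one, prZero_one, prZero_one]
  · rw [comp_apply, Tmap_cons, prZero_cons, prZero_cons]

theorem cut_Tmap (f : GHom 0 X Y) (u : X.T) :
    cut Y (Tmap f u) = tmap (Tmap f) (Tmap f) (cut X u) := by
  have h : ∀ s, tmap (Tmap f) (Tmap f) (consT X s) =
      consT Y (tmap f (tmap (Tmap f) (Tmap f)) s) :=
    tensor_ext₃ (f := (tmap (Tmap f) (Tmap f)).comp (consT X))
      (g := (consT Y).comp (tmap f (tmap (Tmap f) (Tmap f)))) (fun i j l x y z hx hy hz => by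
        rw [comp_apply, comp_apply, consT_tm, tmap_tm₀, tmap_tm₀, tmap_tm₀, consT_tm, Tmap_cons,
          tmap_tm₀])
  refine T_ext (f := (cut Y).comp (Tmap f)) (g := (tmap (Tmap f) (Tmap f)).comp (cut X)) ?_
    (fun i j x t _ _ ih => ?_) u
  · rw [comp_apply, comp_apply, Tmap_one, cut_one, cut_one, tmap_tm₀, Tmap_one]
  · rw [comp_apply, comp_apply] at ih ⊢
    rw [Tmap_cons, cut_cons, cut_cons, map_add, h, tmap_tm₀ f (Tmap f),
      tmap_tm₀ (Tmap f) (Tmap f), tmap_tm₀ (GHom.id X) (cut X), tmap_tm₀ (GHom.id Y) (cut Y),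
      tmap_tm₀ f (tmap (Tmap f) (Tmap f)), Tmap_one, Tmap_cons, tmap_tm₀ f (Tmap f), ih]
    rfl

theorem prOne_Tmap (f : GHom 0 X Y) (u : X.T) : prOne Y (Tmap f u) = f (prOne X u) := by
  refine T_ext (f := (prOne Y).comp (Tmap f)) (g := f.comp (prOne X)) ?_
    (fun i j x t _ _ _ => ?_) u
  · rw [comp_apply, comp_apply, Tmap_one, prOne_one, prOne_one, map_zero]
  · rw [comp_apply, comp_apply, Tmap_cons, prOne_cons, prOne_cons, tmap_tm₀, tmap_tm₀, tmap_tm₀,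
      prZero_Tmap]
    refine (GrMod.unit 𝒜).hom_induction (p := fun a => runit Y (tm (f x) a) =
      f (runit X (tm x a))) ?_ (fun l a ha => ?_) (fun a b ha hb => ?_) (prZero X t)
    · rw [tm_zero_right, tm_zero_right, map_zero, map_zero, map_zero]
    · rw [runit_tm (f.map_mem₀ ‹_›) ha, runit_tm ‹_› ha, map_zsmul, map_smul]
    · rw [tm_add_right, tm_add_right, map_add, map_add, map_add, ha, hb]

end GHom

/-- The components of length 0, 1 and 2 are read off by the projections and by both halves of the
cut. This presents the quadratic part as a convolution. -/
theorem AlgData.bCheck_apply (A : AlgData 𝒜) (v : (A.A.shift 1).T) :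
    A.bCheck v = A.b₀ (GHom.prZero _ v) + A.b₁ (GHom.prOne _ v) +
      A.b₂ (GHom.tmap (GHom.prOne _) (GHom.prOne _) (GHom.cut _ v)) := by
  refine GHom.T_induction (p := fun v => A.bCheck v = A.b₀ (GHom.prZero _ v) +
    A.b₁ (GHom.prOne _ v) + A.b₂ (GHom.tmap (GHom.prOne _) (GHom.prOne _) (GHom.cut _ v)))
    ?_ (fun n t => ?_) (fun x y hx hy => ?_) v
  · simp only [map_zero, add_zero]
  · refine (GHom.desc_inj _ n t).trans ?_
    have key : ∀ {v : (A.A.shift 1).T} {a x w}, GHom.prZero _ v = a → GHom.prOne _ v = x →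
        GHom.tmap (GHom.prOne _) (GHom.prOne _) (GHom.cut _ v) = w →
        A.b₀ a + A.b₁ x + A.b₂ w = A.b₀ (GHom.prZero _ v) + A.b₁ (GHom.prOne _ v) +
          A.b₂ (GHom.tmap (GHom.prOne _) (GHom.prOne _) (GHom.cut _ v)) := by
      rintro v a x w rfl rfl rfl; rfl
    match n with
    | 0 =>
      refine .trans ?_ (key (GHom.pr_inj_same _ 0 t) (GHom.prOne_inj_zero t)
        ((congrArg (fun v => GHom.tmap (GHom.prOne _) (GHom.prOne _) (GHom.cut _ v))
          (GHom.injZero_eq (show k from t))).trans (c := 0) ?_))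
      · change A.b₀ t = A.b₀ t + A.b₁ 0 + A.b₂ 0
        rw [map_zero A.b₁, map_zero A.b₂, add_zero, add_zero]
      · exact GHom.tmap_prOne_cut_smul_one _ _
    | 1 =>
      refine .trans ?_ (key (GHom.prZero_inj_succ 0 t) (GHom.prOne_inj_one t)
        ((GHom.tmap_prOne_prOne_cut_inj 0 t (f := 0)
          fun t => (GHom.prOne_inj_zero t).symm).trans (GHom.tmap_zero_right _ _)))
      change A.b₁ (GHom.runit _ t) = A.b₀ 0 + A.b₁ (GHom.runit _ t) + A.b₂ 0
      rw [map_zero A.b₀, map_zero A.b₂, add_zero, zero_add]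
    | 2 =>
      refine .trans ?_ (key (GHom.prZero_inj_succ 1 t) (GHom.prOne_inj_add_two 0 t)
        (GHom.tmap_prOne_prOne_cut_inj 1 t (f := GHom.runit _)
          fun t => (GHom.prOne_inj_one t).symm))
      refine .trans ?_ (congrArg (· + _) ((congrArg₂ (· + ·) (map_zero A.b₀)
        (map_zero A.b₁)).trans (add_zero 0)).symm)
      exact (zero_add _).symm
    | n + 3 =>
      refine .trans ?_ (key (GHom.prZero_inj_succ (n + 2) t) (GHom.prOne_inj_add_two (n + 1) t)
        ((GHom.tmap_prOne_prOne_cut_inj (n + 2) t (f := 0)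
          fun t => (GHom.prOne_inj_add_two n t).symm).trans (GHom.tmap_zero_right _ _)))
      change 0 = A.b₀ 0 + A.b₁ 0 + A.b₂ 0
      rw [map_zero A.b₀, map_zero A.b₁, map_zero A.b₂, add_zero, add_zero]
  · rw [map_add, hx, hy, map_add, map_add, map_add, map_add, map_add, map_add, map_add]
    abel

namespace GHom
variable {X P Q : GrMod 𝒜}

/-- D² and the commutator with φ satisfy the same recursion, with inhomogeneous terms given by their
components in X. These cancel by hypothesis, so the sum vanishes by `T_fix_unique`. -/
theorem coderiv_coderiv (b : GHom 1 X.T X) (φ : GHom 2 X.T (GrMod.unit 𝒜))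
    (h : ∀ u, b (coderiv b u) + (lunit X (tmap φ (prOne X) (cut X u)) -
      runit X (tmap (prOne X) φ (cut X u))) = 0) (u : X.T) :
    coderiv b (coderiv b u) = runit X.T (tmap (GHom.id X.T) φ (cut X u)) -
      lunit X.T (tmap φ (GHom.id X.T) (cut X u)) := by
  set D := coderiv b with hD
  set DD : GHom 2 X.T X.T := (D.comp D).cast with hDD
  set bD : GHom 2 X.T X := (b.comp D).cast with hbD
  set G : GHom 2 X.T X.T := (conv (cut X) (lunit X.T) φ (GHom.id X.T)).cast +
    -(conv (cut X) (runit X.T) (GHom.id X.T) φ).cast with hG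
  set κ : GHom 2 X.T X := (conv (cut X) (lunit X) φ (prOne X)).cast +
    -(conv (cut X) (runit X) (prOne X) φ).cast with hκ
  have hG' : ∀ u, G u = cons X (tmap (prOne X) G (cut X u)) +
      cons X (tmap κ (GHom.id X.T) (cut X u)) :=
    commutator_rec cut_coassoc cut_counit counit_cut (g := GHom.id X.T) T_rec φ
      (fun u => (sub_eq_add_neg _ _).symm) (fun u => (sub_eq_add_neg _ _).symm)
  -- The two terms in which b acts in front and D acts behind it cancel, as b and D are odd. This is
  -- why D² behaves like a coderivation.
  have hDD' : ∀ u, DD u = cons X (tmap (prOne X) DD (cut X u)) +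
      cons X (tmap bD (GHom.id X.T) (cut X u)) := by
    intro u
    change D (D u) = _
    rw [hD, coderiv_rec b (coderiv b u), ← hD, cut_coderiv, ← hD, map_add, map_add, map_add,
      map_add, tmap_tmap (GHom.id X.T) D b (GHom.id X.T) b D (by norm_num) (fun _ => rfl)
        (fun _ => rfl),
      tmap_tmap₀ D (GHom.id X.T) b (GHom.id X.T) bD (GHom.id X.T) (by norm_num) (fun _ => rfl)
        (fun _ => rfl),
      tmap_tmap (GHom.id X.T) D (prOne X) D (prOne X) DD (by norm_num) (fun _ => rfl)
        (fun _ => rfl),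
      tmap_tmap₀ D (GHom.id X.T) (prOne X) D b D (by norm_num) (fun u => (prOne_coderiv b u).symm)
        (fun _ => rfl), mul_one, ksign_one, mul_zero, ksign_zero, one_smul, neg_one_smul, map_neg]
    abel
  have hZ : ∀ u, (bD + κ) u = (0 : GHom 2 X.T X) u := fun u =>
    (congrArg (b (D u) + ·) (sub_eq_add_neg _ _).symm).trans (h u)
  have hE := T_fix_unique (cons X) (DD + G) (fun u => by
    have h₁ : cons X (tmap (bD + κ) (GHom.id X.T) (cut X u)) = 0 := by
      rw [tmap_congr (f := bD + κ) (f' := 0) (g := GHom.id X.T) (g' := GHom.id X.T) rfl hZ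
        (fun _ => rfl), tmap_zero_left, map_zero]
    rw [tmap_add_left, map_add] at h₁
    rw [tmap_add_right, map_add, add_apply, hG', hDD',
      ← add_zero (_ + cons X (tmap (prOne X) G (cut X u))), ← h₁]
    abel) u
  have hE' : D (D u) + (lunit X.T (tmap φ (GHom.id X.T) (cut X u)) +
    -runit X.T (tmap (GHom.id X.T) φ (cut X u))) = 0 := hE
  rw [eq_neg_of_add_eq_zero_left hE']
  abel

theorem tmap_consT (B : GHom 0 X.T Q) (F : GHom 0 X.T P) (x : X) (w : X.T.tensor X.T) :
    tmap B F (consT X (tm x w)) = tmap ((B.comp (cons X)).cast (r := 0)) (GHom.id P)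
      (assocInv X X.T P (tm x (tmap (GHom.id X.T) F w))) :=
  tm_induction (p := fun w => tmap B F (consT X (tm x w)) = tmap ((B.comp (cons X)).cast (r := 0)) (GHom.id P)
      (assocInv X X.T P (tm x (tmap (GHom.id X.T) F w))))
    (by simp only [map_zero, tm_zero_right])
    (fun i j y z _ _ => by
      rw [consT_tm, tmap_tm₀, tmap_tm₀, assocInv_tm, tmap_tm₀]
      rfl)
    (fun y z hy hz => by
      rw [tm_add_right, map_add, map_add, hy, hz, map_add, tm_add_right, map_add, map_add]) w

/-- The hypothesis says that F kills the right part of every cut of a word of length m, so for one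
letter more only the cut with empty left part survives. -/
theorem tmap_cut_inj_succ {m : ℕ} {F : GHom 0 X.T P}
    (hF : ∀ t, tmap (GHom.id X.T) F (cut X (inj X.tpow m t)) = 0) (B : GHom 0 X.T Q)
    (t : X.tensor (X.tpow m)) : tmap B F (cut X (inj X.tpow (m + 1) t)) =
      tm (B (oneT X)) (F (inj X.tpow (m + 1) t)) := by
  rw [inj_succ, cut_cons, map_add, tmap_tm₀]
  refine add_eq_left.2 ?_
  refine tensor_ext (f := (tmap B F).comp ((consT X).comp ((tmap (GHom.id X) (cut X)).comp
    (tmap (GHom.id X) (inj X.tpow m))))) (g := (0 : GHom 0 _ _)) (fun i j x s _ _ => ?_) t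
  rw [comp_apply, comp_apply, comp_apply, tmap_tm₀, tmap_tm₀, tmap_consT, hF, tm_zero_right,
    map_zero, map_zero]
  rfl

theorem tmap_cut_smul_one (B : GHom 0 X.T Q) (F : GHom 0 X.T P) (a : k) :
    tmap B F (cut X (a • oneT X)) = a • tm (B (oneT X)) (F (oneT X)) := by
  rw [map_smul, map_smul, cut_one, tmap_tm₀]

theorem tmap_id_cut_inj_eq_zero {n : ℕ} {F : GHom 0 X.T P}
    (hF : ∀ m ≤ n, ∀ t, F (inj X.tpow m t) = 0) (m : ℕ) (hm : m ≤ n) (t : X.tpow m) :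
    tmap (GHom.id X.T) F (cut X (inj X.tpow m t)) = 0 := by
  induction m with
  | zero =>
    refine (congrArg (fun u => tmap (GHom.id X.T) F (cut X u)) (injZero_eq (show k from t))).trans
      ((tmap_cut_smul_one _ F _).trans ?_)
    rw [show F (oneT X) = 0 from hF 0 hm (1 : k), tm_zero_right, smul_zero]
  | succ m ih =>
    refine (tmap_cut_inj_succ (ih (by omega)) _ t).trans ?_
    rw [hF (m + 1) hm, tm_zero_right]

/-- The condition on B discards the cut with empty left part. Every other cut leaves a right part
shorter than the word, which gains one in length; this drives the proof of conilpotency. -/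
theorem tmap_cut_inj_eq_zero {n : ℕ} {F : GHom 0 X.T P}
    (hF : ∀ m ≤ n, ∀ t, F (inj X.tpow m t) = 0) {B : GHom 0 X.T Q} (hB : B (oneT X) = 0)
    (m : ℕ) (hm : m ≤ n + 1) (t : X.tpow m) : tmap B F (cut X (inj X.tpow m t)) = 0 := by
  cases m with
  | zero =>
    refine (congrArg (fun u => tmap B F (cut X u)) (injZero_eq (show k from t))).trans
      ((tmap_cut_smul_one _ F _).trans ?_)
    rw [hB, tm_zero_left, smul_zero]
  | succ m =>
    refine (tmap_cut_inj_succ (tmap_id_cut_inj_eq_zero hF m (by omega)) _ t).trans ?_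
    rw [hB, tm_zero_left]

end GHom

/-- In terms of the universal cochain τ the structure maps add up to εm₀ − m₁τ − τ∗τ, the part of
the Maurer–Cartan equation that involves only the operations of A. -/
theorem AlgData.bCheck_Tmap_shiftIncl (A : AlgData 𝒜) (τ : GHom 1 (A.bar.shift 1).T A.A)
    (hτ : ∀ u, τ u = GHom.kerIncl A.split (GHom.sigmaInv 1 A.bar (GHom.prOne _ u)))
    (u : (A.bar.shift 1).T) : GHom.sigmaInv 1 A.A (A.bCheck (GHom.Tmap A.shiftIncl u)) =
      GHom.prZero _ u • A.curv - A.diff (τ u) - A.mul (GHom.tmap τ τ (GHom.cut _ u)) := by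
  set F : GHom 0 (A.bar.shift 1).T (A.A.shift 1) := (A.shiftIncl.comp (GHom.prOne _)).cast
  rw [A.bCheck_apply, GHom.prZero_Tmap, GHom.prOne_Tmap, GHom.cut_Tmap,
    GHom.tmap_tmap₀ (GHom.Tmap A.shiftIncl) (GHom.Tmap A.shiftIncl) (GHom.prOne _)
      (GHom.prOne _) F F (add_zero 0).symm
      (fun u => (GHom.prOne_Tmap A.shiftIncl u).symm)
      (fun u => (GHom.prOne_Tmap A.shiftIncl u).symm), sub_eq_add_neg, sub_eq_add_neg, hτ]
  refine congrArg (fun z => GHom.prZero _ u • A.curv + -A.diff (GHom.kerIncl A.split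
    (GHom.sigmaInv 1 A.bar (GHom.prOne _ u))) + -A.mul z) ?_
  exact GHom.tmap_tmap₀ F F (GHom.sigmaInv 1 A.A) (GHom.sigmaInv 1 A.A) τ τ (zero_add 1).symm
    hτ hτ _

/-- The sum A = Ā ⊕ kη is direct. One equation in A whose two sides lie in different summands thus
gives two vanishing statements. -/
theorem eq_zero_of_eq_smul_one {A : AlgData 𝒜} (h : A.split A.one = (1 : k)) {a : GrMod.unit 𝒜}
    {x : A.A} (hx : A.split x = 0) (hxa : x = a • A.one) : a = 0 := by
  have := congrArg A.split hxa
  rw [hx, map_smul, h] at this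
  exact (mul_one (a : k)).symm.trans this.symm

namespace UCCAlg
variable (A : UCCAlg 𝒜)

/-- The inclusion `Ā[1] → A`. -/
def ofBarShift : GHom 1 (A.data.bar.shift 1) A.data.A :=
  ((GHom.kerIncl A.data.split).comp (GHom.sigmaInv 1 A.data.bar)).cast

theorem ofBarShift_injective {x y : A.data.bar.shift 1} (h : A.ofBarShift x = A.ofBarShift y) :
    x = y := Subtype.ext (p := (· ∈ LinearMap.ker A.data.split.lin)) h

theorem split_ofBarShift (x : A.data.bar.shift 1) : A.data.split (A.ofBarShift x) = 0 := x.2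

/-- The universal twisting cochain `Bar A → A`. -/
noncomputable def univTw : GHom 1 (barData A).C A.data.A :=
  (A.ofBarShift.comp (GHom.prOne (A.data.bar.shift 1))).cast

theorem univTw_apply (u : (barData A).C) : A.univTw u = A.ofBarShift (GHom.prOne _ u) := rfl

/-- The composite `T(Ā[1]) → T(A[1]) → A[1] → A`. -/
noncomputable def bCheckIncl : GHom 2 (barData A).C A.data.A :=
  ((GHom.sigmaInv 1 A.data.A).comp (A.data.bCheck.comp (GHom.Tmap A.data.shiftIncl))).cast

theorem bCheckIncl_apply (u : (barData A).C) :
    A.bCheckIncl u =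
    (barData A).counit u • A.data.curv - A.data.diff (A.univTw u) -
      A.data.mul (GHom.tmap A.univTw A.univTw ((barData A).comul u)) := by
  exact A.data.bCheck_Tmap_shiftIncl A.univTw (fun _ => rfl) u

theorem cocurv_barData (u : (barData A).C) :
    (barData A).cocurv u = -A.data.split (A.bCheckIncl u) := rfl

theorem univTw_codiff (u : (barData A).C) : A.univTw ((barData A).codiff u) =
    A.bCheckIncl u - A.data.split (A.bCheckIncl u) • A.data.one := by
  refine (congrArg A.ofBarShift (GHom.prOne_coderiv _ u)).trans ?_
  exact (sub_eq_add_neg _ _).symm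

/-- The codifferential and the curvature of Bar A are the components of the same map `bCheckIncl`
along Ā and, up to sign, along kη; put together they give the equation. -/
theorem isTwisting_univTw : IsTwisting (barData A) A.data A.univTw := by
  intro u
  have h := A.bCheckIncl_apply u
  have hn : (-A.data.split (A.bCheckIncl u) : GrMod.unit 𝒜) • A.data.one =
    -(A.data.split (A.bCheckIncl u) • A.data.one) := neg_smul (R := k) _ _
  rw [univTw_codiff, cocurv_barData, hn]
  rw [← sub_eq_zero] at h ⊢
  rw [← h]
  abel

theorem barData_isPrecurved : (barData A).IsPrecurved where
  coassoc := GHom.cut_coassoc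
  coleibniz := GHom.cut_coderiv _
  comul_counit := GHom.cut_counit
  counit_comul := GHom.counit_cut
  counit_codiff := GHom.prZero_coderiv _


theorem comm_ofBarShift (φ : GHom 2 (barData A).C (GrMod.unit 𝒜))
    (t : (barData A).C.tensor (barData A).C) :
    GHom.lunit A.data.A (GHom.tmap φ A.univTw t) - GHom.runit A.data.A (GHom.tmap A.univTw φ t) =
    A.ofBarShift (GHom.lunit _ (GHom.tmap φ (GHom.prOne (A.data.bar.shift 1)) t) -
      GHom.runit _ (GHom.tmap (GHom.prOne (A.data.bar.shift 1)) φ t)) := by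
  rw [map_sub]
  refine congrArg₂ (· - ·) ?_ ?_
  · exact (GHom.map_lunit_tmap _ _ _ _).symm
  · refine Eq.symm ((GHom.map_runit_tmap_sign A.ofBarShift _ φ A.univTw (fun _ => rfl) t).trans ?_)
    rw [show ksign (1 * 2) = 1 from ksign_of_even ⟨1, rfl⟩, one_smul]

/-- The Bianchi identity for the universal cochain; its left side vanishes by the axioms of A. What
is left equates an element of Ā with a multiple of η, so both are zero. -/
theorem curvature_bar (u : (barData A).C) :
    A.ofBarShift (GHom.prOne _ ((barData A).codiff ((barData A).codiff u)) +
      (GHom.lunit _ (GHom.tmap (barData A).cocurv (GHom.prOne (A.data.bar.shift 1))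
        ((barData A).comul u)) -
      GHom.runit _ (GHom.tmap (GHom.prOne (A.data.bar.shift 1)) (barData A).cocurv
        ((barData A).comul u)))) = (barData A).cocurv ((barData A).codiff u) • A.data.one := by
  have h := A.isTwisting_univTw.curvature A.barData_isPrecurved A.isUCCAlg.isPrecurved u
  rw [A.isUCCAlg.diff_diff, A.isUCCAlg.diff_curv, smul_zero] at h
  rw [map_add, ← comm_ofBarShift, ← univTw_apply, ← sub_eq_zero, ← add_sub_assoc]
  refine h.symm.trans ?_
  abel

theorem cocurv_codiff_barData (u : (barData A).C) :
    (barData A).cocurv ((barData A).codiff u) = 0 :=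
  eq_zero_of_eq_smul_one A.isUCCAlg.split_one (A.split_ofBarShift _) (A.curvature_bar u)

theorem codiff_codiff_barData (u : (barData A).C) :
    (barData A).codiff ((barData A).codiff u) =
    GHom.runit _ (GHom.tmap (GHom.id (barData A).C) (barData A).cocurv ((barData A).comul u)) -
    GHom.lunit _ (GHom.tmap (barData A).cocurv (GHom.id (barData A).C) ((barData A).comul u)) := by
  refine GHom.coderiv_coderiv _ (barData A).cocurv (fun u => A.ofBarShift_injective ?_) u
  have h := A.curvature_bar u
  rw [A.cocurv_codiff_barData (show (barData A).C from u), zero_smul_unit] at h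
  refine .trans ?_ (h.trans (map_zero _).symm)
  exact congrArg (fun z => A.ofBarShift (z + _)) (GHom.prOne_coderiv _ _).symm

theorem isCoaugmented_barData : (barData A).IsCoaugmented where
  coassoc := GHom.cut_coassoc
  coleibniz := GHom.cut_coderiv _
  codiff_codiff := A.codiff_codiff_barData
  cocurv_codiff := A.cocurv_codiff_barData
  comul_counit := GHom.cut_counit
  counit_comul := GHom.counit_cut
  counit_codiff := GHom.prZero_coderiv _
  counit_aug := GHom.prZero_one
  comul_aug := GHom.cut_one

/-- A word with at most n letters cannot be cut into n + 1 nonempty pieces. -/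
theorem iterComul_barData (n : ℕ) : ∀ m ≤ n, ∀ t,
    (barData A).iterComul A.isCoaugmented_barData.counit_aug n
      ((barData A).barPr A.isCoaugmented_barData.counit_aug
        (GHom.inj (A.data.bar.shift 1).tpow m t)) = 0 := by
  set h := A.isCoaugmented_barData.counit_aug
  induction n with
  | zero =>
    intro m hm t
    obtain rfl := Nat.le_zero.1 hm
    refine (congrArg (fun u => (barData A).iterComul h 0 ((barData A).barPr h u))
      (GHom.injZero_eq (show k from t))).trans ?_
    refine (congrArg ((barData A).iterComul h 0) ((map_smul ((barData A).barPr h) (show k from t)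
      (barData A).aug).trans ?_)).trans (map_zero _)
    exact (congrArg ((show k from t) • ·) (CoalgData.barPr_aug h)).trans (smul_zero _)
  | succ n ih =>
    intro m hm t
    set c : (barData A).C := GHom.inj (A.data.bar.shift 1).tpow m t
    set F : GHom 0 (barData A).C _ := (((barData A).iterComul h n).comp ((barData A).barPr h)).cast
    change GHom.tmap (GHom.id (barData A).bar) ((barData A).iterComul h n)
      (GHom.tmap ((barData A).barPr h) ((barData A).barPr h)
        ((barData A).comul (GHom.kerIncl (barData A).counit ((barData A).barPr h c)))) = 0
    rw [CoalgData.incl_barPr, map_sub, map_smul, A.isCoaugmented_barData.comul_aug, map_sub,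
      map_smul, GHom.tmap_zero_fst (CoalgData.barPr_aug h), smul_zero, sub_zero,
      GHom.tmap_tmap₀ _ _ _ _ ((barData A).barPr h) F (add_zero 0).symm (fun _ => rfl)
      (fun _ => rfl)]
    exact GHom.tmap_cut_inj_eq_zero (F := F) ih (CoalgData.barPr_aug h) m hm t

theorem isCACoalg_barData : (barData A).IsCACoalg where
  toIsCoaugmented := A.isCoaugmented_barData
  conilpotent x := by
    set h := A.isCoaugmented_barData.counit_aug
    have key : ∀ c : (A.data.bar.shift 1).T, ∃ N, ∀ n ≥ N,
        (barData A).iterComul h n ((barData A).barPr h c) = 0 := fun c =>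
      GHom.T_induction (p := fun c => ∃ N, ∀ n ≥ N,
        (barData A).iterComul h n ((barData A).barPr h c) = 0)
        ⟨0, fun n _ => (congrArg _ (map_zero ((barData A).barPr h))).trans (map_zero _)⟩
        (fun m t => ⟨m, fun n hn => A.iterComul_barData n m hn t⟩)
        (fun x y => by
          rintro ⟨N, hN⟩ ⟨N', hN'⟩
          refine ⟨N + N', fun n hn => ?_⟩
          refine (congrArg _ (map_add ((barData A).barPr h) x y)).trans ((map_add _ _ _).trans ?_)
          exact (congrArg₂ (· + ·) (hN n (by omega)) (hN' n (by omega))).trans (add_zero _)) c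
    -- The index is raised by one because conilpotency demands n ≥ 1, while N may be 0.
    obtain ⟨N, hN⟩ := key (GHom.kerIncl (barData A).counit x)
    refine ⟨N + 1, by omega, ?_⟩
    rw [← hN (N + 1) (by omega), CoalgData.barPr_incl]

end UCCAlg

end bar

section barFunctor
variable {k : Type u} [Ring k] {𝒜 : ℤ → AddSubgroup k} [GradedRing 𝒜] [StronglyCommutative 𝒜]

/-! ### Morphisms to the bar construction -/

section
variable {C : CoalgData 𝒜} {X : GrMod 𝒜}
open GHom

/-- Compatibility with the codifferentials need only be checked after projection to X. The three
maps involved satisfy recursions with the same γ and g, so the defect solves the homogeneous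
equation. -/
theorem codiff_of_prOne (hC : C.IsCACoalg) {g : GHom 0 C.C X.T} {γ : GHom 0 C.C X}
    (hγ : ∀ c, γ c = prOne X (g c)) (hγw : γ C.aug = 0)
    (hg : ∀ c, tmap g g (C.comul c) = cut X (g c)) (hε : ∀ c, prZero X (g c) = C.counit c)
    (b : GHom 1 X.T X) (φ : GHom 1 C.C (GrMod.unit 𝒜))
    (h : ∀ c, γ (C.codiff c) + (lunit X (tmap φ γ (C.comul c)) -
      runit X (tmap γ φ (C.comul c))) = b (g c)) (c : C.C) :
    g (C.codiff c) + (lunit X.T (tmap φ g (C.comul c)) - runit X.T (tmap g φ (C.comul c))) =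
      coderiv b (g c) := by
  set D := coderiv b with hD
  have hrec := rec_of_comul hγ hg hε
  set gδ : GHom 1 C.C X.T := (g.comp C.codiff).cast with hgδ
  set γδ : GHom 1 C.C X := (γ.comp C.codiff).cast with hγδ
  set Dg : GHom 1 C.C X.T := (D.comp g).cast with hDg
  set bg : GHom 1 C.C X := (b.comp g).cast with hbg
  set G : GHom 1 C.C X.T := (conv C.comul (lunit X.T) φ g).cast +
    -(conv C.comul (runit X.T) g φ).cast with hG
  set κ : GHom 1 C.C X := (conv C.comul (lunit X) φ γ).cast +
    -(conv C.comul (runit X) γ φ).cast with hκ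
  have hG' : ∀ c, G c = cons X (tmap γ G (C.comul c)) + cons X (tmap κ g (C.comul c)) :=
    commutator_rec hC.coassoc hC.comul_counit hC.counit_comul hrec φ
      (fun u => (sub_eq_add_neg _ _).symm) (fun u => (sub_eq_add_neg _ _).symm)
  have hgδ' : ∀ c, gδ c = cons X (tmap γ gδ (C.comul c)) + cons X (tmap γδ g (C.comul c)) := by
    intro c
    change g (C.codiff c) = _
    rw [hrec, hC.counit_codiff, zero_smul_unit, zero_add, hC.coleibniz, map_add, map_add,
      tmap_tmap (GHom.id C.C) C.codiff γ g γ gδ (by norm_num) (fun _ => rfl) (fun _ => rfl),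
      tmap_tmap₀ C.codiff (GHom.id C.C) γ g γδ g (by norm_num) (fun _ => rfl) (fun _ => rfl),
      mul_zero, ksign_zero, one_smul]
  have hDg' : ∀ c, Dg c = cons X (tmap γ Dg (C.comul c)) + cons X (tmap bg g (C.comul c)) := by
    intro c
    change D (g c) = _
    rw [hD, coderiv_rec b (g c), ← hD, ← hg,
      tmap_tmap₀ g g b (GHom.id X.T) bg g (by norm_num) (fun _ => rfl) (fun _ => rfl),
      tmap_tmap₀ g g (prOne X) D γ Dg (by norm_num) hγ (fun _ => rfl), add_comm]
  have hZ : ∀ c, (γδ + κ + -bg) c = (0 : GHom 1 C.C X) c := fun c => by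
    rw [GHom.add_apply, GHom.neg_apply, GHom.zero_apply, add_neg_eq_zero]
    exact (congrArg (γ (C.codiff c) + ·) (sub_eq_add_neg _ _).symm).trans (h c)
  have hE := C.fix_unique hC (cons X) hγw (E := gδ + G + -Dg) (fun c => by
    have h₁ : cons X (tmap (γδ + κ + -bg) g (C.comul c)) = 0 := by
      rw [tmap_congr (f := γδ + κ + -bg) (f' := 0) (g := g) (g' := g) rfl hZ
        (fun _ => rfl), tmap_zero_left, map_zero]
    rw [tmap_add_left, tmap_add_left, tmap_neg_left, map_add, map_add, map_neg] at h₁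
    rw [tmap_add_right, tmap_add_right, tmap_neg_right, map_add, map_add, map_neg,
      GHom.add_apply, GHom.add_apply, GHom.neg_apply, hG', hgδ', hDg',
      ← add_zero (_ + -cons X (tmap γ Dg (C.comul c))), ← h₁]
    abel) c
  rw [GHom.add_apply, GHom.neg_apply, add_neg_eq_zero] at hE
  exact (congrArg (g (C.codiff c) + ·) (sub_eq_add_neg _ _)).trans hE

/-- Coalgebra maps to `T X` with the same component in `X` are equal. -/
theorem T_coalgHom_ext (hC : C.IsCACoalg) {g g' : GHom 0 C.C X.T}
    (hg : ∀ c, tmap g g (C.comul c) = cut X (g c)) (hε : ∀ c, prZero X (g c) = C.counit c)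
    (hg' : ∀ c, tmap g' g' (C.comul c) = cut X (g' c)) (hε' : ∀ c, prZero X (g' c) = C.counit c)
    (hw : g C.aug = oneT X) (h : ∀ c, prOne X (g c) = prOne X (g' c)) : g = g' := by
  set γ : GHom 0 C.C X := ((prOne X).comp g).cast with hγ
  have e := rec_of_comul (γ := γ) (fun _ => rfl) hg hε
  have e' := rec_of_comul (γ := γ) h hg' hε'
  have hγw : γ C.aug = 0 := (congrArg (prOne X) hw).trans prOne_one
  refine GHom.ext fun c => ?_
  have hE := C.fix_unique hC (cons X) hγw (E := g + -g') (fun c => by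
    rw [tmap_add_right, tmap_neg_right, map_add, map_neg, GHom.add_apply, GHom.neg_apply]
    conv_lhs => rw [e, e']
    abel) c
  rwa [GHom.add_apply, GHom.neg_apply, add_neg_eq_zero] at hE

end

namespace UCCAlg
variable (A : UCCAlg 𝒜) {C : CoalgData 𝒜}

/-- The equation for the pull says that a defect in Ā, from the codifferentials, equals a defect in
kη, from the curvatures. Both vanish, and `codiff_of_prOne` lifts the first from Ā[1] to Bar A. -/
theorem isHom_of_isTwisting_pull (hC : C.IsCACoalg) {g : CoalgHomData C (barData A)}
    (hδ : ∀ x, GHom.tmap g.g₁ g.g₁ (C.comul x) = (barData A).comul (g.g₁ x))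
    (hε : ∀ x, (barData A).counit (g.g₁ x) = C.counit x) (hw : g.g₁ C.aug = (barData A).aug)
    (hθ : IsTwisting C A.data (g.pull A.univTw)) : g.IsHom := by
  set L : C.C → (barData A).C := fun c => GHom.lunit _ (GHom.tmap g.g₀ g.g₁ (C.comul c)) with hL
  set R : C.C → (barData A).C := fun c => GHom.runit _ (GHom.tmap g.g₁ g.g₀ (C.comul c)) with hR
  set S : C.C → GrMod.unit 𝒜 := fun c => C.cocurv c - g.g₀ (C.codiff c) -
    GHom.lunit (GrMod.unit 𝒜) (GHom.tmap g.g₀ g.g₀ (C.comul c)) with hS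
  have key : ∀ c, A.univTw (g.g₁ (C.codiff c) + (L c - R c) - (barData A).codiff (g.g₁ c)) =
      (S c - (barData A).cocurv (g.g₁ c)) • A.data.one := by
    intro c
    have h := hθ c
    have hb := A.bCheckIncl_apply (g.g₁ c)
    have hn : (-A.data.split (A.bCheckIncl (g.g₁ c)) : GrMod.unit 𝒜) • A.data.one =
      -(A.data.split (A.bCheckIncl (g.g₁ c)) • A.data.one) := neg_smul (R := k) _ _
    rw [g.mul_tmap_pull A.isUCCAlg.isPrecurved, g.pull_apply, g.pull_apply, map_add, map_smul,
      A.isUCCAlg.diff_one, smul_zero, add_zero, hδ] at h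
    rw [hε] at hb
    rw [map_sub, map_add, map_sub, univTw_codiff, cocurv_barData, hS, sub_smul_unit, sub_smul_unit,
      sub_smul_unit, hn]
    rw [← sub_eq_zero] at h hb ⊢
    refine .trans ?_ ((congrArg₂ (· - ·) h hb).trans (sub_zero 0))
    dsimp only
    abel
  have hS0 : ∀ c, S c = (barData A).cocurv (g.g₁ c) := fun c =>
    sub_eq_zero.1 (eq_zero_of_eq_smul_one A.isUCCAlg.split_one (A.split_ofBarShift _) (key c))
  have h0 : ∀ c, GHom.prOne (A.data.bar.shift 1) (g.g₁ (C.codiff c) + (L c - R c)) =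
      GHom.prOne (A.data.bar.shift 1) ((barData A).codiff (g.g₁ c)) := fun c => by
    refine A.ofBarShift_injective (sub_eq_zero.1 ?_)
    have h := key c
    rw [hS0, sub_self, zero_smul_unit, map_sub] at h
    exact h
  refine ⟨hδ, fun c => ?_, hS0, hε, hw⟩
  set γ : GHom 0 C.C (A.data.bar.shift 1) := ((GHom.prOne (A.data.bar.shift 1)).comp g.g₁).cast
  refine codiff_of_prOne hC (γ := γ) (fun _ => rfl) ?_ hδ hε _ g.g₀ (fun c => ?_) c
  · exact (congrArg (GHom.prOne _) hw).trans GHom.prOne_one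
  · refine .trans ?_ ((h0 c).trans (GHom.prOne_coderiv _ _))
    refine (congrArg (γ (C.codiff c) + ·) ?_).trans (map_add (GHom.prOne _) _ _).symm
    refine .trans ?_ (map_sub (GHom.prOne (A.data.bar.shift 1)) (L c) (R c)).symm
    exact congrArg₂ (· - ·) (GHom.map_lunit_tmap _ _ _ _).symm (GHom.map_runit_tmap _ _ _ _).symm

theorem pull_univTw_aug {g : CoalgHomData C (barData A)} (hw : g.g₁ C.aug = (barData A).aug) :
    g.pull A.univTw C.aug = (g.g₀ C.aug : k) • A.data.one := by
  rw [g.pull_apply, hw, show A.univTw (barData A).aug = 0 from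
    (congrArg A.ofBarShift GHom.prOne_one).trans (map_zero _), zero_add]

/-- The splitting of A extracts g₀ from the cochain; the rest is the component of g₁ in Ā[1], which
determines g₁ by `T_coalgHom_ext`. -/
theorem coalgHom_ext (hC : C.IsCACoalg) {g g' : CoalgHomData C (barData A)} (hg : g.IsHom)
    (hg' : g'.IsHom) (h : ∀ c, g.pull A.univTw c = g'.pull A.univTw c) : g = g' := by
  have h₀ : ∀ c, g.g₀ c = g'.g₀ c := fun c => by
    have := congrArg A.data.split (h c)
    rw [g.pull_apply, g'.pull_apply, map_add, map_add, univTw_apply, univTw_apply,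
      split_ofBarShift, split_ofBarShift, map_smul, map_smul, A.isUCCAlg.split_one, zero_add,
      zero_add] at this
    exact (mul_one (g.g₀ c : k)).symm.trans (this.trans (mul_one (g'.g₀ c : k)))
  refine CoalgHomData.ext (T_coalgHom_ext hC hg.map_comul hg.map_counit hg'.map_comul
    hg'.map_counit hg.map_aug fun c => A.ofBarShift_injective ?_) (GHom.ext h₀)
  have := h c
  rw [g.pull_apply, g'.pull_apply, h₀] at this
  exact add_right_cancel this

/-- The component of θ in Ā becomes the corestriction γ of g₁, and its component along η becomes g₀.
-/
theorem exists_pull_eq (hC : C.IsCACoalg) {θ : GHom 1 C.C A.data.A} (hθ : IsTwisting C A.data θ)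
    {l : k} (hl : θ C.aug = l • A.data.one) :
    ∃ g : CoalgHomData C (barData A), g.IsHom ∧ ∀ c, g.pull A.univTw c = θ c := by
  have h1 := A.isUCCAlg.split_one
  set γ : GHom 0 C.C (A.data.bar.shift 1) :=
    ((GHom.sigma 1 A.data.bar).comp ((A.data.barPr h1).comp θ)).cast with hγ
  have hj : ∀ c, A.ofBarShift (γ c) = θ c - A.data.split (θ c) • A.data.one := fun c =>
    (sub_eq_add_neg _ _).symm
  -- This is where the condition at w is needed: θ(w) must have no component in Ā for the recursion
  -- to be solvable by conilpotency.
  have hγw : γ C.aug = 0 := A.ofBarShift_injective (by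
    rw [hj, hl, map_smul, h1, map_zero]
    exact (congrArg (fun a : k => l • A.data.one - a • A.data.one) (mul_one l)).trans (sub_self _))
  obtain ⟨g, hg⟩ := C.exists_fix hC (GHom.cons _) hγw
    (GHom.smulElem' C.counit (GHom.oneT_mem (A.data.bar.shift 1)) (r := 0))
  have hp : ∀ c, (CoalgHomData.mk (D := barData A) g (A.data.split.comp θ).cast).pull
      A.univTw c = θ c := fun c => by
    rw [CoalgHomData.pull_apply]
    refine (congrArg (fun x => A.ofBarShift x + A.data.split (θ c) • A.data.one)
      (prOne_of_rec hC.comul_counit hg c)).trans ?_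
    rw [hj, sub_add_cancel]
  refine ⟨⟨g, (A.data.split.comp θ).cast⟩, ?_, hp⟩
  refine A.isHom_of_isTwisting_pull hC (comul_of_rec hC hγw hg) (prZero_of_rec hg) ?_
    (fun c => ?_)
  · refine (hg _).trans ?_
    rw [hC.comul_aug, GHom.tmap_zero_fst hγw, map_zero, add_zero]
    exact (congrArg (fun a : k => a • GHom.oneT (A.data.bar.shift 1)) hC.counit_aug).trans
      (one_smul k _)
  · rw [show (CoalgHomData.mk (D := barData A) g (A.data.split.comp θ).cast).pull A.univTw = θ
      from GHom.ext hp]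
    exact hθ c

end UCCAlg

theorem AlgHomData.fCheck_apply {A B : AlgData 𝒜} (f : AlgHomData A B) (v : (A.A.shift 1).T) :
    GHom.sigmaInv 1 B.A (f.fCheck v) = GHom.prZero _ v • (f.und : k) • B.one +
      f.f₁ (GHom.sigmaInv 1 A.A (GHom.prOne _ v)) := by
  refine GHom.T_induction (p := fun v => GHom.sigmaInv 1 B.A (f.fCheck v) =
    GHom.prZero _ v • (f.und : k) • B.one +
      f.f₁ (GHom.sigmaInv 1 A.A (GHom.prOne _ v))) ?_ (fun n t => ?_) (fun x y hx hy => ?_) v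
  · simp only [map_zero, add_zero]
    exact (zero_smul_unit _).symm
  · refine (congrArg (GHom.sigmaInv 1 B.A) (GHom.desc_inj _ n t)).trans ?_
    have key : ∀ {v : (A.A.shift 1).T} {a x}, GHom.prZero _ v = a → GHom.prOne _ v = x →
        a • (f.und : k) • B.one + f.f₁ (GHom.sigmaInv 1 A.A x) =
          GHom.prZero _ v • (f.und : k) • B.one +
            f.f₁ (GHom.sigmaInv 1 A.A (GHom.prOne _ v)) := by
      rintro v a x rfl rfl; rfl
    match n with
    | 0 =>
      refine .trans ?_ (key (GHom.pr_inj_same _ 0 t) (GHom.prOne_inj_zero t))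
      exact ((congrArg (_ + ·) (map_zero f.f₁)).trans (add_zero _)).symm
    | 1 =>
      refine .trans ?_ (key (GHom.prZero_inj_succ 0 t) (GHom.prOne_inj_one t))
      exact ((congrArg (· + _) (zero_smul_unit _)).trans (zero_add _)).symm
    | n + 2 =>
      refine .trans ?_ (key (GHom.prZero_inj_succ (n + 1) t) (GHom.prOne_inj_add_two n t))
      exact ((congrArg₂ (· + ·) (zero_smul_unit _) (map_zero f.f₁)).trans (add_zero _)).symm
  · rw [map_add, map_add, hx, hy, map_add, map_add, map_add, map_add]
    refine .trans ?_ (congrArg (· + _) (add_smul (R := k) _ _ _).symm)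
    abel

section
variable {A B D : UCCAlg 𝒜} (f : A ⟶ B)

/-- Naturality of Bar A → A. The components of the pushed cochain along Ā and along kη are, by
construction, those of Bar f. -/
theorem pull_barMap (u : (barData A).C) :
    (barMap f).pull B.univTw u = f.data.push A.univTw u := by
  have h₁ : B.univTw ((barMap f).g₁ u) = f.data.f₁ (A.univTw u) -
      B.data.split (f.data.f₁ (A.univTw u)) • B.data.one :=
    (congrArg B.ofBarShift (GHom.prOne_Tmap _ u)).trans (sub_eq_add_neg _ _).symm
  have h₂ : (barMap f).g₀ u =
      B.data.split ((barData A).counit u • (f.data.und : k) • B.data.one +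
        f.data.f₁ (A.univTw u)) := by
    refine congrArg B.data.split ((f.data.fCheck_apply _).trans (congrArg₂ (· + ·) ?_ ?_))
    · exact congrArg (· • (f.data.und : k) • B.data.one) (GHom.prZero_Tmap _ u)
    · exact congrArg (fun z => f.data.f₁ (GHom.sigmaInv 1 A.data.A z)) (GHom.prOne_Tmap _ u)
  have h₃ : B.data.split ((barData A).counit u • (f.data.und : k) • B.data.one) • B.data.one =
      (barData A).counit u • (f.data.und : k) • B.data.one := by
    rw [map_smul, map_smul, B.isUCCAlg.split_one]
    refine (congrArg (fun a : k => ((barData A).counit u * a : k) • B.data.one)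
      (mul_one (f.data.und : k))).trans ?_
    exact mul_smul ((barData A).counit u : k) (f.data.und : k) B.data.one
  rw [CoalgHomData.pull_apply, AlgHomData.push_apply, h₁, h₂, map_add]
  refine (congrArg (_ + ·) (add_smul (R := k) _ _ _)).trans ?_
  refine .trans ?_ (congrArg (f.data.f₁ (A.univTw u) + ·) h₃)
  dsimp only
  abel

theorem isHom_barMap : (barMap f).IsHom := by
  refine B.isHom_of_isTwisting_pull A.isCACoalg_barData (fun u => (GHom.cut_Tmap _ u).symm)
    (GHom.prZero_Tmap _) (GHom.Tmap_one _) ?_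
  rw [show (barMap f).pull B.univTw = f.data.push A.univTw from GHom.ext (pull_barMap f)]
  exact A.isTwisting_univTw.push A.barData_isPrecurved B.isUCCAlg.isPrecurved f.isHom

end

variable (𝒜) in
-- Conilpotency of Bar A allows morphisms into a bar construction to be compared by their cochains,
-- and pulling back along Bar f amounts to pushing along f.
theorem barIsFunctor : BarIsFunctor 𝒜 where
  obj A := A.isCACoalg_barData
  map := isHom_barMap
  map_id A := by
    refine A.coalgHom_ext A.isCACoalg_barData (isHom_barMap _) (CoalgHomData.isHom_id _)
      fun u => ?_
    rw [pull_barMap, CoalgHomData.pull_id]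
    exact AlgHomData.push_id _ u
  map_comp {A B D} f g := by
    refine D.coalgHom_ext A.isCACoalg_barData (isHom_barMap _)
      ((isHom_barMap f).comp (isHom_barMap g)) fun u => ?_
    rw [pull_barMap, CoalgHomData.pull_comp,
      CoalgHomData.pull_congr (barMap f) (pull_barMap g),
      ← AlgHomData.push_pull g.isHom.map_one (isHom_barMap f).map_counit,
      AlgHomData.push_congr g.data (pull_barMap f)]
    exact AlgHomData.push_comp f.data g.isHom _ u

end barFunctor

section adjunction
variable {k : Type u} [Ring k] {𝒜 : ℤ → AddSubgroup k} [GradedRing 𝒜] [StronglyCommutative 𝒜]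

/-! ### The adjunction -/

/-- Twisting cochains `θ : C → A` with `w θ ∈ k η`. -/
def TwistingCochain (C : CACoalg 𝒜) (A : UCCAlg 𝒜) : Type u :=
  {θ : GHom 1 C.data.C A.data.A // IsTwisting C.data A.data θ ∧
    ∃ l : 𝒜 1, θ C.data.aug = (l : k) • A.data.one}

variable (hBar : BarIsFunctor 𝒜) (hCobar : CobarIsFunctor 𝒜) (C : CACoalg 𝒜) (A : UCCAlg 𝒜)

/-- The twisting cochain of a morphism `Cobar C → A`. -/
noncomputable def twOfAlgHom (f : (Cobar hCobar).obj C ⟶ A) : TwistingCochain C A :=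
  ⟨f.data.push C.univTw, C.isTwisting_univTw.push C.isCACoalg.isPrecurved A.isUCCAlg.isPrecurved
    f.isHom, f.data.und, C.push_univTw_aug f.data⟩

/-- The twisting cochain of a morphism `C → Bar A`. -/
noncomputable def twOfCoalgHom (g : C ⟶ (Bar hBar).obj A) : TwistingCochain C A :=
  ⟨g.data.pull A.univTw, A.isTwisting_univTw.pull A.isUCCAlg.isPrecurved g.isHom,
    ⟨g.data.g₀ C.data.aug, by simpa using g.data.g₀.map_mem C.data.aug_mem⟩,
    A.pull_univTw_aug g.isHom.map_aug⟩

theorem twOfAlgHom_bijective : Function.Bijective (twOfAlgHom hCobar C A) := by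
  constructor
  · intro f g h
    exact UCCAlg.Hom.ext (C.algHom_ext A.isUCCAlg.split_one f.isHom g.isHom
      fun c => DFunLike.congr_fun (congrArg Subtype.val h) c)
  · rintro ⟨θ, hθ, l, hl⟩
    -- The scalar l with θ(w) = l·1 becomes the component `und`.
    refine ⟨⟨C.ofTw θ l, C.isHom_ofTw A.isUCCAlg.isPrecurved hθ hl⟩, Subtype.ext (GHom.ext ?_)⟩
    exact C.push_eq_of_aug (f := C.ofTw θ l) (C.ofTw_inj₁ A.isUCCAlg.isPrecurved θ l) hl

theorem twOfCoalgHom_bijective : Function.Bijective (twOfCoalgHom hBar C A) := by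
  constructor
  · intro f g h
    exact CACoalg.Hom.ext (A.coalgHom_ext C.isCACoalg f.isHom g.isHom
      fun c => DFunLike.congr_fun (congrArg Subtype.val h) c)
  · rintro ⟨θ, hθ, l, hl⟩
    obtain ⟨g, hg, h⟩ := A.exists_pull_eq C.isCACoalg hθ hl
    exact ⟨⟨g, hg⟩, Subtype.ext (GHom.ext h)⟩

/-- The bijection `Hom(Cobar C, A) ≃ Hom(C, Bar A)`. -/
noncomputable def cobarBarEquiv :
    ((Cobar hCobar).obj C ⟶ A) ≃ (C ⟶ (Bar hBar).obj A) :=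
  (Equiv.ofBijective _ (twOfAlgHom_bijective hCobar C A)).trans
    (Equiv.ofBijective _ (twOfCoalgHom_bijective hBar C A)).symm

variable {C A}

/-- Corresponding morphisms are those with the same cochain; both naturality squares are checked in
this form. -/
theorem cobarBarEquiv_eq_iff (f : (Cobar hCobar).obj C ⟶ A) (g : C ⟶ (Bar hBar).obj A) :
    cobarBarEquiv hBar hCobar C A f = g ↔
      ∀ c, f.data.push C.univTw c = g.data.pull A.univTw c := by
  refine Iff.trans (b := twOfAlgHom hCobar C A f = twOfCoalgHom hBar C A g)
    ((Equiv.ofBijective _ (twOfCoalgHom_bijective hBar C A)).symm_apply_eq) ⟨fun h c => ?_, fun h => ?_⟩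
  · exact DFunLike.congr_fun (congrArg Subtype.val h) c
  · exact Subtype.ext (GHom.ext h)

/-- The cobar construction is left adjoint to the bar construction. -/
noncomputable def cobarBarAdjunction : Cobar hCobar ⊣ Bar hBar :=
  Adjunction.mkOfHomEquiv
    { homEquiv := cobarBarEquiv hBar hCobar
      homEquiv_naturality_left_symm := fun {C D A} f g => by
        -- Passing to a preimage h removes the inverse bijection; the square then follows by
        -- exchanging the push along Cobar f for the pull along f.
        obtain ⟨h, rfl⟩ := (cobarBarEquiv hBar hCobar D A).surjective g
        rw [Equiv.symm_apply_apply, Equiv.symm_apply_eq]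
        refine ((cobarBarEquiv_eq_iff hBar hCobar _ _).2 fun c => ?_).symm
        have hh := (cobarBarEquiv_eq_iff hBar hCobar h _).1 rfl
        refine ((cobarMap f).push_comp h.isHom C.univTw c).trans ?_
        refine (h.data.push_congr (push_cobarMap f) c).trans ?_
        refine (AlgHomData.push_pull h.isHom.map_one f.isHom.map_counit _ c).trans ?_
        refine (f.data.pull_congr hh c).trans ?_
        exact (CoalgHomData.pull_comp f.data _ A.univTw c).symm
      homEquiv_naturality_right := fun {C A B} f g => by
        -- Pushing along g is exchanged for pulling back along Bar g by `pull_barMap`.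
        refine (cobarBarEquiv_eq_iff hBar hCobar _ _).2 fun c => ?_
        have hf := (cobarBarEquiv_eq_iff hBar hCobar f _).1 rfl
        set h := cobarBarEquiv hBar hCobar C A f
        refine (f.data.push_comp g.isHom C.univTw c).trans ?_
        refine (g.data.push_congr hf c).trans ?_
        refine (AlgHomData.push_pull g.isHom.map_one h.isHom.map_counit _ c).trans ?_
        refine (h.data.pull_congr (fun u => (pull_barMap g u).symm) c).trans ?_
        exact (CoalgHomData.pull_comp h.data (barMap g) B.univTw c).symm }

end adjunction

end CurvedBarCobar

open CategoryTheory CurvedBarCobar in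
theorem mainTheorem1 {k : Type*} [Ring k] (𝒜 : ℤ → AddSubgroup k) [GradedRing 𝒜]
    [StronglyCommutative 𝒜] :
    ∃ (hBar : BarIsFunctor 𝒜) (hCobar : CobarIsFunctor 𝒜),
      Nonempty (Cobar hCobar ⊣ Bar hBar) :=
  ⟨barIsFunctor 𝒜, cobarIsFunctor 𝒜, ⟨cobarBarAdjunction _ _⟩⟩
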